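/- **Notation.** Points of $\mathbb R^2$ are $x=(x_1,x_2)$; $D=\partial_{x_1}-\partial_t$ and $\Box=\partial_t^2-\partial_{x_1}^2$ (no $\partial_{x_2}^2$ term). For $s\ge 0$, $\|g\|_{H^s}=\|(1+|\xi|^2)^{s/2}\hat g\|_{L^2(\mathbb R^2)}\in[0,\infty]$, with value $\infty$ if $g\notin L^2(\mathbb R^2)$. **Data.** Let $\alpha,\delta>0$. For $\varepsilon>0$ let $\psi_\varepsilon\in C^\infty(\mathbb R;[0,1])$ with $\psi_\varepsilon=0$ on $[0,\varepsilon/2]$, $\psi_\varepsilon=1$ on $[\varepsilon,\infty)$ and $|\partial^k\psi_\varepsilon|\le C(k)\varepsilon^{-k}$ for all $k\ge 0$, with $C(k)$ independent of $\varepsilon$. Let $$\Omega_0=\Big\{x_1\ge 0,\ |x_2|\le \tfrac{\sqrt{x_1}}{|\ln x_1|^{\delta}}\Big\}\cap[0,\tfrac12]\times[0,\tfrac12],$$ and for $0<\varepsilon<\frac12$ let $\chi_\varepsilon\in C_c^\infty(\mathbb R^2)$ satisfy $\chi_\varepsilon(x)=-\int_0^{x_1}\psi_\varepsilon(s)|\ln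 s|^\alpha\,ds$ for $x\in\Omega_0$. Let $\tilde u_0\in H^4(\mathbb R^2)$, $\tilde u_1\in H^3(\mathbb R^2)$ (identified with their continuous representatives) be real-valued, and let $f\in C^\infty(\mathbb R\times\mathbb R^2\times\mathbb R\times\mathbb R;\mathbb R)$ be bounded together with each of its derivatives. Assume that for some $\kappa<1$, for all $0<\varepsilon<\frac12$ and $x\in\mathbb R^2$, $$\chi_\varepsilon(x)+\partial_{x_1}\tilde u_0(x)-\tilde u_1(x)\le\kappa ,$$ i.e. the initial value of $Du$ stays below the degenerate value $1$, uniformly. **Problem.** For $T>0$ consider on $[0,T)\times\mathbb R^2$ $$\Box u=Du\,D^2u+f(t,x_1,x_2,u,Du),\qquad u|_{t=0}=\tilde u_0,\quad \partial_tu|_{t=0}=-\chi_\varepsilon+\tilde u_1 .\qquad(P_\varepsilon)$$ (This contains both sources of the form $f(t,x_1,x_2,u)$ and sources of the form $f(t,x_1,x_2,Du)$.) A classical solution is a real function $u$ which, together with its derivatives up to order two in $(t,x_1)$, exists and is continuous on $[0,T)\times\mathbb R^2$, satisfies $(P_\varepsilon)$ pointwise and $Du\ne1$ everywhere. **Theorem.**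 There are $\varepsilon_0>0$ and times $t_\varepsilon$ with $t_\varepsilon\to0$ as $\varepsilon\to0^+$ such that for every $0<\varepsilon<\min(\varepsilon_0,\frac12)$: $t_\varepsilon>0$, $(P_\varepsilon)$ has exactly one classical solution $u_\varepsilon$ on $[0,t_\varepsilon)\times\mathbb R^2$, and $$\|u_\varepsilon(0,\cdot)\|_{H^{11/4}(\mathbb R^2)}<\infty,\qquad \|u_\varepsilon(t,\cdot)\|_{H^{11/4}(\mathbb R^2)}\to\infty\ \text{ as } t\uparrow t_\varepsilon .$$ Moreover the blow-up is local: there is $\theta\in C_c^\infty(\mathbb R^2)$ with $\|\theta\,u_\varepsilon(t,\cdot)\|_{H^{11/4}(\mathbb R^2)}\to\infty$ as $t\uparrow t_\varepsilon$. -/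

import Mathlib

open Set Filter Topology MeasureTheory
open scoped ENNReal ContDiff FourierTransform

noncomputable section

/-- The space `ℝ²` with its Euclidean norm; `x 0` is the variable `x₁`, `x 1` is the variable `x₂`. -/
abbrev Plane := EuclideanSpace ℝ (Fin 2)

open Classical in
/-- The extended `H^s(ℝ²)` norm (`s ≥ 0`): the `L²` norm of `(1 + |ξ|²)^{s/2} ĝ(ξ)`, where `ĝ` is the
Plancherel (`L²`) Fourier transform of `g`; it is `∞` when `g` is not in `L²(ℝ²)`. -/
def sobolevNorm (s : ℝ) (g : Plane → ℝ) : ℝ≥0∞ :=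
  if h : MemLp (fun x => (g x : ℂ)) 2 (volume : Measure Plane) then
    eLpNorm (fun ξ : Plane =>
      (((1 + ‖ξ‖ ^ 2) ^ (s / 2) : ℝ) : ℂ) * (𝓕 (h.toLp (fun x => (g x : ℂ)))) ξ) 2 volume
  else ⊤

/-- The time derivative of a function on `[0, ∞) × ℝ²` (one-sided at `t = 0`). -/
def dt (w : ℝ → Plane → ℝ) (t : ℝ) (x : Plane) : ℝ :=
  derivWithin (fun s => w s x) (Ici 0) t

/-- The derivative with respect to `x₁`. -/
def dx1 (w : ℝ → Plane → ℝ) (t : ℝ) (x : Plane) : ℝ :=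
  lineDeriv ℝ (w t) x (EuclideanSpace.single 0 1)

/-- The operator `D = ∂_{x₁} - ∂_t`. -/
def opD (w : ℝ → Plane → ℝ) (t : ℝ) (x : Plane) : ℝ := dx1 w t x - dt w t x

/-- The wave operator in the variables `(t, x₁)`: `□ = ∂_t² - ∂_{x₁}²`. -/
def box (w : ℝ → Plane → ℝ) (t : ℝ) (x : Plane) : ℝ := dt (dt w) t x - dx1 (dx1 w) t x

/-- `w` has partial derivatives in `t` and `x₁` on `[0, T) × ℝ²`, and `w` and these derivatives are
jointly continuous there. -/
structure IsC1 (T : ℝ) (w : ℝ → Plane → ℝ) : Prop where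
  cont : ContinuousOn (Function.uncurry w) (Ico 0 T ×ˢ univ)
  diff_t : ∀ t ∈ Ico 0 T, ∀ x, DifferentiableWithinAt ℝ (fun s => w s x) (Ici 0) t
  diff_x : ∀ t ∈ Ico 0 T, ∀ x, LineDifferentiableAt ℝ (w t) x (EuclideanSpace.single 0 1)
  cont_t : ContinuousOn (Function.uncurry (dt w)) (Ico 0 T ×ˢ univ)
  cont_x : ContinuousOn (Function.uncurry (dx1 w)) (Ico 0 T ×ˢ univ)

/-- `u` is a classical solution on `[0, T) × ℝ²` of
`□u = Du D²u + f(t, x, u, Du)`, `u(0) = a`, `∂_t u(0) = b`, with `Du ≠ 1`. It is `C²` in `(t, x₁)`,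
which are the only variables with respect to which the equation differentiates. -/
structure IsClassicalSolution (f : ℝ × Plane × ℝ × ℝ → ℝ) (a b : Plane → ℝ) (T : ℝ)
    (u : ℝ → Plane → ℝ) : Prop where
  c1 : IsC1 T u
  c1_t : IsC1 T (dt u)
  c1_x : IsC1 T (dx1 u)
  ne_one : ∀ t ∈ Ico 0 T, ∀ x, opD u t x ≠ 1
  eqn : ∀ t ∈ Ico 0 T, ∀ x,
    box u t x = opD u t x * opD (opD u) t x + f (t, x, u t x, opD u t x)
  init : ∀ x, u 0 x = a x
  init_t : ∀ x, dt u 0 x = b x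

/-- The family of cutoffs `ψ_ε`: smooth, `0` on `[0, ε/2]`, `1` on `[ε, ∞)`, with values in `[0,1]`
and `|∂^k ψ_ε| ≤ C(k) ε^{-k}`. -/
structure IsCutoffFamily (ψ : ℝ → ℝ → ℝ) : Prop where
  smooth : ∀ ε > 0, ContDiff ℝ ∞ (ψ ε)
  eq_zero : ∀ ε > 0, ∀ s ∈ Icc 0 (ε / 2), ψ ε s = 0
  eq_one : ∀ ε > 0, ∀ s ≥ ε, ψ ε s = 1
  mem_Icc : ∀ ε > 0, ∀ s, ψ ε s ∈ Icc (0 : ℝ) 1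
  bound : ∀ k : ℕ, ∃ C : ℝ, ∀ ε > 0, ∀ s, |iteratedDeriv k (ψ ε) s| ≤ C / ε ^ k

/-- The region `Ω₀ = {x₁ ≥ 0, |x₂| ≤ √x₁ / |ln x₁|^δ} ∩ [0,1/2] × [0,1/2]`. -/
def omegaZero (δ : ℝ) : Set Plane :=
  {x | 0 ≤ x 0 ∧ |x 1| ≤ √(x 0) / |Real.log (x 0)| ^ δ} ∩
    {x | x 0 ∈ Icc (0 : ℝ) (1 / 2) ∧ x 1 ∈ Icc (0 : ℝ) (1 / 2)}

/-- `χ_ε` (`0 < ε < 1/2`) is a smooth compactly supported function on `ℝ²` that equals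
`-∫_0^{x₁} ψ_ε(s) |ln s|^α ds` on `Ω₀`. -/
structure IsDataFamily (α δ : ℝ) (ψ : ℝ → ℝ → ℝ) (χ : ℝ → Plane → ℝ) : Prop where
  smooth : ∀ ε ∈ Ioo (0 : ℝ) (1 / 2), ContDiff ℝ ∞ (χ ε)
  compact : ∀ ε ∈ Ioo (0 : ℝ) (1 / 2), HasCompactSupport (χ ε)
  eq_on : ∀ ε ∈ Ioo (0 : ℝ) (1 / 2), ∀ x ∈ omegaZero δ,
    χ ε x = -∫ s in (0 : ℝ)..(x 0), ψ ε s * |Real.log s| ^ α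

end

/-! For fixed q = x₂ the problem is one-dimensional. In the null coordinates y = x₁ + t, z = x₁ − t
one has Du = 2∂_z u, and v = Du satisfies a Burgers equation v_y + v v_z = −F with F = f/2
(`charSource`) and v = v₀ on the diagonal y = z, that is, at t = 0. Characteristics are labelled by
the point ξ of the diagonal where they start. Along them Z_y = V and V_y = −F, while J = Z_ξ and P =
V_ξ obey J_y = P and a linear equation for P; differentiating the diagonal conditions gives J = 1 −
v₀ and P = v₀' + F at y = ξ. Since u_z = v/2, the value U of u is recovered at fixed y from U_ξ =
VJ/2. This system, nonlocal through U, has a global solution (`exists_lagrangeSol`). All singular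
behaviour comes from inverting (y, ξ) ↦ (y, t) with t = (y − Z)/2, whose ξ-derivative is −J/2.

Focusing. The data are prescribed on Ω₀, of which only the axis x₂ = 0 is needed: at (ε, 0) the
x₁-derivative of χ_ε is −|ln ε|^α while χ_ε itself stays bounded. So P starts out very negative at
the label ε, and J vanishes on that characteristic within a time of order |ln ε|^(−α)
(`exists_J_nonpos`). Outside the support of χ_ε the data are bounded uniformly in ε, so J stays
positive there on a strip of fixed width; compactness then yields a first focusing time T and a
point where J = 0 (`exists_focusPoint`), not necessarily on the axis. Before T the inversion is C¹
and produces a classical solution (`isClassicalSolution_eul`). Uniqueness comes from a maximum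
principle on domains of determinacy (`IsClassicalSolution.unique`), once 1 − Du is known to stay
away from 0.

Blow-up. At the focusing point J = 0, and linearity of the (J, P) system forces P ≠ 0. The function
H = u_{x₁} is regular in Lagrangian coordinates and there H_ξ = P(1 − V)/2 ≠ 0, so between the
labels ξ and ξ + δ it changes by an amount comparable to δ. The data have 3/4-Hölder highest
derivatives, hence so is J in the label, and at time T these labels lie within O(δ^(7/4)) of each
other in space (`exists_near`). Thus u_{x₁} cannot be 2/3-Hölder up to T, because (7/4)(2/3) = 7/6 >
1. But H^(11/4)(ℝ²) controls exactly such a norm of u_{x₁} (`exists_holder_of_sobolevNorm`), and a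
bound along any sequence of times tending to T would pass to the limit
(`exists_holder_of_frequently`). The argument only looks at a neighbourhood of one point, so it is
insensitive to a cutoff θ. -/

/-! ### Fourier representation and Hölder embedding of H^s(ℝ²) -/

/-- The `L²` inverse Fourier transform of an integrable function is given by the integral. -/
theorem MeasureTheory.Lp.fourierInv_ae_eq_of_integrable
    (F : Lp (α := Plane) ℂ 2 (volume : Measure Plane)) (hF : Integrable (F : Plane → ℂ)) :
    ((𝓕⁻ F : Lp (α := Plane) ℂ 2 (volume : Measure Plane)) : Plane → ℂ)
      =ᵐ[volume] 𝓕⁻ (F : Plane → ℂ) := by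
  have hcont : Continuous (𝓕⁻ (F : Plane → ℂ)) := by
    have h1 : MemLp (F : Plane → ℂ) 1 := memLp_one_iff_integrable.2 hF
    rw [← Real.Lp.fourierTransformInv_toLp h1]
    exact (Real.Lp.fourierTransformInv h1.toLp).continuous
  -- Tested against a smooth compactly supported g: the L² inverse transform agrees with the
  -- distributional one, which is defined by duality, and Fubini moves the transform back from the
  -- test function to F.
  apply ae_eq_of_integral_contDiff_smul_eq
  · exact (Lp.memLp _).locallyIntegrable (by norm_num)
  · exact hcont.locallyIntegrable
  intro g hg hgs
  have hg' : ContDiff ℝ ∞ (fun x => (g x : ℂ)) := Complex.ofRealCLM.contDiff.comp hg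
  have hgs' : HasCompactSupport (fun x => (g x : ℂ)) :=
    hgs.comp_left (g := fun r : ℝ => (r : ℂ)) (by simp)
  set φ : SchwartzMap Plane ℂ := hgs'.toSchwartzMap hg' with hφ
  have hφx : ∀ x, φ x = (g x : ℂ) := fun x => rfl
  have h1 : ∫ x, g x • (𝓕⁻ F : Lp (α := Plane) ℂ 2 (volume : Measure Plane)) x =
      Lp.toTemperedDistribution (𝓕⁻ F : Lp (α := Plane) ℂ 2 (volume : Measure Plane)) φ := by
    rw [Lp.toTemperedDistribution_apply]
    exact integral_congr_ae (Eventually.of_forall fun x => by simp [hφx])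
  rw [h1, ← Lp.fourierInv_toTemperedDistribution_eq, TemperedDistribution.fourierInv_apply,
    Lp.toTemperedDistribution_apply]
  have h2 := VectorFourier.integral_fourierIntegral_smul_eq_flip (L := -innerₗ Plane)
    (μ := (volume : Measure Plane)) (ν := (volume : Measure Plane))
    (f := (φ : Plane → ℂ)) (g := (F : Plane → ℂ)) Real.continuous_fourierChar
    (by
      show Continuous fun p : Plane × Plane => -(inner ℝ p.1 p.2)
      fun_prop) φ.integrable hF
  have h3 : ∀ (f : Plane → ℂ) (x : Plane), 𝓕⁻ f x =
      VectorFourier.fourierIntegral Real.fourierChar volume (-innerₗ Plane) f x := by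
    intro f x
    rw [Real.fourierInv_eq]
    simp [VectorFourier.fourierIntegral]
  have h4 : (-innerₗ Plane).flip = -innerₗ Plane := by
    ext x y
    simp [real_inner_comm]
  rw [h4] at h2
  simp only [← h3] at h2
  rw [SchwartzMap.fourierInv_coe, h2]
  exact integral_congr_ae (Eventually.of_forall fun x => by simp [hφx])

/-- Functions with finite `H^s(ℝ²)` norm have an absolutely convergent Fourier representation with
weight of any order `σ < s - 1`. -/
theorem exists_fourier_repr {s σ : ℝ} (hσ0 : 0 ≤ σ) (hσ : σ < s - 1) :
    ∃ C : ℝ, 0 ≤ C ∧ ∀ g : Plane → ℝ, Continuous g → sobolevNorm s g < ⊤ →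
      ∃ F : Plane → ℂ, Integrable F ∧ Integrable (fun ξ => (1 + ‖ξ‖ ^ 2) ^ (σ / 2) * ‖F ξ‖) ∧
        ∫ ξ, (1 + ‖ξ‖ ^ 2) ^ (σ / 2) * ‖F ξ‖ ≤ C * (sobolevNorm s g).toReal ∧
        ∀ x, (g x : ℂ) = 𝓕⁻ F x := by
  -- Cauchy–Schwarz: the weighted modulus of F is W times the modulus of a function of L² norm
  -- ‖g‖_{H^s}, and W² = (1 + |ξ|²)^(σ − s) is integrable on ℝ² because s − σ > 1.
  set W : Plane → ℝ := fun ξ => (1 + ‖ξ‖ ^ 2) ^ ((σ - s) / 2) with hW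
  have hWc : Continuous W := by
    refine Continuous.rpow_const (by fun_prop) fun x => Or.inl (by positivity)
  have hWm : MemLp W 2 := by
    rw [memLp_two_iff_integrable_sq hWc.aestronglyMeasurable]
    have := integrable_rpow_neg_one_add_norm_sq (E := Plane) (μ := volume) (r := 2 * (s - σ))
      (by simp; linarith)
    refine this.congr (Eventually.of_forall fun x => ?_)
    simp only [hW]
    rw [← Real.rpow_natCast (_ ^ ((σ - s) / 2)), ← Real.rpow_mul (by positivity)]
    congr 1
    push_cast
    ring
  refine ⟨(eLpNorm W 2 volume).toReal, ENNReal.toReal_nonneg, fun g hg hs => ?_⟩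
  unfold sobolevNorm at hs ⊢
  split_ifs at hs ⊢ with h
  swap
  · simp at hs
  set F : Lp (α := Plane) ℂ 2 (volume : Measure Plane) := 𝓕 (h.toLp (fun x => (g x : ℂ))) with hF
  set H : Plane → ℂ := fun ξ => (((1 + ‖ξ‖ ^ 2) ^ (s / 2) : ℝ) : ℂ) * F ξ with hH
  have hHm : AEStronglyMeasurable H volume := by
    refine AEStronglyMeasurable.mul ?_ (Lp.aestronglyMeasurable F)
    refine Continuous.aestronglyMeasurable (Complex.continuous_ofReal.comp ?_)
    exact Continuous.rpow_const (by fun_prop) fun x => Or.inl (by positivity)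
  have hHL : MemLp H 2 := ⟨hHm, hs⟩
  have hkey : ∀ ξ, (1 + ‖ξ‖ ^ 2) ^ (σ / 2) * ‖F ξ‖ = ‖W ξ • H ξ‖ := by
    intro ξ
    have hp : (0 : ℝ) < 1 + ‖ξ‖ ^ 2 := by positivity
    rw [norm_smul, hH, norm_mul, Complex.norm_real, Real.norm_of_nonneg (by positivity),
      Real.norm_of_nonneg (by positivity), ← mul_assoc, hW, ← Real.rpow_add hp]
    congr 2
    ring
  have hWH : MemLp (W • H) 1 := hHL.smul hWm
  have hint : Integrable (fun ξ => (1 + ‖ξ‖ ^ 2) ^ (σ / 2) * ‖F ξ‖) :=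
    (memLp_one_iff_integrable.1 hWH).norm.congr (Eventually.of_forall fun ξ => (hkey ξ).symm)
  have hFi : Integrable (F : Plane → ℂ) := by
    refine hint.mono (Lp.aestronglyMeasurable F) (Eventually.of_forall fun ξ => ?_)
    rw [norm_mul, norm_norm]
    refine le_mul_of_one_le_left (norm_nonneg _) ?_
    rw [Real.norm_of_nonneg (by positivity)]
    exact Real.one_le_rpow (by nlinarith [sq_nonneg ‖ξ‖]) (by positivity)
  refine ⟨F, hFi, hint, ?_, ?_⟩
  · have h1 : eLpNorm (W • H) 1 volume ≤ eLpNorm W 2 volume * eLpNorm H 2 volume :=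
      eLpNorm_smul_le_mul_eLpNorm hHm hWc.aestronglyMeasurable
    have h2 : ∫ ξ, (1 + ‖ξ‖ ^ 2) ^ (σ / 2) * ‖F ξ‖ = (eLpNorm (W • H) 1 volume).toReal := by
      simp_rw [hkey]
      rw [eLpNorm_one_eq_lintegral_enorm, ← integral_norm_eq_lintegral_enorm hWH.1]
      rfl
    rw [h2, ← ENNReal.toReal_mul]
    exact ENNReal.toReal_mono (ENNReal.mul_ne_top hWm.2.ne hs.ne) h1
  · have h1 : (fun x => (g x : ℂ)) =ᵐ[volume] 𝓕⁻ (F : Plane → ℂ) := by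
      have e1 := h.coeFn_toLp
      have e2 := Lp.fourierInv_ae_eq_of_integrable F hFi
      rw [hF, FourierTransform.fourierInv_fourier_eq, ← hF] at e2
      exact e1.symm.trans e2
    have hcont : Continuous (𝓕⁻ (F : Plane → ℂ)) := by
      have h1 : MemLp (F : Plane → ℂ) 1 := memLp_one_iff_integrable.2 hFi
      rw [← Real.Lp.fourierTransformInv_toLp h1]
      exact (Real.Lp.fourierTransformInv h1.toLp).continuous
    have := (Continuous.ae_eq_iff_eq volume (Complex.continuous_ofReal.comp hg) hcont).1 h1
    exact fun x => congrFun this x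

/-- The vector `e₁`. -/
noncomputable abbrev e₁ : Plane := EuclideanSpace.single 0 1

/-- Multiplication by `2πi ξ₁` on the Fourier side. -/
noncomputable def fourierDx1 (F : Plane → ℂ) (ξ : Plane) : ℂ := (2 * Real.pi * Complex.I * (ξ 0 : ℂ)) * F ξ

theorem norm_fourierDx1_le (F : Plane → ℂ) (ξ : Plane) :
    ‖fourierDx1 F ξ‖ ≤ 2 * Real.pi * ((1 + ‖ξ‖ ^ 2) ^ (1 / 2 : ℝ) * ‖F ξ‖) := by
  have h1 : |ξ 0| ≤ ‖ξ‖ := by simpa using PiLp.norm_apply_le ξ 0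
  have h2 : ‖ξ‖ ≤ (1 + ‖ξ‖ ^ 2) ^ (1 / 2 : ℝ) := by
    rw [← Real.sqrt_eq_rpow]
    exact Real.le_sqrt_of_sq_le (by linarith)
  have h3 : ‖fourierDx1 F ξ‖ = 2 * Real.pi * (|ξ 0| * ‖F ξ‖) := by
    simp [fourierDx1, abs_of_pos Real.pi_pos, mul_assoc]
  rw [h3]
  have := Real.pi_pos
  gcongr
  exact h1.trans h2

theorem aestronglyMeasurable_fourierDx1 {F : Plane → ℂ} (hF : AEStronglyMeasurable F volume) :
    AEStronglyMeasurable (fourierDx1 F) volume := by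
  unfold fourierDx1
  exact AEStronglyMeasurable.mul (Continuous.aestronglyMeasurable (by fun_prop)) hF

theorem hasDerivAt_fourierInv_line {F : Plane → ℂ} (hF : Integrable F)
    (hF' : Integrable fun ξ : Plane => ‖ξ‖ * ‖F ξ‖) (x : Plane) :
    HasDerivAt (fun r : ℝ => 𝓕⁻ F (x + r • e₁)) (𝓕⁻ (fourierDx1 F) x) 0 := by
  have h1 := Real.hasFDerivAt_fourier hF hF' (-x)
  have h2 : HasDerivAt (fun r : ℝ => -(x + r • e₁)) (-e₁) 0 := by
    have := (((hasDerivAt_id (0 : ℝ)).smul_const e₁).const_add x).neg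
    rw [one_smul] at this
    exact this
  have h3 := HasFDerivAt.comp_hasDerivAt (0 : ℝ) (by simpa using h1) h2
  simp only [Real.fourierInv_eq_fourier_neg]
  have hi : Integrable (VectorFourier.fourierSMulRight (innerSL ℝ) F) := by
    refine (hF'.const_mul (2 * Real.pi * ‖innerSL (E := Plane) ℝ‖)).mono'
      hF.1.fourierSMulRight (Eventually.of_forall fun ξ => ?_)
    refine (VectorFourier.norm_fourierSMulRight_le _ _ _).trans (le_of_eq (by ring))
  rw [Real.fourier_continuousLinearMap_apply hi] at h3
  have hfun : fourierDx1 F =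
      fun ξ => VectorFourier.fourierSMulRight (innerSL ℝ) F ξ (-e₁) := by
    ext ξ
    have h4 : innerSL ℝ ξ e₁ = ξ 0 := by
      rw [innerSL_apply_apply, EuclideanSpace.inner_single_right]
      simp
    simp only [VectorFourier.fourierSMulRight_apply, fourierDx1, map_neg, h4]
    simp
    ring
  rw [hfun]
  exact h3

/-- Interpolation between the Lipschitz bound r = 2π|a − b| and the trivial bound 2: according as r
≤ 1 or r ≥ 1, one or the other is at most 2r^γ. -/
theorem norm_fourierChar_sub_le {γ : ℝ} (hγ0 : 0 < γ) (hγ1 : γ ≤ 1) (a b : ℝ) :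
    ‖((Real.fourierChar a : Circle) : ℂ) - (Real.fourierChar b : Circle)‖ ≤
      2 * (2 * Real.pi * |a - b|) ^ γ := by
  have h1 : ‖((Real.fourierChar a : Circle) : ℂ) - (Real.fourierChar b : Circle)‖ ≤
      2 * Real.pi * |a - b| := by
    have : a = b + (a - b) := by ring
    nth_rw 1 [this]
    rw [AddChar.map_add_eq_mul, Circle.coe_mul, ← mul_sub_one, norm_mul, Circle.norm_coe, one_mul,
      Real.fourierChar_apply]
    have := Real.norm_exp_I_mul_ofReal_sub_one_le (x := 2 * Real.pi * (a - b))
    rw [mul_comm] at this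
    refine this.trans (le_of_eq ?_)
    rw [Real.norm_eq_abs, abs_mul, abs_of_pos (by positivity)]
  have h2 : ‖((Real.fourierChar a : Circle) : ℂ) - (Real.fourierChar b : Circle)‖ ≤ 2 := by
    refine (norm_sub_le _ _).trans ?_
    rw [Circle.norm_coe, Circle.norm_coe]
    norm_num
  have h0 : 0 ≤ 2 * Real.pi * |a - b| := by positivity
  rcases le_total (2 * Real.pi * |a - b|) 1 with h | h
  · have := Real.rpow_le_rpow_of_exponent_ge' h0 h hγ0.le hγ1
    rw [Real.rpow_one] at this
    have h3 : 0 ≤ (2 * Real.pi * |a - b|) ^ γ := by positivity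
    linarith
  · have := Real.one_le_rpow h hγ0.le
    linarith

/-- The Hölder bound on characters is integrated against |F|; the factor (2π)^γ is replaced by 2π,
using γ ≤ 1. -/
theorem norm_fourierInv_sub_le {F : Plane → ℂ} {γ : ℝ} (hγ0 : 0 < γ) (hγ1 : γ ≤ 1)
    (hF : Integrable F) (hF' : Integrable fun ξ : Plane => (1 + ‖ξ‖ ^ 2) ^ (γ / 2) * ‖F ξ‖)
    (x y : Plane) :
    ‖𝓕⁻ F x - 𝓕⁻ F y‖ ≤
      2 * (2 * Real.pi) * (∫ ξ, (1 + ‖ξ‖ ^ 2) ^ (γ / 2) * ‖F ξ‖) * ‖x - y‖ ^ γ := by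
  have hpi := Real.pi_gt_three
  have hint : ∀ z : Plane, Integrable fun ξ : Plane => Real.fourierChar (inner ℝ ξ z) • F ξ := by
    intro z
    refine hF.mono (AEStronglyMeasurable.smul (Continuous.aestronglyMeasurable ?_) hF.1)
      (Eventually.of_forall fun ξ => by simp [Circle.norm_smul])
    have h1 : Continuous fun ξ : Plane => inner ℝ ξ z := continuous_id.inner continuous_const
    exact continuous_induced_dom.comp (Real.continuous_fourierChar.comp h1)
  rw [Real.fourierInv_eq, Real.fourierInv_eq, ← integral_sub (hint x) (hint y),
    ← integral_const_mul, ← integral_mul_const]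
  refine norm_integral_le_of_norm_le ((hF'.const_mul _).mul_const _)
    (Eventually.of_forall fun ξ => ?_)
  rw [Circle.smul_def, Circle.smul_def, ← sub_smul, norm_smul]
  have h1 := norm_fourierChar_sub_le hγ0 hγ1 (inner ℝ ξ x) (inner ℝ ξ y)
  have h2 : (2 * Real.pi * |inner ℝ ξ x - inner ℝ ξ y|) ^ γ ≤
      (2 * Real.pi) * (1 + ‖ξ‖ ^ 2) ^ (γ / 2) * ‖x - y‖ ^ γ := by
    rw [← inner_sub_right]
    have h3 : |inner ℝ ξ (x - y)| ≤ √(1 + ‖ξ‖ ^ 2) * ‖x - y‖ := by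
      refine (abs_real_inner_le_norm _ _).trans ?_
      gcongr
      exact Real.le_sqrt_of_sq_le (by linarith)
    calc (2 * Real.pi * |inner ℝ ξ (x - y)|) ^ γ
        ≤ (2 * Real.pi * (√(1 + ‖ξ‖ ^ 2) * ‖x - y‖)) ^ γ := by gcongr
      _ = (2 * Real.pi) ^ γ * ((1 + ‖ξ‖ ^ 2) ^ (γ / 2) * ‖x - y‖ ^ γ) := by
          rw [Real.mul_rpow (x := 2 * Real.pi) (by positivity) (by positivity),
            Real.mul_rpow (x := √(1 + ‖ξ‖ ^ 2)) (by positivity) (by positivity), Real.sqrt_eq_rpow,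
            ← Real.rpow_mul (by positivity)]
          congr 3
          ring
      _ ≤ (2 * Real.pi) * ((1 + ‖ξ‖ ^ 2) ^ (γ / 2) * ‖x - y‖ ^ γ) := by
          gcongr
          exact Real.rpow_le_self_of_one_le (by linarith) hγ1
      _ = _ := by ring
  calc _ ≤ (2 * ((2 * Real.pi) * (1 + ‖ξ‖ ^ 2) ^ (γ / 2) * ‖x - y‖ ^ γ)) * ‖F ξ‖ := by
        gcongr
        exact h1.trans (by linarith)
    _ = _ := by ring

theorem norm_iterate_fourierDx1_le (F : Plane → ℂ) (j : ℕ) (ξ : Plane) :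
    ‖fourierDx1^[j] F ξ‖ ≤ (2 * Real.pi) ^ j * ((1 + ‖ξ‖ ^ 2) ^ ((j : ℝ) / 2) * ‖F ξ‖) := by
  induction j with
  | zero => simp
  | succ j ih =>
    rw [Function.iterate_succ_apply']
    refine (norm_fourierDx1_le _ _).trans ?_
    have := Real.pi_pos
    calc _ ≤ 2 * Real.pi * ((1 + ‖ξ‖ ^ 2) ^ (1 / 2 : ℝ) *
          ((2 * Real.pi) ^ j * ((1 + ‖ξ‖ ^ 2) ^ ((j : ℝ) / 2) * ‖F ξ‖))) := by gcongr
      _ = (2 * Real.pi) ^ (j + 1) *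
          ((1 + ‖ξ‖ ^ 2) ^ (1 / 2 : ℝ) * (1 + ‖ξ‖ ^ 2) ^ ((j : ℝ) / 2) * ‖F ξ‖) := by ring
      _ = _ := by
        rw [← Real.rpow_add (by positivity)]
        congr 4
        push_cast
        ring

/-- Embedding of `H^s(ℝ²)` into a Hölder class, for derivatives in `x₁`. -/
theorem exists_holder_of_sobolevNorm {s γ : ℝ} (k : ℕ) (hγ0 : 0 < γ) (hγ1 : γ ≤ 1)
    (hs : k + γ < s - 1) :
    ∃ C : ℝ, 0 ≤ C ∧ ∀ g : Plane → ℝ, Continuous g → sobolevNorm s g < ⊤ →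
      ∃ G : ℕ → Plane → ℝ, G 0 = g ∧
        (∀ j < k, ∀ x, HasDerivAt (fun r : ℝ => G j (x + r • e₁)) (G (j + 1) x) 0) ∧
        (∀ j ≤ k, Continuous (G j)) ∧
        (∀ j ≤ k, ∀ x, |G j x| ≤ C * (sobolevNorm s g).toReal) ∧
        ∀ x y, |G k x - G k y| ≤ C * (sobolevNorm s g).toReal * ‖x - y‖ ^ γ := by
  have hpi := Real.pi_gt_three
  obtain ⟨C, hC, h⟩ := exists_fourier_repr (s := s) (σ := k + γ) (by positivity) hs
  refine ⟨2 * (2 * Real.pi) * ((2 * Real.pi) ^ k * C), by positivity, fun g hg hgs => ?_⟩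
  obtain ⟨F, hF, hFw, hFC, hgF⟩ := h g hg hgs
  set N := (sobolevNorm s g).toReal
  have hw : ∀ (τ : ℝ) (j : ℕ), 0 ≤ τ → j + τ ≤ k + γ → ∀ ξ : Plane,
      (1 + ‖ξ‖ ^ 2) ^ (τ / 2) * ‖fourierDx1^[j] F ξ‖ ≤
        (2 * Real.pi) ^ j * ((1 + ‖ξ‖ ^ 2) ^ ((k + γ) / 2) * ‖F ξ‖) := by
    intro τ j hτ hj ξ
    calc _ ≤ (1 + ‖ξ‖ ^ 2) ^ (τ / 2) *
          ((2 * Real.pi) ^ j * ((1 + ‖ξ‖ ^ 2) ^ ((j : ℝ) / 2) * ‖F ξ‖)) := by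
          gcongr
          exact norm_iterate_fourierDx1_le F j ξ
      _ = (2 * Real.pi) ^ j *
          ((1 + ‖ξ‖ ^ 2) ^ (τ / 2) * (1 + ‖ξ‖ ^ 2) ^ ((j : ℝ) / 2) * ‖F ξ‖) := by ring
      _ ≤ _ := by
        rw [← Real.rpow_add (by positivity)]
        gcongr
        · nlinarith [sq_nonneg ‖ξ‖]
        · linarith
  have hmeas : ∀ j : ℕ, AEStronglyMeasurable (fourierDx1^[j] F) volume := by
    intro j
    induction j with
    | zero => exact hF.1
    | succ j ih =>
      rw [Function.iterate_succ_apply']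
      exact aestronglyMeasurable_fourierDx1 ih
  have hint : ∀ (τ : ℝ) (j : ℕ), 0 ≤ τ → j + τ ≤ k + γ →
      Integrable fun ξ : Plane => (1 + ‖ξ‖ ^ 2) ^ (τ / 2) * ‖fourierDx1^[j] F ξ‖ := by
    intro τ j hτ hj
    refine (hFw.const_mul ((2 * Real.pi) ^ j)).mono' ?_ (Eventually.of_forall fun ξ => ?_)
    · refine AEStronglyMeasurable.mul (Continuous.aestronglyMeasurable ?_) (hmeas j).norm
      exact Continuous.rpow_const (by fun_prop) fun x => Or.inl (by positivity)
    · rw [Real.norm_of_nonneg (by positivity)]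
      exact hw τ j hτ hj ξ
  have hle : ∀ (τ : ℝ) (j : ℕ), 0 ≤ τ → j + τ ≤ k + γ → j ≤ k →
      ∫ ξ : Plane, (1 + ‖ξ‖ ^ 2) ^ (τ / 2) * ‖fourierDx1^[j] F ξ‖ ≤
        (2 * Real.pi) ^ k * C * N := by
    intro τ j hτ hj hjk
    calc _ ≤ ∫ ξ : Plane, (2 * Real.pi) ^ j * ((1 + ‖ξ‖ ^ 2) ^ ((k + γ) / 2) * ‖F ξ‖) :=
          integral_mono (hint τ j hτ hj) (hFw.const_mul _) (hw τ j hτ hj)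
      _ = (2 * Real.pi) ^ j * ∫ ξ : Plane, (1 + ‖ξ‖ ^ 2) ^ ((k + γ) / 2) * ‖F ξ‖ :=
          integral_const_mul _ _
      _ ≤ (2 * Real.pi) ^ k * (C * N) := by
          gcongr
          · linarith
      _ = _ := by ring
  have hcast : ∀ j : ℕ, j ≤ k → (j : ℝ) ≤ k := fun j hj => by exact_mod_cast hj
  have hintj : ∀ j ≤ k, Integrable (fourierDx1^[j] F) := by
    intro j hj
    have := hint 0 j le_rfl (by linarith [hcast j hj])
    simp only [zero_div, Real.rpow_zero, one_mul] at this
    exact (integrable_norm_iff (hmeas j)).1 this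
  refine ⟨fun j x => (𝓕⁻ (fourierDx1^[j] F) x).re, ?_, ?_, ?_, ?_, ?_⟩
  · ext x
    simp [← hgF]
  · intro j hj x
    have hj' : (j : ℝ) + 1 ≤ k := by exact_mod_cast hj
    have h1 : Integrable fun ξ : Plane => ‖ξ‖ * ‖fourierDx1^[j] F ξ‖ := by
      refine (hint 1 j zero_le_one (by linarith)).mono'
        (continuous_norm.aestronglyMeasurable.mul (hmeas j).norm)
        (Eventually.of_forall fun ξ => ?_)
      rw [Real.norm_of_nonneg (by positivity), ← Real.sqrt_eq_rpow]
      gcongr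
      exact Real.le_sqrt_of_sq_le (by linarith)
    have h2 := hasDerivAt_fourierInv_line (hintj j hj.le) h1 x
    rw [← Function.iterate_succ_apply' fourierDx1 j F] at h2
    exact Complex.reCLM.hasFDerivAt.comp_hasDerivAt (0 : ℝ) h2
  · intro j hj
    have h1 : MemLp (fourierDx1^[j] F) 1 := memLp_one_iff_integrable.2 (hintj j hj)
    have h2 : Continuous (𝓕⁻ (fourierDx1^[j] F)) := by
      rw [← Real.Lp.fourierTransformInv_toLp h1]
      exact (Real.Lp.fourierTransformInv h1.toLp).continuous
    exact Complex.continuous_re.comp h2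
  · intro j hj x
    have h1 := hle 0 j le_rfl (by linarith [hcast j hj]) hj
    simp only [zero_div, Real.rpow_zero, one_mul] at h1
    have h2 : ‖𝓕⁻ (fourierDx1^[j] F) x‖ ≤ ∫ ξ, ‖fourierDx1^[j] F ξ‖ := by
      rw [Real.fourierInv_eq]
      refine (norm_integral_le_integral_norm _).trans (le_of_eq ?_)
      simp [Circle.norm_smul]
    refine (Complex.abs_re_le_norm _).trans (h2.trans (h1.trans ?_))
    have : 0 ≤ (2 * Real.pi) ^ k * C * N := by positivity
    nlinarith
  · intro x y
    rw [← Complex.sub_re]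
    refine (Complex.abs_re_le_norm _).trans
      ((norm_fourierInv_sub_le hγ0 hγ1 (hintj k le_rfl) (hint γ k hγ0.le le_rfl) x y).trans ?_)
    have := hle γ k hγ0.le le_rfl le_rfl
    calc _ ≤ 2 * (2 * Real.pi) * ((2 * Real.pi) ^ k * C * N) * ‖x - y‖ ^ γ := by gcongr
      _ = _ := by ring

/-! ### Calculus of two real variables -/

/-- Chain rule for a function of two variables with continuous partial derivatives near a point. -/
theorem hasDerivAt_comp_of_partials {f f₁ f₂ : ℝ × ℝ → ℝ} {a b : ℝ → ℝ} {a' b' r : ℝ}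
    (h₁ : ∀ᶠ p in 𝓝 (a r, b r), HasDerivAt (fun s => f (s, p.2)) (f₁ p) p.1)
    (h₂ : ∀ᶠ p in 𝓝 (a r, b r), HasDerivAt (fun s => f (p.1, s)) (f₂ p) p.2)
    (c₁ : ContinuousAt f₁ (a r, b r)) (c₂ : ContinuousAt f₂ (a r, b r))
    (ha : HasDerivAt a a' r) (hb : HasDerivAt b b' r) :
    HasDerivAt (fun s => f (a s, b s)) (f₁ (a r, b r) * a' + f₂ (a r, b r) * b') r := by
  have h := hasStrictFDerivAt_uncurry_coprod (𝕜 := ℝ) (u := (a r, b r)) (f := fun x y => f (x, y))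
    (f₁ := fun x y => ContinuousLinearMap.toSpanSingleton ℝ (f₁ (x, y)))
    (f₂ := fun x y => ContinuousLinearMap.toSpanSingleton ℝ (f₂ (x, y)))
    (h₁.mono fun p hp => hp.hasFDerivAt) (h₂.mono fun p hp => hp.hasFDerivAt)
    ((ContinuousLinearMap.toSpanSingletonCLE (𝕜 := ℝ) (E := ℝ)).continuous.continuousAt.comp c₁)
    ((ContinuousLinearMap.toSpanSingletonCLE (𝕜 := ℝ) (E := ℝ)).continuous.continuousAt.comp c₂)
  refine HasDerivAt.congr_deriv (h.hasFDerivAt.comp_hasDerivAt r (ha.prodMk hb)) ?_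
  simp [Function.HasUncurry.uncurry, mul_comm]

theorem continuous_intervalIntegral_param {X E : Type*} [TopologicalSpace X]
    [FirstCountableTopology X] [LocallyCompactSpace X] [NormedAddCommGroup E] [NormedSpace ℝ E]
    {g : X → ℝ → E} (hg : Continuous g.uncurry) {a b : X → ℝ} (ha : Continuous a)
    (hb : Continuous b) : Continuous fun x => ∫ t in a x..b x, g x t := by
  have hgi : ∀ x c d, IntervalIntegrable (g x) volume c d := fun x c d =>
    (hg.comp (by fun_prop : Continuous fun t => (x, t))).intervalIntegrable c d
  have : (fun x => ∫ t in a x..b x, g x t) =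
      fun x => (∫ t in (0 : ℝ)..b x, g x t) - ∫ t in (0 : ℝ)..a x, g x t := by
    ext x
    rw [intervalIntegral.integral_interval_sub_left (hgi x _ _) (hgi x _ _)]
  rw [this]
  exact (intervalIntegral.continuous_parametric_intervalIntegral_of_continuous hg hb).sub
    (intervalIntegral.continuous_parametric_intervalIntegral_of_continuous hg ha)

theorem hasDerivAt_intervalIntegral_param {g g' : ℝ × ℝ → ℝ} (hg : Continuous g)
    (hg' : Continuous g') (hd : ∀ p, HasDerivAt (fun x => g (p.1, x)) (g' p) p.2) (a b x : ℝ) :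
    HasDerivAt (fun x => ∫ t in a..b, g (t, x)) (∫ t in a..b, g' (t, x)) x := by
  obtain ⟨C, hC⟩ := ((isCompact_uIcc (a := a) (b := b)).prod
    (isCompact_closedBall x 1)).exists_bound_of_continuousOn hg'.continuousOn
  refine (intervalIntegral.hasDerivAt_integral_of_dominated_loc_of_deriv_le (bound := fun _ => C)
    (F := fun x t => g (t, x)) (F' := fun x t => g' (t, x))
    (Metric.closedBall_mem_nhds x one_pos) ?_ ?_ ?_ ?_ ?_ ?_).2
  · exact Eventually.of_forall fun x =>
      (hg.comp (by fun_prop : Continuous fun t => (t, x))).aestronglyMeasurable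
  · exact (hg.comp (by fun_prop : Continuous fun t => (t, x))).intervalIntegrable _ _
  · exact (hg'.comp (by fun_prop : Continuous fun t => (t, x))).aestronglyMeasurable
  · exact Eventually.of_forall fun t ht y hy => hC (t, y) ⟨uIoc_subset_uIcc ht, hy⟩
  · exact intervalIntegrable_const
  · exact Eventually.of_forall fun t _ y _ => hd (t, y)

/-- Leibniz rule with a moving lower end point. -/
theorem hasDerivAt_intervalIntegral_lower {g g' : ℝ × ℝ → ℝ} (hg : Continuous g)
    (hg' : Continuous g') (hd : ∀ p, HasDerivAt (fun x => g (p.1, x)) (g' p) p.2) (b x : ℝ) :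
    HasDerivAt (fun x => ∫ t in x..b, g (t, x)) (-g (x, x) + ∫ t in x..b, g' (t, x)) x := by
  have hsec : ∀ y, Continuous fun t => g (t, y) := fun y => hg.comp (by fun_prop)
  have := hasDerivAt_comp_of_partials (f := fun p : ℝ × ℝ => ∫ t in p.1..b, g (t, p.2))
    (f₁ := fun p => -g p) (f₂ := fun p => ∫ t in p.1..b, g' (t, p.2)) (a := id) (b := id) (r := x)
    (Eventually.of_forall fun p => intervalIntegral.integral_hasDerivAt_left
      ((hsec p.2).intervalIntegrable _ _) ((hsec p.2).stronglyMeasurableAtFilter _ _)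
      (hsec p.2).continuousAt)
    (Eventually.of_forall fun p => hasDerivAt_intervalIntegral_param hg hg' hd p.1 b p.2)
    (by fun_prop)
    (continuous_intervalIntegral_param (g := fun (p : ℝ × ℝ) t => g' (t, p.2)) (by fun_prop)
      continuous_fst continuous_const).continuousAt
    (hasDerivAt_id x) (hasDerivAt_id x)
  simpa using this

/-- Integrating the weight e^{Λ|t − a|} gains a factor 1/Λ. With Λ large this makes the Picard
operator a contraction on strips of any width, which is why existence is global. -/
theorem norm_intervalIntegral_exp_le {E : Type*} [NormedAddCommGroup E] [NormedSpace ℝ E]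
    {g : ℝ → E} {a b c Λ : ℝ} (hΛ : 0 < Λ)
    (h : ∀ t ∈ uIcc a b, ‖g t‖ ≤ c * Real.exp (Λ * |t - a|)) :
    ‖∫ t in a..b, g t‖ ≤ c / Λ * (Real.exp (Λ * |b - a|) - 1) := by
  have hc : 0 ≤ c := by
    have := h a left_mem_uIcc
    simp at this
    exact (norm_nonneg _).trans this
  have h1 : ‖∫ t in a..b, g t‖ ≤ |∫ t in a..b, c * Real.exp (Λ * |t - a|)| := by
    refine intervalIntegral.norm_integral_le_abs_of_norm_le ?_ ?_
    · exact (ae_restrict_mem measurableSet_uIoc).mono fun t ht => h t (uIoc_subset_uIcc ht)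
    · exact Continuous.intervalIntegrable (by fun_prop) _ _
  refine h1.trans ?_
  rcases le_total a b with hab | hab
  · have h2 : ∫ t in a..b, c * Real.exp (Λ * |t - a|) =
        c / Λ * Real.exp (Λ * (b - a)) - c / Λ * Real.exp (Λ * (a - a)) := by
      rw [intervalIntegral.integral_congr (g := fun t => c * Real.exp (Λ * (t - a)))]
      · refine intervalIntegral.integral_eq_sub_of_hasDerivAt
          (f := fun t => c / Λ * Real.exp (Λ * (t - a))) (fun t _ => ?_)
          (Continuous.intervalIntegrable (by fun_prop) _ _)
        have := (((((hasDerivAt_id t).sub_const a).const_mul Λ).exp).const_mul (c / Λ))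
        refine HasDerivAt.congr_deriv this ?_
        simp
        field_simp
      · intro t ht
        rw [uIcc_of_le hab] at ht
        simp only
        rw [abs_of_nonneg (sub_nonneg.2 ht.1)]
    rw [h2, abs_of_nonneg (sub_nonneg.2 hab), sub_self, mul_zero, Real.exp_zero, ← mul_sub,
      abs_of_nonneg]
    refine mul_nonneg (by positivity) (sub_nonneg.2 (Real.one_le_exp ?_))
    exact mul_nonneg hΛ.le (sub_nonneg.2 hab)
  · have h2 : ∫ t in a..b, c * Real.exp (Λ * |t - a|) =
        -(c / Λ) * Real.exp (Λ * (a - b)) - (-(c / Λ)) * Real.exp (Λ * (a - a)) := by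
      rw [intervalIntegral.integral_congr (g := fun t => c * Real.exp (Λ * (a - t)))]
      · refine intervalIntegral.integral_eq_sub_of_hasDerivAt
          (f := fun t => -(c / Λ) * Real.exp (Λ * (a - t))) (fun t _ => ?_)
          (Continuous.intervalIntegrable (by fun_prop) _ _)
        have := (((((hasDerivAt_id t).const_sub a).const_mul Λ).exp).const_mul (-(c / Λ)))
        refine HasDerivAt.congr_deriv this ?_
        simp
        field_simp
      · intro t ht
        rw [uIcc_of_ge hab] at ht
        simp only
        rw [abs_of_nonpos (sub_nonpos.2 ht.2), neg_sub]
    rw [h2, abs_of_nonpos (sub_nonpos.2 hab), sub_self, mul_zero, Real.exp_zero, ← mul_sub, neg_mul,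
      abs_neg, neg_sub, abs_of_nonneg]
    refine mul_nonneg (by positivity) (sub_nonneg.2 (Real.one_le_exp ?_))
    exact mul_nonneg hΛ.le (sub_nonneg.2 hab)

/-! ### The Lagrangian system -/

/-- `F` is differentiable and bounded, with bounded and Lipschitz derivative. -/
structure SourceBound (F : ℝ × ℝ × ℝ × ℝ × ℝ → ℝ) (C : ℝ) : Prop where
  diff : Differentiable ℝ F
  bound : ∀ p, |F p| ≤ C
  fderiv_bound : ∀ p, ‖fderiv ℝ F p‖ ≤ C
  fderiv_lip : ∀ p p', ‖fderiv ℝ F p - fderiv ℝ F p'‖ ≤ C * ‖p - p'‖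

namespace SourceBound

variable {F : ℝ × ℝ × ℝ × ℝ × ℝ → ℝ} {C : ℝ}

theorem nonneg (hF : SourceBound F C) : 0 ≤ C := (abs_nonneg _).trans (hF.bound 0)

theorem lip (hF : SourceBound F C) (p p' : ℝ × ℝ × ℝ × ℝ × ℝ) : |F p - F p'| ≤ C * ‖p - p'‖ :=
  Convex.norm_image_sub_le_of_norm_fderiv_le (fun x _ => hF.diff x) (fun x _ => hF.fderiv_bound x)
    convex_univ (mem_univ p') (mem_univ p)

theorem continuous_fderiv (hF : SourceBound F C) : Continuous (fderiv ℝ F) := by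
  have : LipschitzWith (Real.toNNReal C) (fderiv ℝ F) :=
    LipschitzWith.of_dist_le_mul fun p p' => by
      rw [dist_eq_norm, dist_eq_norm, Real.coe_toNNReal _ hF.nonneg]
      exact hF.fderiv_lip p p'
  exact this.continuous

end SourceBound

/-- Continuous initial data `u₀`, and `v₀` with derivative `v₀'` in the second variable, the latter
two bounded by `M`. -/
structure DataBound (u₀ v₀ v₀' : ℝ × ℝ → ℝ) (M : ℝ) : Prop where
  cont_u : Continuous u₀
  cont_v : Continuous v₀
  cont_v' : Continuous v₀'
  deriv_v : ∀ p, HasDerivAt (fun x => v₀ (p.1, x)) (v₀' p) p.2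
  bound_v : ∀ p, |v₀ p| ≤ M
  bound_v' : ∀ p, |v₀' p| ≤ M

/-! ### Bounds and contraction for the Picard operator -/

section Picard

variable (F : ℝ × ℝ × ℝ × ℝ × ℝ → ℝ) (u₀ v₀ v₀' : ℝ × ℝ → ℝ)

/-- The function `u` in Lagrangian coordinates `(q, y, ξ)`, in terms of `(Z, V, J, P)`. -/
noncomputable def lagU (Φ : ℝ × ℝ × ℝ → ℝ × ℝ × ℝ × ℝ) (p : ℝ × ℝ × ℝ) : ℝ :=
  u₀ (p.1, p.2.1) -
    1 / 2 * ∫ r in p.2.2..p.2.1, (Φ (p.1, p.2.1, r)).2.1 * (Φ (p.1, p.2.1, r)).2.2.1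

/-- The right-hand side of the system for `(Z, V, J, P)`. -/
noncomputable def lagRhs (q y : ℝ) (φ : ℝ × ℝ × ℝ × ℝ) (u : ℝ) : ℝ × ℝ × ℝ × ℝ :=
  (φ.2.1, -F (q, y, φ.1, u, φ.2.1), φ.2.2.2,
    -(fderiv ℝ F (q, y, φ.1, u, φ.2.1)
      (0, 0, φ.2.2.1, 1 / 2 * (φ.2.1 * φ.2.2.1), φ.2.2.2)))

/-- The initial values of `(Z, V, J, P)`. -/
noncomputable def lagInit (q ξ : ℝ) : ℝ × ℝ × ℝ × ℝ :=
  (ξ, v₀ (q, ξ), 1 - v₀ (q, ξ), v₀' (q, ξ) + F (q, ξ, ξ, u₀ (q, ξ), v₀ (q, ξ)))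

/-- The Picard operator. -/
noncomputable def lagStep (Φ : ℝ × ℝ × ℝ → ℝ × ℝ × ℝ × ℝ) (p : ℝ × ℝ × ℝ) : ℝ × ℝ × ℝ × ℝ :=
  lagInit F u₀ v₀ v₀' p.1 p.2.2 +
    ∫ t in p.2.2..p.2.1, lagRhs F p.1 t (Φ (p.1, t, p.2.2)) (lagU u₀ Φ (p.1, t, p.2.2))

/-- The Picard iterates. -/
noncomputable def lagSeq : ℕ → ℝ × ℝ × ℝ → ℝ × ℝ × ℝ × ℝ
  | 0 => fun p => (p.2.2, v₀ (p.1, p.2.2), 1, v₀' (p.1, p.2.2))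
  | n + 1 => lagStep F u₀ v₀ v₀' (lagSeq n)

variable {F u₀ v₀ v₀'} {C M : ℝ}

theorem continuous_lagU (hu : Continuous u₀) {Φ : ℝ × ℝ × ℝ → ℝ × ℝ × ℝ × ℝ} (hΦ : Continuous Φ) :
    Continuous (lagU u₀ Φ) := by
  unfold lagU
  refine Continuous.sub (by fun_prop) (Continuous.mul continuous_const ?_)
  exact continuous_intervalIntegral_param
    (g := fun (p : ℝ × ℝ × ℝ) r => (Φ (p.1, p.2.1, r)).2.1 * (Φ (p.1, p.2.1, r)).2.2.1)
    (by fun_prop) (by fun_prop) (by fun_prop)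

theorem continuous_lagRhs (hF : SourceBound F C) {X : Type*} [TopologicalSpace X]
    {q y u : X → ℝ} {φ : X → ℝ × ℝ × ℝ × ℝ} (hq : Continuous q) (hy : Continuous y)
    (hu : Continuous u) (hφ : Continuous φ) :
    Continuous fun x => lagRhs F (q x) (y x) (φ x) (u x) := by
  have h1 := hF.diff.continuous
  have h2 := hF.continuous_fderiv
  unfold lagRhs
  fun_prop

theorem continuous_lagRhs_comp (hF : SourceBound F C) (hu : Continuous u₀)
    {Φ : ℝ × ℝ × ℝ → ℝ × ℝ × ℝ × ℝ} (hΦ : Continuous Φ) :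
    Continuous fun x : ℝ × ℝ × ℝ => lagRhs F x.1 x.2.1 (Φ x) (lagU u₀ Φ x) :=
  continuous_lagRhs hF (by fun_prop) (by fun_prop) (continuous_lagU hu hΦ) hΦ

theorem continuous_lagStep (hF : SourceBound F C) (h : DataBound u₀ v₀ v₀' M)
    {Φ : ℝ × ℝ × ℝ → ℝ × ℝ × ℝ × ℝ} (hΦ : Continuous Φ) :
    Continuous (lagStep F u₀ v₀ v₀' Φ) := by
  have h0 := hF.diff.continuous
  have h1 := h.cont_u
  have h2 := h.cont_v
  have h3 := h.cont_v'
  unfold lagStep lagInit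
  refine Continuous.add (by fun_prop) ?_
  refine continuous_intervalIntegral_param (g := fun (p : ℝ × ℝ × ℝ) t =>
    lagRhs F p.1 t (Φ (p.1, t, p.2.2)) (lagU u₀ Φ (p.1, t, p.2.2))) ?_ (by fun_prop) (by fun_prop)
  exact (continuous_lagRhs_comp hF h1 hΦ).comp
    (by fun_prop : Continuous fun p : (ℝ × ℝ × ℝ) × ℝ => (p.1.1, p.2, p.1.2.2))

theorem continuous_lagSeq (hF : SourceBound F C) (h : DataBound u₀ v₀ v₀' M) (n : ℕ) :
    Continuous (lagSeq F u₀ v₀ v₀' n) := by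
  induction n with
  | zero =>
    have h2 := h.cont_v
    have h3 := h.cont_v'
    unfold lagSeq
    fun_prop
  | succ n ih => exact continuous_lagStep hF h ih

theorem abs_sub_le_of_mem_uIcc {a b t : ℝ} (ht : t ∈ uIcc a b) : |t - a| ≤ |b - a| := by
  rcases le_total a b with h | h
  · rw [uIcc_of_le h] at ht
    rw [abs_of_nonneg (by linarith [ht.1]), abs_of_nonneg (by linarith)]
    linarith [ht.2]
  · rw [uIcc_of_ge h] at ht
    rw [abs_of_nonpos (by linarith [ht.2]), abs_of_nonpos (by linarith)]
    linarith [ht.1]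

/-- `V`, `J`, `P` are bounded by `B` on the strip `|y - ξ| ≤ h`. -/
def StripBound (Φ : ℝ × ℝ × ℝ → ℝ × ℝ × ℝ × ℝ) (h B : ℝ) : Prop :=
  ∀ p : ℝ × ℝ × ℝ, |p.2.1 - p.2.2| ≤ h →
    |(Φ p).2.1| ≤ B ∧ |(Φ p).2.2.1| ≤ B ∧ |(Φ p).2.2.2| ≤ B

theorem abs_mul_sub_mul_le {a b a' b' B d : ℝ} (ha : |a| ≤ B) (hb' : |b'| ≤ B)
    (h1 : |a - a'| ≤ d) (h2 : |b - b'| ≤ d) : |a * b - a' * b'| ≤ 2 * B * d := by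
  have hB : 0 ≤ B := (abs_nonneg _).trans ha
  calc |a * b - a' * b'| = |a * (b - b') + (a - a') * b'| := by ring_nf
    _ ≤ |a| * |b - b'| + |a - a'| * |b'| := by
      rw [← abs_mul, ← abs_mul]
      exact abs_add_le _ _
    _ ≤ B * d + d * B := by gcongr; exact (abs_nonneg _).trans h1
    _ = _ := by ring

theorem norm4_le_iff {φ : ℝ × ℝ × ℝ × ℝ} {d : ℝ} :
    ‖φ‖ ≤ d ↔ |φ.1| ≤ d ∧ |φ.2.1| ≤ d ∧ |φ.2.2.1| ≤ d ∧ |φ.2.2.2| ≤ d := by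
  simp [Prod.norm_def]

theorem norm5_le_iff {φ : ℝ × ℝ × ℝ × ℝ × ℝ} {d : ℝ} :
    ‖φ‖ ≤ d ↔ |φ.1| ≤ d ∧ |φ.2.1| ≤ d ∧ |φ.2.2.1| ≤ d ∧ |φ.2.2.2.1| ≤ d ∧ |φ.2.2.2.2| ≤ d := by
  simp [Prod.norm_def]

/-- For r between ξ and y the point (q, y, r) is no farther from the diagonal than (q, y, ξ), so the
strip bounds and the weight at (q, y, ξ) control the whole integral. The nonlocal term therefore
costs a factor proportional to h and keeps the same exponential weight. -/
theorem abs_lagU_sub_le {Φ Ψ : ℝ × ℝ × ℝ → ℝ × ℝ × ℝ × ℝ} {h B d Λ : ℝ}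
    (hΦc : Continuous Φ) (hΨc : Continuous Ψ) (hΦ : StripBound Φ h B) (hΨ : StripBound Ψ h B)
    (hB : 0 ≤ B) (hd : 0 ≤ d) (hΛ : 0 ≤ Λ)
    (hdiff : ∀ p : ℝ × ℝ × ℝ, |p.2.1 - p.2.2| ≤ h →
      ‖Φ p - Ψ p‖ ≤ d * Real.exp (Λ * |p.2.1 - p.2.2|))
    (p : ℝ × ℝ × ℝ) (hp : |p.2.1 - p.2.2| ≤ h) :
    |lagU u₀ Φ p - lagU u₀ Ψ p| ≤ B * h * d * Real.exp (Λ * |p.2.1 - p.2.2|) := by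
  obtain ⟨q, y, ξ⟩ := p
  simp only at hp ⊢
  have hi : ∀ {Θ : ℝ × ℝ × ℝ → ℝ × ℝ × ℝ × ℝ}, Continuous Θ → IntervalIntegrable
      (fun r => (Θ (q, y, r)).2.1 * (Θ (q, y, r)).2.2.1) volume ξ y := fun hΘ =>
    Continuous.intervalIntegrable (by fun_prop) _ _
  have h1 : lagU u₀ Φ (q, y, ξ) - lagU u₀ Ψ (q, y, ξ) = -(1 / 2 * ∫ r in ξ..y,
      ((Φ (q, y, r)).2.1 * (Φ (q, y, r)).2.2.1 - (Ψ (q, y, r)).2.1 * (Ψ (q, y, r)).2.2.1)) := by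
    rw [intervalIntegral.integral_sub (hi hΦc) (hi hΨc)]
    simp only [lagU]
    ring
  rw [h1, abs_neg, abs_mul, abs_of_pos (by norm_num : (0 : ℝ) < 1 / 2)]
  have h2 := intervalIntegral.norm_integral_le_of_norm_le_const (a := ξ) (b := y)
    (C := 2 * B * (d * Real.exp (Λ * |y - ξ|)))
    (f := fun r => (Φ (q, y, r)).2.1 * (Φ (q, y, r)).2.2.1 -
      (Ψ (q, y, r)).2.1 * (Ψ (q, y, r)).2.2.1) ?_
  · rw [Real.norm_eq_abs] at h2
    have hE := Real.exp_pos (Λ * |y - ξ|)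
    calc _ ≤ 1 / 2 * (2 * B * (d * Real.exp (Λ * |y - ξ|)) * |y - ξ|) := by gcongr
      _ = B * |y - ξ| * d * Real.exp (Λ * |y - ξ|) := by ring
      _ ≤ _ := by gcongr
  · intro r hr
    have hr' : |y - r| ≤ |y - ξ| := by
      have := abs_sub_le_of_mem_uIcc (a := y) (b := ξ) (t := r)
        (by rw [uIcc_comm]; exact uIoc_subset_uIcc hr)
      rwa [abs_sub_comm r, abs_sub_comm ξ] at this
    have hb1 := hΦ (q, y, r) (hr'.trans hp)
    have hb2 := hΨ (q, y, r) (hr'.trans hp)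
    have h3 := hdiff (q, y, r) (hr'.trans hp)
    have h4 : ‖Φ (q, y, r) - Ψ (q, y, r)‖ ≤ d * Real.exp (Λ * |y - ξ|) := by
      refine h3.trans ?_
      simp only
      gcongr
    rw [norm4_le_iff] at h4
    exact abs_mul_sub_mul_le hb1.1 hb2.2.1 h4.2.1 h4.2.2.1

/-- F and its derivative are globally bounded and Lipschitz, so neither Z nor u needs a bound. The
square of B comes from the product V J in the direction along which F is differentiated. -/
theorem norm_lagRhs_sub_le (hF : SourceBound F C) {q y u u' B d : ℝ} {φ φ' : ℝ × ℝ × ℝ × ℝ}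
    (hB : 1 ≤ B) (h1 : |φ.2.1| ≤ B) (h2 : |φ.2.2.1| ≤ B) (h3 : |φ.2.2.2| ≤ B)
    (h2' : |φ'.2.2.1| ≤ B) (hφ : ‖φ - φ'‖ ≤ d) (hu : |u - u'| ≤ d) :
    ‖lagRhs F q y φ u - lagRhs F q y φ' u'‖ ≤ (1 + C * (2 * B ^ 2)) * d := by
  have hC := hF.nonneg
  have hd : 0 ≤ d := (norm_nonneg _).trans hφ
  obtain ⟨e1, e2, e3, e4⟩ := norm4_le_iff.1 hφ
  simp only [Prod.fst_sub, Prod.snd_sub] at e1 e2 e3 e4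
  set a : ℝ × ℝ × ℝ × ℝ × ℝ := (q, y, φ.1, u, φ.2.1)
  set a' : ℝ × ℝ × ℝ × ℝ × ℝ := (q, y, φ'.1, u', φ'.2.1)
  have ha : ‖a - a'‖ ≤ d := by
    rw [norm5_le_iff]
    simp [a, a', e1, e2, hu, hd]
  set w : ℝ × ℝ × ℝ × ℝ × ℝ := (0, 0, φ.2.2.1, 1 / 2 * (φ.2.1 * φ.2.2.1), φ.2.2.2)
  set w' : ℝ × ℝ × ℝ × ℝ × ℝ := (0, 0, φ'.2.2.1, 1 / 2 * (φ'.2.1 * φ'.2.2.1), φ'.2.2.2)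
  have hBB : B ≤ B ^ 2 := by nlinarith
  have hw : ‖w‖ ≤ B ^ 2 := by
    rw [norm5_le_iff]
    refine ⟨by simp [w]; positivity, by simp [w]; positivity, h2.trans hBB, ?_, h3.trans hBB⟩
    simp only [w, abs_mul, abs_of_pos (by norm_num : (0 : ℝ) < 1 / 2)]
    have : |φ.2.1| * |φ.2.2.1| ≤ B * B := by gcongr
    nlinarith
  have hww : ‖w - w'‖ ≤ B * d := by
    rw [norm5_le_iff]
    have hdB : d ≤ B * d := by nlinarith
    refine ⟨by simp [w, w']; positivity, by simp [w, w']; positivity, e3.trans hdB, ?_,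
      e4.trans hdB⟩
    simp only [w, w', Prod.fst_sub, Prod.snd_sub, ← mul_sub, abs_mul,
      abs_of_pos (by norm_num : (0 : ℝ) < 1 / 2)]
    have := abs_mul_sub_mul_le h1 h2' e2 e3
    linarith
  have hle : d ≤ (1 + C * (2 * B ^ 2)) * d := le_mul_of_one_le_left hd (by nlinarith [sq_nonneg B])
  rw [norm4_le_iff]
  refine ⟨e2.trans hle, ?_, e4.trans hle, ?_⟩
  · simp only [lagRhs, Prod.fst_sub, Prod.snd_sub, neg_sub_neg]
    rw [abs_sub_comm]
    refine (hF.lip a a').trans ?_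
    have : C * ‖a - a'‖ ≤ C * d := by gcongr
    have : C * d ≤ C * (2 * B ^ 2) * d := by gcongr; nlinarith
    linarith
  · simp only [lagRhs, Prod.snd_sub, neg_sub_neg]
    rw [abs_sub_comm]
    have e : fderiv ℝ F a w - fderiv ℝ F a' w' =
        (fderiv ℝ F a - fderiv ℝ F a') w + fderiv ℝ F a' (w - w') := by
      simp
    show |fderiv ℝ F a w - fderiv ℝ F a' w'| ≤ _
    rw [e]
    have f1 : |(fderiv ℝ F a - fderiv ℝ F a') w| ≤ C * d * B ^ 2 := by
      refine ((fderiv ℝ F a - fderiv ℝ F a').le_opNorm w).trans ?_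
      gcongr
      exact (hF.fderiv_lip a a').trans (by gcongr)
    have f2 : |fderiv ℝ F a' (w - w')| ≤ C * (B * d) := by
      refine ((fderiv ℝ F a').le_opNorm _).trans ?_
      gcongr
      exact hF.fderiv_bound a'
    refine (abs_add_le _ _).trans ?_
    have : C * (B * d) ≤ C * d * B ^ 2 := by
      rw [mul_comm B d, ← mul_assoc]
      gcongr
    nlinarith

/-- The contraction estimate for the Picard operator in a weighted norm. -/
theorem norm_lagStep_sub_le (hF : SourceBound F C) (hu₀ : Continuous u₀)
    {Φ Ψ : ℝ × ℝ × ℝ → ℝ × ℝ × ℝ × ℝ}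
    {h B d Λ : ℝ} (hΦc : Continuous Φ) (hΨc : Continuous Ψ) (hΦ : StripBound Φ h B)
    (hΨ : StripBound Ψ h B) (hB : 1 ≤ B) (hh : 0 ≤ h) (hd : 0 ≤ d)
    (hΛ : Λ = 2 * ((1 + C * (2 * B ^ 2)) * (1 + B * h)))
    (hdiff : ∀ p : ℝ × ℝ × ℝ, |p.2.1 - p.2.2| ≤ h →
      ‖Φ p - Ψ p‖ ≤ d * Real.exp (Λ * |p.2.1 - p.2.2|))
    (p : ℝ × ℝ × ℝ) (hp : |p.2.1 - p.2.2| ≤ h) :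
    ‖lagStep F u₀ v₀ v₀' Φ p - lagStep F u₀ v₀ v₀' Ψ p‖ ≤
      d / 2 * Real.exp (Λ * |p.2.1 - p.2.2|) := by
  have hC := hF.nonneg
  have hB0 : 0 ≤ B := by linarith
  have hK : 0 < (1 + C * (2 * B ^ 2)) * (1 + B * h) := by positivity
  have hΛ0 : 0 < Λ := by linarith
  obtain ⟨q, y, ξ⟩ := p
  simp only at hp ⊢
  have hi : ∀ {Θ : ℝ × ℝ × ℝ → ℝ × ℝ × ℝ × ℝ}, Continuous Θ → IntervalIntegrable
      (fun t => lagRhs F q t (Θ (q, t, ξ)) (lagU u₀ Θ (q, t, ξ))) volume ξ y := fun hΘ =>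
    Continuous.intervalIntegrable ((continuous_lagRhs_comp hF hu₀ hΘ).comp
      (by fun_prop : Continuous fun t : ℝ => (q, t, ξ))) _ _
  have h1 : lagStep F u₀ v₀ v₀' Φ (q, y, ξ) - lagStep F u₀ v₀ v₀' Ψ (q, y, ξ) = ∫ t in ξ..y,
      (lagRhs F q t (Φ (q, t, ξ)) (lagU u₀ Φ (q, t, ξ)) -
        lagRhs F q t (Ψ (q, t, ξ)) (lagU u₀ Ψ (q, t, ξ))) := by
    rw [intervalIntegral.integral_sub (hi hΦc) (hi hΨc)]
    simp only [lagStep, add_sub_add_left_eq_sub]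
  rw [h1]
  refine (norm_intervalIntegral_exp_le (c := (1 + C * (2 * B ^ 2)) * ((1 + B * h) * d))
    hΛ0 fun t ht => ?_).trans ?_
  · have ht' := (abs_sub_le_of_mem_uIcc ht).trans hp
    have hE := Real.exp_pos (Λ * |t - ξ|)
    have g1 := hΦ (q, t, ξ) ht'
    have g2 := hΨ (q, t, ξ) ht'
    have g3 := hdiff (q, t, ξ) ht'
    have g4 := abs_lagU_sub_le (u₀ := u₀) hΦc hΨc hΦ hΨ hB0 hd hΛ0.le hdiff (q, t, ξ) ht'
    simp only at g3 g4
    have g5 : 0 ≤ B * h * d * Real.exp (Λ * |t - ξ|) := by positivity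
    have g6 : 0 ≤ d * Real.exp (Λ * |t - ξ|) := by positivity
    refine (norm_lagRhs_sub_le hF (d := (1 + B * h) * d * Real.exp (Λ * |t - ξ|)) hB g1.1 g1.2.1
      g1.2.2 g2.2.1 (by linarith) (by linarith)).trans (le_of_eq (by ring))
  · have hE := Real.exp_pos (Λ * |y - ξ|)
    -- Λ is twice the Lipschitz constant of the right-hand side with the dependence on U included;
    -- this is the source of the factor 1/2.
    have : (1 + C * (2 * B ^ 2)) * ((1 + B * h) * d) / Λ = d / 2 := by
      rw [hΛ]
      field_simp
    rw [this]
    gcongr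
    linarith

/-- Growth bounds for the Picard iterates. -/
theorem lagSeq_bound (hF : SourceBound F C) (hD : DataBound u₀ v₀ v₀' M) {h : ℝ} (hh : 0 ≤ h)
    (n : ℕ) (p : ℝ × ℝ × ℝ) (hp : |p.2.1 - p.2.2| ≤ h) :
    |(lagSeq F u₀ v₀ v₀' n p).2.1| ≤ M + C * |p.2.1 - p.2.2| ∧
    |(lagSeq F u₀ v₀ v₀' n p).2.2.1| ≤
      (1 + M + C) * Real.exp ((1 + C) * (1 + M + C * h) * |p.2.1 - p.2.2|) ∧
    |(lagSeq F u₀ v₀ v₀' n p).2.2.2| ≤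
      (1 + M + C) * Real.exp ((1 + C) * (1 + M + C * h) * |p.2.1 - p.2.2|) := by
  have hC := hF.nonneg
  have hM : 0 ≤ M := (abs_nonneg _).trans (hD.bound_v 0)
  -- On the strip |V| ≤ M + Ch because |V_y| ≤ C. Given this, the right-hand side for (J, P) grows
  -- at most linearly with rate L, which depends on h but not on n, so the same exponential bound
  -- passes from one iterate to the next.
  set L := (1 + C) * (1 + M + C * h) with hL
  have hL0 : 0 < L := by positivity
  have hL1 : 1 ≤ L := by nlinarith [mul_nonneg hC hh, mul_nonneg hC (mul_nonneg hC hh)]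
  induction n generalizing p with
  | zero =>
    obtain ⟨q, y, ξ⟩ := p
    simp only [lagSeq] at hp ⊢
    have h1 : 1 ≤ Real.exp (L * |y - ξ|) := Real.one_le_exp (by positivity)
    refine ⟨?_, ?_, ?_⟩
    · exact (hD.bound_v _).trans (le_add_of_nonneg_right (by positivity))
    · rw [abs_one]; nlinarith
    · refine (hD.bound_v' _).trans ?_
      nlinarith
  | succ n ih =>
    obtain ⟨q, y, ξ⟩ := p
    simp only at hp ⊢
    set Φ := lagSeq F u₀ v₀ v₀' n with hΦ
    have hΦc : Continuous Φ := continuous_lagSeq hF hD n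
    have hRc : Continuous fun t : ℝ => lagRhs F q t (Φ (q, t, ξ)) (lagU u₀ Φ (q, t, ξ)) :=
      (continuous_lagRhs_comp hF hD.cont_u hΦc).comp
        (by fun_prop : Continuous fun t : ℝ => (q, t, ξ))
    have hRi := hRc.intervalIntegrable (μ := volume) ξ y
    have hstep : lagSeq F u₀ v₀ v₀' (n + 1) (q, y, ξ) = lagInit F u₀ v₀ v₀' q ξ +
        ∫ t in ξ..y, lagRhs F q t (Φ (q, t, ξ)) (lagU u₀ Φ (q, t, ξ)) := rfl
    have hcomp : ∀ ℓ : (ℝ × ℝ × ℝ × ℝ) →L[ℝ] ℝ, ℓ (lagSeq F u₀ v₀ v₀' (n + 1) (q, y, ξ)) =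
        ℓ (lagInit F u₀ v₀ v₀' q ξ) +
        ∫ t in ξ..y, ℓ (lagRhs F q t (Φ (q, t, ξ)) (lagU u₀ Φ (q, t, ξ))) := by
      intro ℓ
      rw [hstep, map_add, ℓ.intervalIntegral_comp_comm hRi]
    have c2 := hcomp ((ContinuousLinearMap.fst ℝ ℝ (ℝ × ℝ)).comp (ContinuousLinearMap.snd ℝ ℝ _))
    have c3 := hcomp ((ContinuousLinearMap.fst ℝ ℝ ℝ).comp
      ((ContinuousLinearMap.snd ℝ ℝ _).comp (ContinuousLinearMap.snd ℝ ℝ _)))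
    have c4 := hcomp ((ContinuousLinearMap.snd ℝ ℝ ℝ).comp
      ((ContinuousLinearMap.snd ℝ ℝ _).comp (ContinuousLinearMap.snd ℝ ℝ _)))
    simp only [ContinuousLinearMap.comp_apply, ContinuousLinearMap.coe_fst',
      ContinuousLinearMap.coe_snd'] at c2 c3 c4
    have hv := hD.bound_v (q, ξ)
    have hv' := hD.bound_v' (q, ξ)
    have hexp : ∀ {I : ℝ}, ‖I‖ ≤ (1 + M + C) * L / L * (Real.exp (L * |y - ξ|) - 1) → ∀ {a : ℝ},
        |a| ≤ 1 + M + C → |a + I| ≤ (1 + M + C) * Real.exp (L * |y - ξ|) := by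
      intro I hI a ha
      rw [mul_div_cancel_right₀ _ hL0.ne'] at hI
      refine (abs_add_le _ _).trans ?_
      rw [Real.norm_eq_abs] at hI
      linarith
    refine ⟨?_, ?_, ?_⟩
    · rw [c2]
      refine (abs_add_le _ _).trans (add_le_add hv ?_)
      rw [← Real.norm_eq_abs]
      exact intervalIntegral.norm_integral_le_of_norm_le_const fun t _ => by
        simpa [lagRhs] using hF.bound _
    · rw [c3]
      refine hexp (norm_intervalIntegral_exp_le hL0 fun t ht => ?_) ?_
      · have ht' := (abs_sub_le_of_mem_uIcc ht).trans hp
        refine (ih (q, t, ξ) ht').2.2.trans ?_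
        simp only
        gcongr
        exact le_mul_of_one_le_right (by positivity) hL1
      · simp only [lagInit]
        refine (abs_sub _ _).trans ?_
        rw [abs_one]
        linarith
    · rw [c4]
      refine hexp (norm_intervalIntegral_exp_le hL0 fun t ht => ?_) ?_
      · have ht' := (abs_sub_le_of_mem_uIcc ht).trans hp
        obtain ⟨i1, i2, i3⟩ := ih (q, t, ξ) ht'
        simp only at i1 i2 i3
        set E := (1 + M + C) * Real.exp (L * |t - ξ|) with hE
        have hE0 : 0 ≤ E := by positivity
        have hVM : |(Φ (q, t, ξ)).2.1| ≤ M + C * h := i1.trans (by gcongr)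
        have hMh : 0 ≤ M + C * h := by positivity
        simp only [lagRhs, norm_neg]
        refine (ContinuousLinearMap.le_opNorm _ _).trans ?_
        have hw : ‖((0, 0, (Φ (q, t, ξ)).2.2.1, 1 / 2 * ((Φ (q, t, ξ)).2.1 * (Φ (q, t, ξ)).2.2.1),
            (Φ (q, t, ξ)).2.2.2) : ℝ × ℝ × ℝ × ℝ × ℝ)‖ ≤ (1 + M + C * h) * E := by
          rw [norm5_le_iff]
          have hEE : E ≤ (1 + M + C * h) * E := by nlinarith
          refine ⟨by simp; positivity, by simp; positivity, i2.trans hEE, ?_, i3.trans hEE⟩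
          simp only [abs_mul, abs_of_pos (by norm_num : (0 : ℝ) < 1 / 2)]
          have : |(Φ (q, t, ξ)).2.1| * |(Φ (q, t, ξ)).2.2.1| ≤ (M + C * h) * E := by gcongr
          nlinarith
        calc _ ≤ C * ((1 + M + C * h) * E) := by
              gcongr
              exact hF.fderiv_bound _
          _ ≤ (1 + C) * ((1 + M + C * h) * E) := by
              gcongr
              linarith
          _ = _ := by rw [hE, hL]; ring
      · simp only [lagInit]
        exact (abs_add_le _ _).trans (by linarith [hF.bound (q, ξ, ξ, u₀ (q, ξ), v₀ (q, ξ))])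

end Picard

/-! ### Convergence of the iterates and relations in the label -/

section PicardLimit

variable {F : ℝ × ℝ × ℝ × ℝ × ℝ → ℝ} {u₀ v₀ v₀' : ℝ × ℝ → ℝ} {C M : ℝ}

theorem hasDerivAt_lagU {Φ : ℝ × ℝ × ℝ → ℝ × ℝ × ℝ × ℝ} (hΦ : Continuous Φ) (q y ξ : ℝ) :
    HasDerivAt (fun ξ => lagU u₀ Φ (q, y, ξ))
      (1 / 2 * ((Φ (q, y, ξ)).2.1 * (Φ (q, y, ξ)).2.2.1)) ξ := by
  have hc : Continuous fun r => (Φ (q, y, r)).2.1 * (Φ (q, y, r)).2.2.1 := by fun_prop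
  have h1 := intervalIntegral.integral_hasDerivAt_left (hc.intervalIntegrable ξ y)
    (hc.stronglyMeasurableAtFilter _ _) hc.continuousAt
  refine ((h1.const_mul (1 / 2)).const_sub (u₀ (q, y))).congr_deriv ?_
  ring

theorem lagU_diag (Φ : ℝ × ℝ × ℝ → ℝ × ℝ × ℝ × ℝ) (q ξ : ℝ) : lagU u₀ Φ (q, ξ, ξ) = u₀ (q, ξ) := by
  simp [lagU]

theorem lagStep_diag (Φ : ℝ × ℝ × ℝ → ℝ × ℝ × ℝ × ℝ) (q ξ : ℝ) :
    lagStep F u₀ v₀ v₀' Φ (q, ξ, ξ) = lagInit F u₀ v₀ v₀' q ξ := by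
  simp [lagStep]

theorem lagStep_apply (hF : SourceBound F C) (hD : DataBound u₀ v₀ v₀' M)
    {Φ : ℝ × ℝ × ℝ → ℝ × ℝ × ℝ × ℝ} (hΦ : Continuous Φ) (ℓ : (ℝ × ℝ × ℝ × ℝ) →L[ℝ] ℝ)
    (q y ξ : ℝ) :
    ℓ (lagStep F u₀ v₀ v₀' Φ (q, y, ξ)) = ℓ (lagInit F u₀ v₀ v₀' q ξ) +
      ∫ t in ξ..y, ℓ (lagRhs F q t (Φ (q, t, ξ)) (lagU u₀ Φ (q, t, ξ))) := by
  have hRc : Continuous fun t : ℝ => lagRhs F q t (Φ (q, t, ξ)) (lagU u₀ Φ (q, t, ξ)) :=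
    (continuous_lagRhs_comp hF hD.cont_u hΦ).comp
      (by fun_prop : Continuous fun t : ℝ => (q, t, ξ))
  rw [lagStep, map_add, ℓ.intervalIntegral_comp_comm (hRc.intervalIntegrable _ _)]

/-- The relations `Z_ξ = J` and `V_ξ = P` (at fixed `y`), with the initial values of `Z` and `V`. -/
structure LagRel (v₀ : ℝ × ℝ → ℝ) (Φ : ℝ × ℝ × ℝ → ℝ × ℝ × ℝ × ℝ) : Prop where
  diag_Z : ∀ q ξ, (Φ (q, ξ, ξ)).1 = ξ
  diag_V : ∀ q ξ, (Φ (q, ξ, ξ)).2.1 = v₀ (q, ξ)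
  deriv_Z : ∀ q y ξ, HasDerivAt (fun ξ => (Φ (q, y, ξ)).1) (Φ (q, y, ξ)).2.2.1 ξ
  deriv_V : ∀ q y ξ, HasDerivAt (fun ξ => (Φ (q, y, ξ)).2.1) (Φ (q, y, ξ)).2.2.2 ξ

/-- Differentiating the integral equations for Z and V in the label reproduces those for J and P;
the terms −V and +F from the moving end point are precisely the corrections 1 − v₀ and v₀' + F in
`lagInit`. As every iterate satisfies these relations, they pass to the limit, and the limit is
differentiable in the label with derivatives J and P. -/
theorem LagRel.lagStep (hF : SourceBound F C) (hD : DataBound u₀ v₀ v₀' M)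
    {Φ : ℝ × ℝ × ℝ → ℝ × ℝ × ℝ × ℝ} (hΦ : Continuous Φ) (h : LagRel v₀ Φ) :
    LagRel v₀ (lagStep F u₀ v₀ v₀' Φ) := by
  have hUc := continuous_lagU hD.cont_u hΦ
  have hFc := hF.diff.continuous
  have hF'c := hF.continuous_fderiv
  refine ⟨fun q ξ => by rw [lagStep_diag]; rfl, fun q ξ => by rw [lagStep_diag]; rfl, ?_, ?_⟩
  · intro q y ξ
    have e1 : (fun ξ => (_root_.lagStep F u₀ v₀ v₀' Φ (q, y, ξ)).1) =
        fun ξ => ξ + ∫ t in ξ..y, (Φ (q, t, ξ)).2.1 := by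
      ext ξ
      exact lagStep_apply hF hD hΦ (ContinuousLinearMap.fst ℝ ℝ _) q y ξ
    have e2 : (_root_.lagStep F u₀ v₀ v₀' Φ (q, y, ξ)).2.2.1 =
        1 - v₀ (q, ξ) + ∫ t in ξ..y, (Φ (q, t, ξ)).2.2.2 :=
      lagStep_apply hF hD hΦ ((ContinuousLinearMap.fst ℝ ℝ ℝ).comp
        ((ContinuousLinearMap.snd ℝ ℝ _).comp (ContinuousLinearMap.snd ℝ ℝ _))) q y ξ
    rw [e1, e2]
    have h1 := hasDerivAt_intervalIntegral_lower (g := fun p : ℝ × ℝ => (Φ (q, p.1, p.2)).2.1)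
      (g' := fun p : ℝ × ℝ => (Φ (q, p.1, p.2)).2.2.2) (by fun_prop) (by fun_prop)
      (fun p => h.deriv_V q p.1 p.2) y ξ
    -- The end point term is −V(q, ξ, ξ) = −v₀, which matches the initial value 1 − v₀ of J.
    refine ((hasDerivAt_id ξ).add h1).congr_deriv ?_
    simp only [h.diag_V]
    ring
  · intro q y ξ
    have e1 : (fun ξ => (_root_.lagStep F u₀ v₀ v₀' Φ (q, y, ξ)).2.1) = fun ξ => v₀ (q, ξ) +
        ∫ t in ξ..y, -F (q, t, (Φ (q, t, ξ)).1, lagU u₀ Φ (q, t, ξ), (Φ (q, t, ξ)).2.1) := by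
      ext ξ
      exact lagStep_apply hF hD hΦ
        ((ContinuousLinearMap.fst ℝ ℝ (ℝ × ℝ)).comp (ContinuousLinearMap.snd ℝ ℝ _)) q y ξ
    have e2 := lagStep_apply hF hD hΦ ((ContinuousLinearMap.snd ℝ ℝ ℝ).comp
        ((ContinuousLinearMap.snd ℝ ℝ _).comp (ContinuousLinearMap.snd ℝ ℝ _))) q y ξ
    simp only [ContinuousLinearMap.comp_apply, ContinuousLinearMap.coe_snd'] at e2
    rw [e1, e2]
    have h1 := hasDerivAt_intervalIntegral_lower (b := y) (x := ξ)
      (g := fun p : ℝ × ℝ => -F (q, p.1, (Φ (q, p.1, p.2)).1, lagU u₀ Φ (q, p.1, p.2),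
        (Φ (q, p.1, p.2)).2.1))
      (g' := fun p : ℝ × ℝ =>
        (lagRhs F q p.1 (Φ (q, p.1, p.2)) (lagU u₀ Φ (q, p.1, p.2))).2.2.2)
      (by fun_prop) (by unfold lagRhs; fun_prop) (fun p => ?_)
    -- The end point term is +F on the diagonal, which matches the initial value v₀' + F of P.
    · refine ((hD.deriv_v (q, ξ)).add h1).congr_deriv ?_
      simp only [h.diag_V, h.diag_Z, lagU_diag, neg_neg, lagInit]
      ring
    · have hcurve : HasDerivAt (fun ξ => ((q, p.1, (Φ (q, p.1, ξ)).1, lagU u₀ Φ (q, p.1, ξ),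
          (Φ (q, p.1, ξ)).2.1) : ℝ × ℝ × ℝ × ℝ × ℝ)) _ p.2 :=
        (hasDerivAt_const p.2 q).prodMk ((hasDerivAt_const p.2 p.1).prodMk
          ((h.deriv_Z q p.1 p.2).prodMk ((hasDerivAt_lagU hΦ q p.1 p.2).prodMk
            (h.deriv_V q p.1 p.2))))
      exact ((hF.diff _).hasFDerivAt.comp_hasDerivAt p.2 hcurve).neg

theorem lagRel_lagSeq (hF : SourceBound F C) (hD : DataBound u₀ v₀ v₀' M) (n : ℕ) :
    LagRel v₀ (lagSeq F u₀ v₀ v₀' n) := by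
  induction n with
  -- The starting iterate Z = ξ, V = v₀ carries J = 1 and P = v₀' so that the relations already
  -- hold; J = 1 is not the true initial value 1 − v₀.
  | zero => exact ⟨fun q ξ => rfl, fun q ξ => rfl, fun q y ξ => hasDerivAt_id ξ,
      fun q y ξ => hD.deriv_v (q, ξ)⟩
  | succ n ih => exact ih.lagStep hF hD (continuous_lagSeq hF hD n)

/-- Common bound on a strip. -/
theorem exists_stripBound_lagSeq (hF : SourceBound F C) (hD : DataBound u₀ v₀ v₀' M) {h : ℝ}
    (hh : 0 ≤ h) : ∃ B, 1 ≤ B ∧ ∀ n, StripBound (lagSeq F u₀ v₀ v₀' n) h B := by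
  have hC := hF.nonneg
  have hM : 0 ≤ M := (abs_nonneg _).trans (hD.bound_v 0)
  have hE : 1 ≤ Real.exp ((1 + C) * (1 + M + C * h) * h) := Real.one_le_exp (by positivity)
  refine ⟨(1 + M + C * h) + (1 + M + C) * Real.exp ((1 + C) * (1 + M + C * h) * h), ?_, ?_⟩
  · nlinarith [mul_nonneg hC hh]
  intro n p hp
  obtain ⟨h1, h2, h3⟩ := lagSeq_bound hF hD hh n p hp
  have e1 : C * |p.2.1 - p.2.2| ≤ C * h := by gcongr
  have e2 : (1 + M + C) * Real.exp ((1 + C) * (1 + M + C * h) * |p.2.1 - p.2.2|) ≤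
      (1 + M + C) * Real.exp ((1 + C) * (1 + M + C * h) * h) := by gcongr
  have e3 : 0 ≤ C * h := by positivity
  have e4 : 0 ≤ (1 + M + C) * Real.exp ((1 + C) * (1 + M + C * h) * h) := by positivity
  exact ⟨by linarith, by linarith, by linarith⟩

/-- The component Z is not bounded on a strip, but the first two iterates have Z = ξ on the diagonal
and differ by an integral of V, at most Bh. From there each contraction step halves the weighted
distance. -/
theorem exists_geometric_lagSeq (hF : SourceBound F C) (hD : DataBound u₀ v₀ v₀' M) {h : ℝ}
    (hh : 0 ≤ h) {B Λ : ℝ} (hB1 : 1 ≤ B) (hB : ∀ n, StripBound (lagSeq F u₀ v₀ v₀' n) h B)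
    (hΛ : Λ = 2 * ((1 + C * (2 * B ^ 2)) * (1 + B * h))) :
    ∃ d, 0 ≤ d ∧ ∀ n, ∀ p : ℝ × ℝ × ℝ, |p.2.1 - p.2.2| ≤ h →
      ‖lagSeq F u₀ v₀ v₀' n p - lagSeq F u₀ v₀ v₀' (n + 1) p‖ ≤
        d / 2 ^ n * Real.exp (Λ * |p.2.1 - p.2.2|) := by
  have hC := hF.nonneg
  refine ⟨2 * B + B * h, by positivity, fun n => ?_⟩
  induction n with
  | zero =>
    intro p hp
    have h0 := hB 0 p hp
    have h1 := hB 1 p hp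
    have hΛ0 : 0 ≤ Λ := by rw [hΛ]; positivity
    have hE : 1 ≤ Real.exp (Λ * |p.2.1 - p.2.2|) := Real.one_le_exp (by positivity)
    have key : ‖lagSeq F u₀ v₀ v₀' 0 p - lagSeq F u₀ v₀ v₀' (0 + 1) p‖ ≤ 2 * B + B * h := by
      have hBh : 0 ≤ B * h := by positivity
      have aux : ∀ a b : ℝ, |a| ≤ B → |b| ≤ B → |a - b| ≤ 2 * B + B * h := fun a b ha hb =>
        (abs_sub _ _).trans (by linarith)
      rw [norm4_le_iff]
      refine ⟨?_, aux _ _ h0.1 h1.1, aux _ _ h0.2.1 h1.2.1, aux _ _ h0.2.2 h1.2.2⟩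
      obtain ⟨q, y, ξ⟩ := p
      have e1 : (lagSeq F u₀ v₀ v₀' (0 + 1) (q, y, ξ)).1 =
          ξ + ∫ t in ξ..y, (lagSeq F u₀ v₀ v₀' 0 (q, t, ξ)).2.1 :=
        lagStep_apply hF hD (continuous_lagSeq hF hD 0) (ContinuousLinearMap.fst ℝ ℝ _) q y ξ
      rw [Prod.fst_sub, e1]
      simp only [lagSeq, sub_add_cancel_left, abs_neg]
      rw [← Real.norm_eq_abs]
      refine (intervalIntegral.norm_integral_le_of_norm_le_const (C := B) fun t _ => h0.1).trans ?_
      simp only at hp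
      nlinarith
    simp only [pow_zero, div_one]
    nlinarith [norm_nonneg (lagSeq F u₀ v₀ v₀' 0 p - lagSeq F u₀ v₀ v₀' (0 + 1) p)]
  | succ n ih =>
    intro p hp
    have := norm_lagStep_sub_le (v₀ := v₀) (v₀' := v₀') hF hD.cont_u (continuous_lagSeq hF hD n)
      (continuous_lagSeq hF hD (n + 1)) (hB n) (hB (n + 1)) hB1 hh (by positivity) hΛ ih p hp
    refine this.trans (le_of_eq ?_)
    rw [pow_succ]
    field_simp

/-- A solution `(Z, V, J, P, U)` of the Lagrangian system. -/
structure LagrangeSol (F : ℝ × ℝ × ℝ × ℝ × ℝ → ℝ) (u₀ v₀ v₀' : ℝ × ℝ → ℝ)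
    (Z V J P U : ℝ × ℝ × ℝ → ℝ) : Prop where
  cont_Z : Continuous Z
  cont_V : Continuous V
  cont_J : Continuous J
  cont_P : Continuous P
  cont_U : Continuous U
  Z_diag : ∀ q ξ, Z (q, ξ, ξ) = ξ
  V_diag : ∀ q ξ, V (q, ξ, ξ) = v₀ (q, ξ)
  J_diag : ∀ q ξ, J (q, ξ, ξ) = 1 - v₀ (q, ξ)
  P_diag : ∀ q ξ, P (q, ξ, ξ) = v₀' (q, ξ) + F (q, ξ, ξ, u₀ (q, ξ), v₀ (q, ξ))
  Z_y : ∀ q y ξ, HasDerivAt (fun y => Z (q, y, ξ)) (V (q, y, ξ)) y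
  V_y : ∀ q y ξ, HasDerivAt (fun y => V (q, y, ξ))
    (-F (q, y, Z (q, y, ξ), U (q, y, ξ), V (q, y, ξ))) y
  J_y : ∀ q y ξ, HasDerivAt (fun y => J (q, y, ξ)) (P (q, y, ξ)) y
  P_y : ∀ q y ξ, HasDerivAt (fun y => P (q, y, ξ))
    (-(fderiv ℝ F (q, y, Z (q, y, ξ), U (q, y, ξ), V (q, y, ξ))
      (0, 0, J (q, y, ξ), 1 / 2 * (V (q, y, ξ) * J (q, y, ξ)), P (q, y, ξ)))) y
  Z_ξ : ∀ q y ξ, HasDerivAt (fun ξ => Z (q, y, ξ)) (J (q, y, ξ)) ξ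
  V_ξ : ∀ q y ξ, HasDerivAt (fun ξ => V (q, y, ξ)) (P (q, y, ξ)) ξ
  U_ξ : ∀ q y ξ, HasDerivAt (fun ξ => U (q, y, ξ)) (1 / 2 * (V (q, y, ξ) * J (q, y, ξ))) ξ
  U_eq : ∀ q y ξ, U (q, y, ξ) = u₀ (q, y) - 1 / 2 * ∫ r in ξ..y, V (q, y, r) * J (q, y, r)

theorem exists_lagrangeSol_of_fixedPoint (hF : SourceBound F C) (hD : DataBound u₀ v₀ v₀' M)
    {Φ : ℝ × ℝ × ℝ → ℝ × ℝ × ℝ × ℝ} (hΦ : Continuous Φ) (hfix : lagStep F u₀ v₀ v₀' Φ = Φ)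
    (hrel : LagRel v₀ Φ) :
    LagrangeSol F u₀ v₀ v₀' (fun p => (Φ p).1) (fun p => (Φ p).2.1) (fun p => (Φ p).2.2.1)
      (fun p => (Φ p).2.2.2) (lagU u₀ Φ) := by
  have hdiag : ∀ q ξ, Φ (q, ξ, ξ) = lagInit F u₀ v₀ v₀' q ξ := by
    intro q ξ
    rw [← lagStep_diag (F := F) (v₀' := v₀') Φ q ξ, hfix]
  have hy : ∀ q y ξ, HasDerivAt (fun y => Φ (q, y, ξ))
      (lagRhs F q y (Φ (q, y, ξ)) (lagU u₀ Φ (q, y, ξ))) y := by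
    intro q y ξ
    have hRc : Continuous fun t : ℝ => lagRhs F q t (Φ (q, t, ξ)) (lagU u₀ Φ (q, t, ξ)) :=
      (continuous_lagRhs_comp hF hD.cont_u hΦ).comp
        (by fun_prop : Continuous fun t : ℝ => (q, t, ξ))
    have h1 := (hRc.integral_hasStrictDerivAt ξ y).hasDerivAt.const_add (lagInit F u₀ v₀ v₀' q ξ)
    have e : (fun y => Φ (q, y, ξ)) = fun y => lagStep F u₀ v₀ v₀' Φ (q, y, ξ) := by rw [hfix]
    rw [e]
    exact h1
  exact
    { cont_Z := by fun_prop
      cont_V := by fun_prop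
      cont_J := by fun_prop
      cont_P := by fun_prop
      cont_U := continuous_lagU hD.cont_u hΦ
      Z_diag := hrel.diag_Z
      V_diag := hrel.diag_V
      J_diag := fun q ξ => by rw [hdiag]; rfl
      P_diag := fun q ξ => by rw [hdiag]; rfl
      Z_y := fun q y ξ => (hy q y ξ).fst
      V_y := fun q y ξ => (hy q y ξ).snd.fst
      J_y := fun q y ξ => (hy q y ξ).snd.snd.fst
      P_y := fun q y ξ => (hy q y ξ).snd.snd.snd
      Z_ξ := hrel.deriv_Z
      V_ξ := hrel.deriv_V
      U_ξ := hasDerivAt_lagU hΦ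
      U_eq := fun q y ξ => rfl }

/-- The Lagrangian system has a global solution. -/
theorem exists_lagrangeSol (hF : SourceBound F C) (hD : DataBound u₀ v₀ v₀' M) :
    ∃ Z V J P U, LagrangeSol F u₀ v₀ v₀' Z V J P U := by
  have hC := hF.nonneg
  set φ := lagSeq F u₀ v₀ v₀' with hφ
  have hlim : ∀ h : ℝ, 0 ≤ h → ∃ B Λ K : ℝ, 1 ≤ B ∧ (∀ n, StripBound (φ n) h B) ∧
      0 ≤ K ∧ Λ = 2 * ((1 + C * (2 * B ^ 2)) * (1 + B * h)) ∧
      ∀ n, ∀ p : ℝ × ℝ × ℝ, |p.2.1 - p.2.2| ≤ h →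
        dist (φ n p) (φ (n + 1) p) ≤ K / 2 / 2 ^ n := by
    intro h hh
    obtain ⟨B, hB1, hB⟩ := exists_stripBound_lagSeq hF hD hh
    obtain ⟨d, hd, hdn⟩ := exists_geometric_lagSeq hF hD hh hB1 hB rfl
    set Λ := 2 * ((1 + C * (2 * B ^ 2)) * (1 + B * h)) with hΛ
    have hΛ0 : 0 ≤ Λ := by positivity
    refine ⟨B, Λ, 2 * (d * Real.exp (Λ * h)), hB1, hB, by positivity, rfl, fun n p hp => ?_⟩
    rw [dist_eq_norm]
    refine (hdn n p hp).trans ?_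
    rw [mul_div_cancel_left₀ _ (two_ne_zero), mul_div_right_comm]
    gcongr
  have hex : ∀ p, ∃ x, Tendsto (fun n => φ n p) atTop (𝓝 x) := by
    intro p
    obtain ⟨B, Λ, K, -, -, -, -, hK⟩ := hlim |p.2.1 - p.2.2| (abs_nonneg _)
    exact cauchySeq_tendsto_of_complete
      (cauchySeq_of_le_geometric_two (C := K) fun n => hK n p le_rfl)
  choose Φ hΦ using hex
  have hloc : ∀ h : ℝ, 0 ≤ h → TendstoUniformlyOn φ Φ atTop {p | |p.2.1 - p.2.2| ≤ h} := by
    intro h hh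
    obtain ⟨B, Λ, K, -, -, hK0, -, hK⟩ := hlim h hh
    rw [Metric.tendstoUniformlyOn_iff]
    intro ε hε
    have h2 : Tendsto (fun n : ℕ => K / 2 ^ n) atTop (𝓝 0) := by
      have := (tendsto_pow_atTop_nhds_zero_of_lt_one (r := (1 / 2 : ℝ)) (by norm_num)
        (by norm_num)).const_mul K
      simpa [div_eq_mul_inv] using this
    filter_upwards [h2.eventually (gt_mem_nhds hε)] with n hn p hp
    rw [dist_comm]
    exact (dist_le_of_le_geometric_two_of_tendsto (fun n => hK n p hp) (hΦ p) n).trans_lt hn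
  -- Each point is interior to a strip, so uniform convergence on strips is locally uniform,
  -- although the constants grow with the width.
  have hnear : ∀ p : ℝ × ℝ × ℝ, {p' : ℝ × ℝ × ℝ | |p'.2.1 - p'.2.2| ≤ |p.2.1 - p.2.2| + 1} ∈ 𝓝 p := by
    intro p
    have hc : Continuous fun p' : ℝ × ℝ × ℝ => |p'.2.1 - p'.2.2| := by fun_prop
    exact (hc.continuousAt.eventually (gt_mem_nhds (lt_add_one _))).mono fun _ h => le_of_lt h
  have hΦc : Continuous Φ := by
    have : TendstoLocallyUniformly φ Φ atTop := by
      rw [tendstoLocallyUniformly_iff_forall_tendsto]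
      intro p
      have h1 := hloc (|p.2.1 - p.2.2| + 1) (by positivity)
      rw [tendstoUniformlyOn_iff_tendsto] at h1
      exact h1.mono_left (prod_mono le_rfl (le_principal_iff.2 (hnear p)))
    exact this.continuous (Frequently.of_forall fun n => continuous_lagSeq hF hD n)
  have hbd : ∀ h B : ℝ, (∀ n, StripBound (φ n) h B) → StripBound Φ h B := by
    intro h B hB p hp
    have c2 : Continuous fun x : ℝ × ℝ × ℝ × ℝ => |x.2.1| := by fun_prop
    have c3 : Continuous fun x : ℝ × ℝ × ℝ × ℝ => |x.2.2.1| := by fun_prop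
    have c4 : Continuous fun x : ℝ × ℝ × ℝ × ℝ => |x.2.2.2| := by fun_prop
    exact ⟨le_of_tendsto ((c2.tendsto _).comp (hΦ p)) (Eventually.of_forall fun n => (hB n p hp).1),
      le_of_tendsto ((c3.tendsto _).comp (hΦ p)) (Eventually.of_forall fun n => (hB n p hp).2.1),
      le_of_tendsto ((c4.tendsto _).comp (hΦ p)) (Eventually.of_forall fun n => (hB n p hp).2.2)⟩
  have hfix : lagStep F u₀ v₀ v₀' Φ = Φ := by
    ext1 p
    obtain ⟨B, Λ, K, hB1, hB, hK0, hΛ, hK⟩ := hlim |p.2.1 - p.2.2| (abs_nonneg _)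
    have hΛ0 : 0 ≤ Λ := by rw [hΛ]; positivity
    -- The contraction estimate between φ n and Φ, whose weighted distance is at most K/2^n, shows
    -- that the images converge; these images are the iterates φ (n + 1), which converge to Φ.
    have h1 : Tendsto (fun n => lagStep F u₀ v₀ v₀' (φ n) p) atTop
        (𝓝 (lagStep F u₀ v₀ v₀' Φ p)) := by
      rw [tendsto_iff_norm_sub_tendsto_zero]
      have h2 : Tendsto (fun n : ℕ => K / 2 ^ n / 2 * Real.exp (Λ * |p.2.1 - p.2.2|)) atTop
          (𝓝 0) := by
        have := (tendsto_pow_atTop_nhds_zero_of_lt_one (r := (1 / 2 : ℝ)) (by norm_num)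
          (by norm_num)).mul_const (K / 2 * Real.exp (Λ * |p.2.1 - p.2.2|))
        rw [zero_mul] at this
        refine this.congr fun n => ?_
        rw [one_div, inv_pow]
        ring
      refine squeeze_zero (fun n => norm_nonneg _) (fun n => ?_) h2
      refine norm_lagStep_sub_le hF hD.cont_u (continuous_lagSeq hF hD n) hΦc (hB n) (hbd _ _ hB) hB1
        (abs_nonneg _) (by positivity) hΛ (fun p' hp' => ?_) p le_rfl
      rw [← dist_eq_norm]
      refine (dist_le_of_le_geometric_two_of_tendsto (fun n => hK n p' hp') (hΦ p') n).trans ?_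
      exact le_mul_of_one_le_right (by positivity) (Real.one_le_exp (by positivity))
    exact tendsto_nhds_unique h1 ((hΦ p).comp (tendsto_add_atTop_nat 1))
  have hrel : LagRel v₀ Φ := by
    have hsec : ∀ q y : ℝ, TendstoLocallyUniformlyOn (fun n ξ => φ n (q, y, ξ))
        (fun ξ => Φ (q, y, ξ)) atTop univ := by
      intro q y
      rw [tendstoLocallyUniformlyOn_univ, tendstoLocallyUniformly_iff_forall_tendsto]
      intro ξ
      have h1 := hloc (|y - ξ| + 1) (by positivity)
      rw [tendstoUniformlyOn_iff_tendsto] at h1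
      have h3 : Tendsto (fun r : ℝ => (q, y, r)) (𝓝 ξ)
          (𝓟 {p : ℝ × ℝ × ℝ | |p.2.1 - p.2.2| ≤ |y - ξ| + 1}) := by
        refine Tendsto.mono_right (Continuous.tendsto (by fun_prop) ξ)
          (le_principal_iff.2 (hnear (q, y, ξ)))
      exact h1.comp (tendsto_id.prodMap h3)
    have hcomp : ∀ (ℓ : (ℝ × ℝ × ℝ × ℝ) →L[ℝ] ℝ) (q y : ℝ),
        TendstoLocallyUniformlyOn (fun n ξ => ℓ (φ n (q, y, ξ))) (fun ξ => ℓ (Φ (q, y, ξ)))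
          atTop univ := fun ℓ q y => ℓ.uniformContinuous.comp_tendstoLocallyUniformlyOn (hsec q y)
    have hr := lagRel_lagSeq hF hD
    refine ⟨fun q ξ => ?_, fun q ξ => ?_, fun q y ξ => ?_, fun q y ξ => ?_⟩
    · exact tendsto_nhds_unique ((continuous_fst.tendsto _).comp (hΦ (q, ξ, ξ)))
        (tendsto_const_nhds.congr fun n => ((hr n).diag_Z q ξ).symm)
    · exact tendsto_nhds_unique (((continuous_fst.comp continuous_snd).tendsto _).comp
        (hΦ (q, ξ, ξ))) (tendsto_const_nhds.congr fun n => ((hr n).diag_V q ξ).symm)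
    · exact hasDerivAt_of_tendstoLocallyUniformlyOn (f := fun n ξ => (φ n (q, y, ξ)).1)
        (f' := fun n ξ => (φ n (q, y, ξ)).2.2.1) isOpen_univ
        (hcomp ((ContinuousLinearMap.fst ℝ ℝ ℝ).comp
          ((ContinuousLinearMap.snd ℝ ℝ _).comp (ContinuousLinearMap.snd ℝ ℝ _))) q y)
        (Eventually.of_forall fun n ξ _ => (hr n).deriv_Z q y ξ)
        (fun ξ _ => (continuous_fst.tendsto _).comp (hΦ (q, y, ξ))) (mem_univ ξ)
    · exact hasDerivAt_of_tendstoLocallyUniformlyOn (f := fun n ξ => (φ n (q, y, ξ)).2.1)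
        (f' := fun n ξ => (φ n (q, y, ξ)).2.2.2) isOpen_univ
        (hcomp ((ContinuousLinearMap.snd ℝ ℝ ℝ).comp
          ((ContinuousLinearMap.snd ℝ ℝ _).comp (ContinuousLinearMap.snd ℝ ℝ _))) q y)
        (Eventually.of_forall fun n ξ _ => (hr n).deriv_V q y ξ)
        (fun ξ _ => ((continuous_fst.comp continuous_snd).tendsto _).comp (hΦ (q, y, ξ)))
        (mem_univ ξ)
  exact ⟨_, _, _, _, _, exists_lagrangeSol_of_fixedPoint hF hD hΦc hfix hrel⟩

end PicardLimit

/-! ### First derivatives of u in Lagrangian coordinates -/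

namespace LagrangeSol

variable {F : ℝ × ℝ × ℝ × ℝ × ℝ → ℝ} {u₀ v₀ v₀' : ℝ × ℝ → ℝ} {C M : ℝ}
  {Z V J P U : ℝ × ℝ × ℝ → ℝ}

theorem continuous_source (hF : SourceBound F C) (S : LagrangeSol F u₀ v₀ v₀' Z V J P U) :
    Continuous fun p : ℝ × ℝ × ℝ => F (p.1, p.2.1, Z p, U p, V p) := by
  have h0 := hF.diff.continuous
  have h1 := S.cont_Z
  have h2 := S.cont_V
  have h3 := S.cont_U
  fun_prop

/-- The function `∂_y u` in Lagrangian coordinates; `u₀'` is the derivative of `u₀`. -/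
noncomputable def lagN (F : ℝ × ℝ × ℝ × ℝ × ℝ → ℝ) (u₀' v₀ : ℝ × ℝ → ℝ)
    (Z V J U : ℝ × ℝ × ℝ → ℝ) (p : ℝ × ℝ × ℝ) : ℝ :=
  u₀' (p.1, p.2.1) - 1 / 2 * v₀ (p.1, p.2.1) + 1 / 4 * v₀ (p.1, p.2.1) ^ 2 - 1 / 4 * V p ^ 2 +
    1 / 2 * ∫ r in p.2.2..p.2.1, F (p.1, p.2.1, Z (p.1, p.2.1, r), U (p.1, p.2.1, r),
      V (p.1, p.2.1, r)) * J (p.1, p.2.1, r)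

/-- In null coordinates ∂_z(∂_y u) = ½v_y = −½(F + v v_z); multiplying by z_ξ = J and using v_z J =
P gives the right-hand side. -/
theorem lagN_ξ (hF : SourceBound F C) (S : LagrangeSol F u₀ v₀ v₀' Z V J P U) (u₀' : ℝ × ℝ → ℝ)
    (q y ξ : ℝ) : HasDerivAt (fun ξ => lagN F u₀' v₀ Z V J U (q, y, ξ))
      (-(1 / 2 * (V (q, y, ξ) * P (q, y, ξ))) -
        1 / 2 * (F (q, y, Z (q, y, ξ), U (q, y, ξ), V (q, y, ξ)) * J (q, y, ξ))) ξ := by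
  have hs := S.continuous_source hF
  have hJ := S.cont_J
  have hc : Continuous fun r => F (q, y, Z (q, y, r), U (q, y, r), V (q, y, r)) * J (q, y, r) :=
    (hs.mul hJ).comp (by fun_prop : Continuous fun r : ℝ => (q, y, r))
  have h1 := intervalIntegral.integral_hasDerivAt_left (hc.intervalIntegrable ξ y)
    (hc.stronglyMeasurableAtFilter _ _) hc.continuousAt
  have h2 := (((S.V_ξ q y ξ).pow 2).const_mul (1 / 4)).const_sub
    (u₀' (q, y) - 1 / 2 * v₀ (q, y) + 1 / 4 * v₀ (q, y) ^ 2)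
  refine (h2.add (h1.const_mul (1 / 2))).congr_deriv ?_
  push_cast
  ring

/-- Leibniz rule in `y` at fixed label for integrals over labels at fixed `y`. -/
theorem hasDerivAt_integral_label {G G' : ℝ × ℝ × ℝ → ℝ} (hG : Continuous G) (hG' : Continuous G')
    (hd : ∀ q y ξ, HasDerivAt (fun y => G (q, y, ξ)) (G' (q, y, ξ)) y) (q y ξ : ℝ) :
    HasDerivAt (fun y => ∫ r in ξ..y, G (q, y, r))
      (G (q, y, y) + ∫ r in ξ..y, G' (q, y, r)) y := by
  have h1 := hasDerivAt_intervalIntegral_lower (g := fun p : ℝ × ℝ => G (q, p.2, p.1))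
    (g' := fun p : ℝ × ℝ => G' (q, p.2, p.1)) (by fun_prop) (by fun_prop)
    (fun p => hd q p.2 p.1) ξ y
  have e : (fun y => ∫ r in ξ..y, G (q, y, r)) = fun y => -∫ r in y..ξ, G (q, y, r) := by
    ext y
    rw [intervalIntegral.integral_symm]
  rw [e]
  refine h1.neg.congr_deriv ?_
  rw [intervalIntegral.integral_symm y ξ]
  ring

/-- Along a characteristic dz/dy = V and u_z = V/2, so the derivative of u is u_y + V²/2. The
formula in `lagN` is what the integral for U gives: VP = (V²/2)_ξ integrates exactly, and the
integral of FJ remains. -/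
theorem U_y (hF : SourceBound F C) (S : LagrangeSol F u₀ v₀ v₀' Z V J P U) {u₀' : ℝ × ℝ → ℝ}
    (hu : ∀ p, HasDerivAt (fun x => u₀ (p.1, x)) (u₀' p) p.2) (q y ξ : ℝ) :
    HasDerivAt (fun y => U (q, y, ξ))
      (lagN F u₀' v₀ Z V J U (q, y, ξ) + 1 / 2 * V (q, y, ξ) ^ 2) y := by
  have hs := S.continuous_source hF
  have h0 := hF.diff.continuous
  have hZ := S.cont_Z
  have hU := S.cont_U
  have hV := S.cont_V
  have hJ := S.cont_J
  have hP := S.cont_P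
  have h1 := hasDerivAt_integral_label (G := fun p => V p * J p)
    (G' := fun p => -F (p.1, p.2.1, Z p, U p, V p) * J p + V p * P p) (by fun_prop) (by fun_prop)
    (fun q y ξ => ((S.V_y q y ξ).mul (S.J_y q y ξ))) q y ξ
  have e : (fun y => U (q, y, ξ)) =
      fun y => u₀ (q, y) - 1 / 2 * ∫ r in ξ..y, V (q, y, r) * J (q, y, r) := by
    ext y
    exact S.U_eq q y ξ
  rw [e]
  refine ((hu (q, y)).sub (h1.const_mul (1 / 2))).congr_deriv ?_
  have hVP : Continuous fun r => V (q, y, r) * P (q, y, r) := by fun_prop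
  have hFJ : Continuous fun r => F (q, y, Z (q, y, r), U (q, y, r), V (q, y, r)) * J (q, y, r) :=
    (hs.mul hJ).comp (by fun_prop : Continuous fun r : ℝ => (q, y, r))
  have h2 : ∫ r in ξ..y, V (q, y, r) * P (q, y, r) =
      1 / 2 * V (q, y, y) ^ 2 - 1 / 2 * V (q, y, ξ) ^ 2 := by
    refine intervalIntegral.integral_eq_sub_of_hasDerivAt
      (f := fun r => 1 / 2 * V (q, y, r) ^ 2) (fun r _ => ?_) (hVP.intervalIntegrable _ _)
    refine (((S.V_ξ q y r).pow 2).const_mul (1 / 2)).congr_deriv ?_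
    push_cast
    ring
  have h3 : ∫ r in ξ..y, (-F (q, y, Z (q, y, r), U (q, y, r), V (q, y, r)) * J (q, y, r) +
      V (q, y, r) * P (q, y, r)) =
      -(∫ r in ξ..y, F (q, y, Z (q, y, r), U (q, y, r), V (q, y, r)) * J (q, y, r)) +
        ∫ r in ξ..y, V (q, y, r) * P (q, y, r) := by
    simp only [neg_mul]
    rw [← intervalIntegral.integral_neg]
    exact intervalIntegral.integral_add (hFJ.neg.intervalIntegrable _ _)
      (hVP.intervalIntegrable _ _)
  simp only [h3, h2, lagN, S.V_diag, S.J_diag]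
  ring

theorem continuous_lagN (hF : SourceBound F C) (S : LagrangeSol F u₀ v₀ v₀' Z V J P U)
    {u₀' : ℝ × ℝ → ℝ} (hu : Continuous u₀') (hv : Continuous v₀) :
    Continuous (lagN F u₀' v₀ Z V J U) := by
  have hs := S.continuous_source hF
  have hV := S.cont_V
  have hJ := S.cont_J
  unfold lagN
  refine Continuous.add (by fun_prop) (continuous_const.mul ?_)
  exact continuous_intervalIntegral_param (g := fun (p : ℝ × ℝ × ℝ) r =>
    F (p.1, p.2.1, Z (p.1, p.2.1, r), U (p.1, p.2.1, r), V (p.1, p.2.1, r)) * J (p.1, p.2.1, r))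
    ((hs.mul hJ).comp (by fun_prop : Continuous fun p : (ℝ × ℝ × ℝ) × ℝ => (p.1.1, p.1.2.1, p.2)))
    (by fun_prop) (by fun_prop)

/-- The value of N_y is immaterial: it enters u_tt and u_xx identically and cancels in □u, and near
the focusing point only a local bound is used. -/
theorem exists_lagN_y (hF : SourceBound F C) (hD : DataBound u₀ v₀ v₀' M)
    (S : LagrangeSol F u₀ v₀ v₀' Z V J P U) {u₀' u₀'' : ℝ × ℝ → ℝ}
    (hu : ∀ p, HasDerivAt (fun x => u₀ (p.1, x)) (u₀' p) p.2)
    (hu' : ∀ p, HasDerivAt (fun x => u₀' (p.1, x)) (u₀'' p) p.2)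
    (hcu' : Continuous u₀') (hcu'' : Continuous u₀'') :
    ∃ N' : ℝ × ℝ × ℝ → ℝ, Continuous N' ∧ ∀ q y ξ,
      HasDerivAt (fun y => lagN F u₀' v₀ Z V J U (q, y, ξ)) (N' (q, y, ξ)) y := by
  have hs := S.continuous_source hF
  have h0 := hF.diff.continuous
  have hZ := S.cont_Z
  have hV := S.cont_V
  have hJ := S.cont_J
  have hP := S.cont_P
  have hU := S.cont_U
  have hN := S.continuous_lagN hF hcu' hD.cont_v
  have hF' := hF.continuous_fderiv
  have hv := hD.cont_v
  have hv' := hD.cont_v'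
  set Fy : ℝ × ℝ × ℝ → ℝ := fun p => fderiv ℝ F (p.1, p.2.1, Z p, U p, V p)
    (0, 1, V p, lagN F u₀' v₀ Z V J U p + 1 / 2 * V p ^ 2, -F (p.1, p.2.1, Z p, U p, V p)) with hFy
  have hFyc : Continuous Fy := (hF'.comp (by fun_prop)).clm_apply (by fun_prop)
  have hFyd : ∀ q y ξ, HasDerivAt
      (fun y => F (q, y, Z (q, y, ξ), U (q, y, ξ), V (q, y, ξ))) (Fy (q, y, ξ)) y := by
    intro q y ξ
    have hcurve : HasDerivAt (fun y => ((q, y, Z (q, y, ξ), U (q, y, ξ),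
        V (q, y, ξ)) : ℝ × ℝ × ℝ × ℝ × ℝ)) _ y :=
      (hasDerivAt_const y q).prodMk ((hasDerivAt_id y).prodMk
        ((S.Z_y q y ξ).prodMk ((S.U_y hF hu q y ξ).prodMk (S.V_y q y ξ))))
    exact (hF.diff _).hasFDerivAt.comp_hasDerivAt y hcurve
  have h1 := hasDerivAt_integral_label (G := fun p => F (p.1, p.2.1, Z p, U p, V p) * J p)
    (G' := fun p => Fy p * J p + F (p.1, p.2.1, Z p, U p, V p) * P p) (by fun_prop) (by fun_prop)
    (fun q y ξ => (hFyd q y ξ).mul (S.J_y q y ξ))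
  refine ⟨fun p => u₀'' (p.1, p.2.1) - 1 / 2 * v₀' (p.1, p.2.1) +
    1 / 4 * (2 * v₀ (p.1, p.2.1) * v₀' (p.1, p.2.1)) -
    1 / 4 * (2 * V p * -F (p.1, p.2.1, Z p, U p, V p)) +
    1 / 2 * (F (p.1, p.2.1, Z (p.1, p.2.1, p.2.1), U (p.1, p.2.1, p.2.1),
      V (p.1, p.2.1, p.2.1)) * J (p.1, p.2.1, p.2.1) +
      ∫ r in p.2.2..p.2.1, (Fy (p.1, p.2.1, r) * J (p.1, p.2.1, r) +
        F (p.1, p.2.1, Z (p.1, p.2.1, r), U (p.1, p.2.1, r), V (p.1, p.2.1, r)) *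
          P (p.1, p.2.1, r))), ?_, ?_⟩
  · refine Continuous.add (by fun_prop) (continuous_const.mul (Continuous.add (by fun_prop) ?_))
    exact continuous_intervalIntegral_param (g := fun (p : ℝ × ℝ × ℝ) r =>
      Fy (p.1, p.2.1, r) * J (p.1, p.2.1, r) +
        F (p.1, p.2.1, Z (p.1, p.2.1, r), U (p.1, p.2.1, r), V (p.1, p.2.1, r)) *
          P (p.1, p.2.1, r)) (by fun_prop) (by fun_prop) (by fun_prop)
  · intro q y ξ
    have a1 := (hu' (q, y)).sub ((hD.deriv_v (q, y)).const_mul (1 / 2))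
    have a2 := a1.add (((hD.deriv_v (q, y)).pow 2).const_mul (1 / 4))
    have a3 := a2.sub (((S.V_y q y ξ).pow 2).const_mul (1 / 4))
    have a4 := a3.add ((h1 q y ξ).const_mul (1 / 2))
    refine HasDerivAt.congr_deriv a4 ?_
    push_cast
    ring

end LagrangeSol

/-! ### Inversion of the Lagrangian coordinates -/

theorem HasDerivAt.eventually_lt_right {g : ℝ → ℝ} {g' x : ℝ} (hg : HasDerivAt g g' x)
    (h : g' < 0) : ∀ᶠ z in 𝓝[>] x, g z < g x := by
  have h1 := (hasDerivAt_iff_tendsto_slope.1 hg).eventually (gt_mem_nhds h)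
  have h2 : ∀ᶠ z in 𝓝[>] x, slope g x z < 0 :=
    h1.filter_mono (nhdsWithin_mono x fun z (hz : x < z) => hz.ne')
  filter_upwards [h2, self_mem_nhdsWithin] with z hz hxz
  rw [slope_def_field, div_neg_iff] at hz
  rcases hz with hz | hz
  · linarith [hz.2, show x < z from hxz]
  · linarith [hz.1]

/-- A region of the Lagrangian coordinates, with `-h₁ ≤ y - ξ ≤ h`, in which the time
`(y - Z) / 2` increases along characteristics and distinct characteristics do not meet before the
time `T`. -/
structure EulerDomain (Z V J : ℝ × ℝ × ℝ → ℝ) (h h₁ c T : ℝ) : Prop where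
  h_pos : 0 < h
  h₁_pos : 0 < h₁
  c_pos : 0 < c
  T_pos : 0 < T
  T_le : T ≤ c * h
  V_le : ∀ p : ℝ × ℝ × ℝ, -h₁ ≤ p.2.1 - p.2.2 → p.2.1 - p.2.2 ≤ h → V p ≤ 1 - 2 * c
  J_pos : ∀ p : ℝ × ℝ × ℝ, -h₁ ≤ p.2.1 - p.2.2 → p.2.1 - p.2.2 ≤ h → (p.2.1 - Z p) / 2 < T →
    0 < J p

namespace EulerDomain

variable {F : ℝ × ℝ × ℝ × ℝ × ℝ → ℝ} {u₀ v₀ v₀' : ℝ × ℝ → ℝ} {C M : ℝ}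
  {Z V J P U : ℝ × ℝ × ℝ → ℝ} {h h₁ c T : ℝ}

theorem hasDerivAt_time (S : LagrangeSol F u₀ v₀ v₀' Z V J P U) (q y ξ : ℝ) :
    HasDerivAt (fun y => (y - Z (q, y, ξ)) / 2) ((1 - V (q, y, ξ)) / 2) y :=
  ((hasDerivAt_id y).sub (S.Z_y q y ξ)).div_const 2

theorem hasDerivAt_time_ξ (S : LagrangeSol F u₀ v₀ v₀' Z V J P U) (q y ξ : ℝ) :
    HasDerivAt (fun ξ => (y - Z (q, y, ξ)) / 2) (-J (q, y, ξ) / 2) ξ :=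
  ((S.Z_ξ q y ξ).const_sub y).div_const 2

/-- The time increases at rate at least `c` in `y` along a characteristic. -/
theorem time_sub_le (S : LagrangeSol F u₀ v₀ v₀' Z V J P U)
    (hV : ∀ p : ℝ × ℝ × ℝ, -h₁ ≤ p.2.1 - p.2.2 → p.2.1 - p.2.2 ≤ h → V p ≤ 1 - 2 * c)
    {q ξ y y' : ℝ} (h1 : -h₁ ≤ y - ξ) (hyy : y ≤ y') (h2 : y' - ξ ≤ h) :
    c * (y' - y) ≤ (y' - Z (q, y', ξ)) / 2 - (y - Z (q, y, ξ)) / 2 := by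
  refine (convex_Icc y y').mul_sub_le_image_sub_of_le_deriv
    (f := fun y => (y - Z (q, y, ξ)) / 2)
    (fun x _ => (hasDerivAt_time S q x ξ).continuousAt.continuousWithinAt)
    (fun x _ => (hasDerivAt_time S q x ξ).differentiableAt.differentiableWithinAt)
    (fun x hx => ?_) y (left_mem_Icc.2 hyy) y' (right_mem_Icc.2 hyy) hyy
  rw [(hasDerivAt_time S q x ξ).deriv]
  rw [interior_Icc] at hx
  have := hV (q, x, ξ) (by simp only; linarith [hx.1]) (by simp only; linarith [hx.2])
  linarith

/-- At fixed `y` the time decreases strictly in the label, before the time `T`. -/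
theorem time_lt (E : EulerDomain Z V J h h₁ c T) (S : LagrangeSol F u₀ v₀ v₀' Z V J P U)
    {q y ξ ξ' : ℝ} (h1 : y - ξ ≤ h) (h2 : -h₁ ≤ y - ξ') (hlt : ξ < ξ')
    (hT : (y - Z (q, y, ξ)) / 2 < T) : (y - Z (q, y, ξ')) / 2 < (y - Z (q, y, ξ)) / 2 := by
  set g : ℝ → ℝ := fun r => (y - Z (q, y, r)) / 2 with hg
  have hgc : Continuous g := by
    have := S.cont_Z
    fun_prop
  obtain ⟨m, hm, hmin⟩ := (isCompact_Icc (a := ξ) (b := ξ')).exists_isMinOn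
    (nonempty_Icc.2 hlt.le) hgc.continuousOn
  -- At a minimizer of the time over [ξ, ξ'] the time is below T, so J > 0 there and the time
  -- decreases to its right; the minimizer can only be ξ'. Since J > 0 is known only at times before
  -- T, monotonicity on the whole interval cannot be read off from the sign of the derivative.
  have key : ∀ r ∈ Icc ξ ξ', g r ≤ g m → r = ξ' := by
    intro r hr hrm
    by_contra hne
    have hr' : r < ξ' := lt_of_le_of_ne hr.2 hne
    have hrT : g r < T := (hrm.trans (hmin (left_mem_Icc.2 hlt.le))).trans_lt hT
    have hJ := E.J_pos (q, y, r) (by simp only; linarith [hr.2]) (by simp only; linarith [hr.1]) hrT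
    have hev := (hasDerivAt_time_ξ S q y r).eventually_lt_right (by linarith)
    obtain ⟨z, hz1, hz2⟩ := (hev.and (Ioo_mem_nhdsGT hr')).exists
    have : g m ≤ g z := hmin ⟨hr.1.trans hz2.1.le, hz2.2.le⟩
    have : g z < g r := hz1
    linarith
  have hm' : m = ξ' := key m hm le_rfl
  have hle : g ξ' ≤ g ξ := hm' ▸ hmin (left_mem_Icc.2 hlt.le)
  refine lt_of_le_of_ne hle fun heq => ?_
  have : ξ = ξ' := key ξ (left_mem_Icc.2 hlt.le) (by rw [hm']; exact heq.ge)
  exact hlt.ne this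

/-- Intermediate value theorem between the labels y − h, where the time is at least ch ≥ T, and y +
h₁, where it is at most −ch₁. Admitting slightly negative times makes t = 0 an interior value, so
that two-sided derivatives exist there. -/
theorem exists_label (E : EulerDomain Z V J h h₁ c T) (S : LagrangeSol F u₀ v₀ v₀' Z V J P U)
    (q y : ℝ) {t : ℝ} (ht : -(c * h₁) < t) (ht' : t < T) :
    ∃ ξ, y - ξ < h ∧ -h₁ < y - ξ ∧ (y - Z (q, y, ξ)) / 2 = t := by
  have hh := E.h_pos
  have hh1 := E.h₁_pos
  have hc := E.c_pos
  set g : ℝ → ℝ := fun r => (y - Z (q, y, r)) / 2 with hg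
  have hgc : Continuous g := by
    have := S.cont_Z
    fun_prop
  have e1 : t < g (y - h) := by
    have h3 := time_sub_le S E.V_le (q := q) (ξ := y - h) (y := y - h) (y' := y)
      (by linarith) (by linarith) (by linarith)
    rw [S.Z_diag] at h3
    have := E.T_le
    have h4 : g (y - h) = (y - Z (q, y, y - h)) / 2 := rfl
    linarith
  have e2 : g (y + h₁) < t := by
    have h3 := time_sub_le S E.V_le (q := q) (ξ := y + h₁) (y := y) (y' := y + h₁)
      (by linarith) (by linarith) (by linarith)
    rw [S.Z_diag] at h3
    have h4 : g (y + h₁) = (y - Z (q, y, y + h₁)) / 2 := rfl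
    linarith
  obtain ⟨ξ, hξ, hgξ⟩ := intermediate_value_Ioo' (by linarith : y - h ≤ y + h₁) hgc.continuousOn
    (⟨e2, e1⟩ : t ∈ Ioo (g (y + h₁)) (g (y - h)))
  exact ⟨ξ, by linarith [hξ.1], by linarith [hξ.2], hgξ⟩

theorem label_unique (E : EulerDomain Z V J h h₁ c T) (S : LagrangeSol F u₀ v₀ v₀' Z V J P U)
    {q y t ξ ξ' : ℝ} (ht : t < T) (a1 : y - ξ ≤ h) (a2 : -h₁ ≤ y - ξ)
    (a3 : (y - Z (q, y, ξ)) / 2 = t) (b1 : y - ξ' ≤ h) (b2 : -h₁ ≤ y - ξ')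
    (b3 : (y - Z (q, y, ξ')) / 2 = t) : ξ = ξ' := by
  rcases lt_trichotomy ξ ξ' with hlt | heq | hlt
  · have := E.time_lt S a1 b2 hlt (a3.trans_lt ht)
    linarith
  · exact heq
  · have := E.time_lt S b1 a2 hlt (b3.trans_lt ht)
    linarith

open Classical in
/-- The label of the characteristic through the point with coordinate `y` at time `t`. -/
noncomputable def label (Z : ℝ × ℝ × ℝ → ℝ) (h h₁ : ℝ) (p : ℝ × ℝ × ℝ) : ℝ :=
  if hp : ∃ ξ, p.2.1 - ξ < h ∧ -h₁ < p.2.1 - ξ ∧ (p.2.1 - Z (p.1, p.2.1, ξ)) / 2 = p.2.2 then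
    hp.choose else 0

theorem label_spec (E : EulerDomain Z V J h h₁ c T) (S : LagrangeSol F u₀ v₀ v₀' Z V J P U)
    (q y : ℝ) {t : ℝ} (ht : -(c * h₁) < t) (ht' : t < T) :
    y - label Z h h₁ (q, y, t) < h ∧ -h₁ < y - label Z h h₁ (q, y, t) ∧
      (y - Z (q, y, label Z h h₁ (q, y, t))) / 2 = t := by
  have hex := E.exists_label S q y ht ht'
  have e : label Z h h₁ (q, y, t) = hex.choose := dif_pos hex
  rw [e]
  exact hex.choose_spec

theorem label_eq (E : EulerDomain Z V J h h₁ c T) (S : LagrangeSol F u₀ v₀ v₀' Z V J P U)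
    {q y t ξ : ℝ} (ht : -(c * h₁) < t) (ht' : t < T) (a1 : y - ξ ≤ h) (a2 : -h₁ ≤ y - ξ)
    (a3 : (y - Z (q, y, ξ)) / 2 = t) : label Z h h₁ (q, y, t) = ξ := by
  obtain ⟨b1, b2, b3⟩ := E.label_spec S q y ht ht'
  exact E.label_unique S ht' b1.le b2.le b3 a1 a2 a3

/-- Strict monotonicity traps the label: ξ + η and ξ − η give times strictly below and above t, and
these strict inequalities persist at nearby points. -/
theorem continuousAt_label (E : EulerDomain Z V J h h₁ c T)
    (S : LagrangeSol F u₀ v₀ v₀' Z V J P U) (q y : ℝ) {t : ℝ} (ht : -(c * h₁) < t) (ht' : t < T) :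
    ContinuousAt (label Z h h₁) (q, y, t) := by
  obtain ⟨b1, b2, b3⟩ := E.label_spec S q y ht ht'
  set ξ := label Z h h₁ (q, y, t) with hξ
  have hZ := S.cont_Z
  rw [Metric.continuousAt_iff']
  intro ε hε
  obtain ⟨η, hη0, hη1, hη2, hη3⟩ : ∃ η > 0, η < ε ∧ y - (ξ - η) < h ∧ -h₁ < y - (ξ + η) := by
    refine ⟨min (ε / 2) (min ((h - (y - ξ)) / 2) ((y - ξ + h₁) / 2)), ?_, ?_, ?_, ?_⟩
    · refine lt_min (by linarith) (lt_min (by linarith) (by linarith))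
    · exact (min_le_left _ _).trans_lt (by linarith)
    · have := (min_le_right (ε / 2) _).trans (min_le_left ((h - (y - ξ)) / 2) ((y - ξ + h₁) / 2))
      linarith
    · have := (min_le_right (ε / 2) _).trans (min_le_right ((h - (y - ξ)) / 2) ((y - ξ + h₁) / 2))
      linarith
  have g1 : (y - Z (q, y, ξ + η)) / 2 < t := by
    have := E.time_lt S (q := q) (y := y) (ξ := ξ) (ξ' := ξ + η) b1.le hη3.le (by linarith)
      (b3.trans_lt ht')
    rwa [b3] at this
  have g2 : t < (y - Z (q, y, ξ - η)) / 2 := by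
    by_contra hcon
    push Not at hcon
    have := E.time_lt S (q := q) (y := y) (ξ := ξ - η) (ξ' := ξ) hη2.le b2.le (by linarith)
      (hcon.trans_lt ht')
    linarith
  have c1 : ∀ᶠ p : ℝ × ℝ × ℝ in 𝓝 (q, y, t), (p.2.1 - Z (p.1, p.2.1, ξ + η)) / 2 < p.2.2 :=
    ContinuousAt.eventually_lt (by fun_prop) (by fun_prop) g1
  have c2 : ∀ᶠ p : ℝ × ℝ × ℝ in 𝓝 (q, y, t), p.2.2 < (p.2.1 - Z (p.1, p.2.1, ξ - η)) / 2 :=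
    ContinuousAt.eventually_lt (by fun_prop) (by fun_prop) g2
  have c3 : ∀ᶠ p : ℝ × ℝ × ℝ in 𝓝 (q, y, t), p.2.1 - (ξ - η) < h :=
    ContinuousAt.eventually_lt (by fun_prop) (by fun_prop) hη2
  have c4 : ∀ᶠ p : ℝ × ℝ × ℝ in 𝓝 (q, y, t), -h₁ < p.2.1 - (ξ + η) :=
    ContinuousAt.eventually_lt (by fun_prop) (by fun_prop) hη3
  have c5 : ∀ᶠ p : ℝ × ℝ × ℝ in 𝓝 (q, y, t), -(c * h₁) < p.2.2 :=
    ContinuousAt.eventually_lt (by fun_prop) (by fun_prop) ht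
  have c6 : ∀ᶠ p : ℝ × ℝ × ℝ in 𝓝 (q, y, t), p.2.2 < T :=
    ContinuousAt.eventually_lt (by fun_prop) (by fun_prop) ht'
  filter_upwards [c1, c2, c3, c4, c5, c6] with p d1 d2 d3 d4 d5 d6
  have hgc : Continuous fun r => (p.2.1 - Z (p.1, p.2.1, r)) / 2 := by fun_prop
  obtain ⟨r, hr, hgr⟩ := intermediate_value_Ioo' (by linarith : ξ - η ≤ ξ + η) hgc.continuousOn
    (⟨d1, d2⟩ : p.2.2 ∈ Ioo _ _)
  have : label Z h h₁ p = r :=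
    E.label_eq S d5 d6 (by linarith [hr.1]) (by linarith [hr.2]) hgr
  rw [this, Real.dist_eq, abs_lt]
  constructor <;> linarith [hr.1, hr.2]

/-- Derivative of the label along a curve. -/
theorem hasDerivAt_label (E : EulerDomain Z V J h h₁ c T)
    (S : LagrangeSol F u₀ v₀ v₀' Z V J P U) {q r : ℝ} {y t : ℝ → ℝ} {y' t' : ℝ}
    (ht : -(c * h₁) < t r) (ht' : t r < T) (hy : HasDerivAt y y' r) (hdt : HasDerivAt t t' r) :
    HasDerivAt (fun s => label Z h h₁ (q, y s, t s))
      (((1 - V (q, y r, label Z h h₁ (q, y r, t r))) * y' - 2 * t') /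
        J (q, y r, label Z h h₁ (q, y r, t r))) r := by
  obtain ⟨b1, b2, b3⟩ := E.label_spec S q (y r) ht ht'
  set ξ := label Z h h₁ (q, y r, t r) with hξ
  have hZ := S.cont_Z
  have hV := S.cont_V
  have hJ := S.cont_J
  have hJ0 : 0 < J (q, y r, ξ) := E.J_pos (q, y r, ξ) b2.le b1.le (b3.trans_lt ht')
  set A : ℝ := (1 - V (q, y r, ξ)) / 2
  set B : ℝ := -J (q, y r, ξ) / 2 with hB
  have hB0 : B ≠ 0 := by rw [hB]; linarith
  -- Derivative of (y, ξ) ↦ (y, t): triangular with diagonal entries 1 and −J/2, invertible because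
  -- J > 0. The continuity of the label already proved then gives differentiability of the inverse.
  let L : (ℝ × ℝ) ≃L[ℝ] (ℝ × ℝ) := ContinuousLinearEquiv.equivOfInverse
    ((ContinuousLinearMap.fst ℝ ℝ ℝ).prod
      (A • ContinuousLinearMap.fst ℝ ℝ ℝ + B • ContinuousLinearMap.snd ℝ ℝ ℝ))
    ((ContinuousLinearMap.fst ℝ ℝ ℝ).prod
      ((-A / B) • ContinuousLinearMap.fst ℝ ℝ ℝ + B⁻¹ • ContinuousLinearMap.snd ℝ ℝ ℝ))
    (fun p => by ext <;> simp; field_simp; ring) (fun p => by ext <;> simp; field_simp; ring)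
  have hΨ : HasFDerivAt (fun p : ℝ × ℝ => (p.1, (p.1 - Z (q, p.1, p.2)) / 2))
      (L : ℝ × ℝ →L[ℝ] ℝ × ℝ) (y r, ξ) := by
    have h1 := hasStrictFDerivAt_uncurry_coprod (𝕜 := ℝ) (u := (y r, ξ))
      (f := fun a b => (a - Z (q, a, b)) / 2)
      (f₁ := fun a b => ContinuousLinearMap.toSpanSingleton ℝ ((1 - V (q, a, b)) / 2))
      (f₂ := fun a b => ContinuousLinearMap.toSpanSingleton ℝ (-J (q, a, b) / 2))
      (Eventually.of_forall fun p => (hasDerivAt_time S q p.1 p.2).hasFDerivAt)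
      (Eventually.of_forall fun p => (hasDerivAt_time_ξ S q p.1 p.2).hasFDerivAt)
      ((ContinuousLinearMap.toSpanSingletonCLE (𝕜 := ℝ) (E := ℝ)).continuous.continuousAt.comp
        (f := fun p : ℝ × ℝ => (1 - V (q, p.1, p.2)) / 2) (by fun_prop))
      ((ContinuousLinearMap.toSpanSingletonCLE (𝕜 := ℝ) (E := ℝ)).continuous.continuousAt.comp
        (f := fun p : ℝ × ℝ => -J (q, p.1, p.2) / 2) (by fun_prop))
    refine (hasFDerivAt_fst.prodMk h1.hasFDerivAt).congr_fderiv ?_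
    ext <;> simp [L, Function.HasUncurry.uncurry, A, B]
  have hcl : ContinuousAt (fun p : ℝ × ℝ => (p.1, label Z h h₁ (q, p.1, p.2))) (y r, t r) := by
    refine continuousAt_fst.prodMk ?_
    exact ContinuousAt.comp (x := (y r, t r)) (f := fun p : ℝ × ℝ => (q, p.1, p.2))
      (E.continuousAt_label S q (y r) ht ht') (by fun_prop)
  have hinv := HasFDerivAt.of_local_left_inverse (a := (y r, t r)) hcl hΨ (by
    have c5 : ∀ᶠ p : ℝ × ℝ in 𝓝 (y r, t r), -(c * h₁) < p.2 :=
      ContinuousAt.eventually_lt (by fun_prop) (by fun_prop) ht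
    have c6 : ∀ᶠ p : ℝ × ℝ in 𝓝 (y r, t r), p.2 < T :=
      ContinuousAt.eventually_lt (by fun_prop) (by fun_prop) ht'
    filter_upwards [c5, c6] with p d5 d6
    exact Prod.ext rfl (E.label_spec S q p.1 d5 d6).2.2)
  have hfin : HasDerivAt (fun s => (y s, label Z h h₁ (q, y s, t s))) _ r :=
    hinv.comp_hasDerivAt (f := fun s => (y s, t s)) r (hy.prodMk hdt)
  refine HasDerivAt.congr_deriv hfin.snd ?_
  simp [L, A, B]
  field_simp
  ring

end EulerDomain

/-! ### The Eulerian form of the solution -/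

namespace EulerDomain

variable {F : ℝ × ℝ × ℝ × ℝ × ℝ → ℝ} {u₀ v₀ v₀' : ℝ × ℝ → ℝ} {C M : ℝ}
  {Z V J P U : ℝ × ℝ × ℝ → ℝ} {h h₁ c T : ℝ}

/-- The Eulerian form of a function `H` of the Lagrangian coordinates. -/
noncomputable def eul (Z : ℝ × ℝ × ℝ → ℝ) (h h₁ : ℝ) (H : ℝ × ℝ × ℝ → ℝ) (t : ℝ) (x : Plane) : ℝ :=
  H (x 1, x 0 + t, label Z h h₁ (x 1, x 0 + t, t))

theorem J_pos_label (E : EulerDomain Z V J h h₁ c T) (S : LagrangeSol F u₀ v₀ v₀' Z V J P U)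
    (q y : ℝ) {t : ℝ} (ht : -(c * h₁) < t) (ht' : t < T) :
    0 < J (q, y, label Z h h₁ (q, y, t)) := by
  obtain ⟨b1, b2, b3⟩ := E.label_spec S q y ht ht'
  exact E.J_pos _ b2.le b1.le (b3.trans_lt ht')

theorem hasDerivAt_comp_label (E : EulerDomain Z V J h h₁ c T)
    (S : LagrangeSol F u₀ v₀ v₀' Z V J P U) {H Hy Hξ : ℝ × ℝ × ℝ → ℝ}
    (hy : ∀ q y ξ, HasDerivAt (fun y => H (q, y, ξ)) (Hy (q, y, ξ)) y)
    (hξ : ∀ q y ξ, HasDerivAt (fun ξ => H (q, y, ξ)) (Hξ (q, y, ξ)) ξ)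
    (cy : Continuous Hy) (cξ : Continuous Hξ) {q r : ℝ} {y t : ℝ → ℝ} {y' t' : ℝ}
    (ht : -(c * h₁) < t r) (ht' : t r < T) (hdy : HasDerivAt y y' r) (hdt : HasDerivAt t t' r) :
    HasDerivAt (fun s => H (q, y s, label Z h h₁ (q, y s, t s)))
      (Hy (q, y r, label Z h h₁ (q, y r, t r)) * y' + Hξ (q, y r, label Z h h₁ (q, y r, t r)) *
        (((1 - V (q, y r, label Z h h₁ (q, y r, t r))) * y' - 2 * t') /
          J (q, y r, label Z h h₁ (q, y r, t r)))) r :=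
  hasDerivAt_comp_of_partials (f := fun p : ℝ × ℝ => H (q, p.1, p.2))
    (f₁ := fun p => Hy (q, p.1, p.2)) (f₂ := fun p => Hξ (q, p.1, p.2))
    (b := fun s => label Z h h₁ (q, y s, t s))
    (Eventually.of_forall fun p => hy q p.1 p.2) (Eventually.of_forall fun p => hξ q p.1 p.2)
    (by fun_prop) (by fun_prop) hdy (E.hasDerivAt_label S ht ht' hdy hdt)

theorem add_smul_e₁_zero (x : Plane) (r : ℝ) : (x + r • e₁) 0 = x 0 + r := by simp [e₁]

theorem add_smul_e₁_one (x : Plane) (r : ℝ) : (x + r • e₁) 1 = x 1 := by simp [e₁]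

theorem eul_hasDerivAt_t (E : EulerDomain Z V J h h₁ c T)
    (S : LagrangeSol F u₀ v₀ v₀' Z V J P U) {H Hy Hξ : ℝ × ℝ × ℝ → ℝ}
    (hy : ∀ q y ξ, HasDerivAt (fun y => H (q, y, ξ)) (Hy (q, y, ξ)) y)
    (hξ : ∀ q y ξ, HasDerivAt (fun ξ => H (q, y, ξ)) (Hξ (q, y, ξ)) ξ)
    (cy : Continuous Hy) (cξ : Continuous Hξ) {t : ℝ} (ht : -(c * h₁) < t) (ht' : t < T)
    (x : Plane) : HasDerivAt (fun s => eul Z h h₁ H s x)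
      (eul Z h h₁ (fun p => Hy p - (1 + V p) * Hξ p / J p) t x) t := by
  refine (E.hasDerivAt_comp_label S hy hξ cy cξ (q := x 1) (r := t) (y := fun s => x 0 + s)
    (t := id) ht ht' ((hasDerivAt_id t).const_add (x 0)) (hasDerivAt_id t)).congr_deriv ?_
  simp only [eul, id]
  ring

theorem eul_hasDerivAt_x (E : EulerDomain Z V J h h₁ c T)
    (S : LagrangeSol F u₀ v₀ v₀' Z V J P U) {H Hy Hξ : ℝ × ℝ × ℝ → ℝ}
    (hy : ∀ q y ξ, HasDerivAt (fun y => H (q, y, ξ)) (Hy (q, y, ξ)) y)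
    (hξ : ∀ q y ξ, HasDerivAt (fun ξ => H (q, y, ξ)) (Hξ (q, y, ξ)) ξ)
    (cy : Continuous Hy) (cξ : Continuous Hξ) {t : ℝ} (ht : -(c * h₁) < t) (ht' : t < T)
    (x : Plane) : HasDerivAt (fun r : ℝ => eul Z h h₁ H t (x + r • e₁))
      (eul Z h h₁ (fun p => Hy p + (1 - V p) * Hξ p / J p) t x) 0 := by
  have h1 := E.hasDerivAt_comp_label S hy hξ cy cξ (q := x 1) (r := 0)
    (y := fun r => x 0 + r + t) (t := fun _ => t) ht ht'
    (((hasDerivAt_id (0 : ℝ)).const_add (x 0)).add_const t) (hasDerivAt_const 0 t)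
  simp only [eul, add_smul_e₁_zero, add_smul_e₁_one]
  refine h1.congr_deriv ?_
  simp only [add_zero]
  ring

theorem eul_continuousOn (E : EulerDomain Z V J h h₁ c T)
    (S : LagrangeSol F u₀ v₀ v₀' Z V J P U) {H : ℝ × ℝ × ℝ → ℝ}
    (hH : ∀ p, J p ≠ 0 → ContinuousAt H p) :
    ContinuousOn (Function.uncurry (eul Z h h₁ H)) (Ico 0 T ×ˢ univ) := by
  rintro ⟨t, x⟩ ⟨ht, -⟩
  have ht0 : -(c * h₁) < t := by
    have := mul_pos E.c_pos E.h₁_pos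
    linarith [ht.1]
  have c1 : ContinuousAt (fun p : ℝ × Plane => (p.2 1, p.2 0 + p.1, p.1)) (t, x) := by fun_prop
  have c2 : ContinuousAt (fun p : ℝ × Plane => label Z h h₁ (p.2 1, p.2 0 + p.1, p.1)) (t, x) :=
    ContinuousAt.comp (x := (t, x)) (g := label Z h h₁)
      (E.continuousAt_label S (x 1) (x 0 + t) ht0 ht.2) c1
  have c3 : ContinuousAt (fun p : ℝ × Plane =>
      (p.2 1, p.2 0 + p.1, label Z h h₁ (p.2 1, p.2 0 + p.1, p.1))) (t, x) :=
    ContinuousAt.prodMk (by fun_prop) (ContinuousAt.prodMk (by fun_prop) c2)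
  exact (ContinuousAt.comp (x := (t, x)) (g := H)
    (hH _ (E.J_pos_label S (x 1) (x 0 + t) ht0 ht.2).ne') c3).continuousWithinAt

/-- Regularity and derivatives of functions given by smooth functions of the Lagrangian
coordinates. -/
theorem isC1_of_eq_eul (E : EulerDomain Z V J h h₁ c T)
    (S : LagrangeSol F u₀ v₀ v₀' Z V J P U) {H Hy Hξ : ℝ × ℝ × ℝ → ℝ}
    (hy : ∀ q y ξ, HasDerivAt (fun y => H (q, y, ξ)) (Hy (q, y, ξ)) y)
    (hξ : ∀ q y ξ, HasDerivAt (fun ξ => H (q, y, ξ)) (Hξ (q, y, ξ)) ξ)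
    (cH : Continuous H) (cy : Continuous Hy) (cξ : Continuous Hξ) {w : ℝ → Plane → ℝ}
    (hw : ∀ t ∈ Ico 0 T, ∀ x, w t x = eul Z h h₁ H t x) :
    IsC1 T w ∧
    (∀ t ∈ Ico 0 T, ∀ x, dt w t x = eul Z h h₁ (fun p => Hy p - (1 + V p) * Hξ p / J p) t x) ∧
    (∀ t ∈ Ico 0 T, ∀ x, dx1 w t x = eul Z h h₁ (fun p => Hy p + (1 - V p) * Hξ p / J p) t x) := by
  have hV := S.cont_V
  have hJ := S.cont_J
  have ht0 : ∀ t ∈ Ico 0 T, -(c * h₁) < t := by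
    intro t ht
    have := mul_pos E.c_pos E.h₁_pos
    linarith [ht.1]
  have d1 : ∀ t ∈ Ico 0 T, ∀ x, HasDerivWithinAt (fun s => w s x)
      (eul Z h h₁ (fun p => Hy p - (1 + V p) * Hξ p / J p) t x) (Ici 0) t := by
    intro t ht x
    refine (E.eul_hasDerivAt_t S hy hξ cy cξ (ht0 t ht) ht.2 x).hasDerivWithinAt.congr_of_eventuallyEq
      ?_ (hw t ht x)
    filter_upwards [self_mem_nhdsWithin, mem_nhdsWithin_of_mem_nhds (Iio_mem_nhds ht.2)]
      with s hs hs'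
    exact hw s ⟨hs, hs'⟩ x
  have d2 : ∀ t ∈ Ico 0 T, ∀ x, HasLineDerivAt ℝ (w t)
      (eul Z h h₁ (fun p => Hy p + (1 - V p) * Hξ p / J p) t x) x (EuclideanSpace.single 0 1) := by
    intro t ht x
    have h1 := E.eul_hasDerivAt_x S hy hξ cy cξ (ht0 t ht) ht.2 x
    unfold HasLineDerivAt
    simp only [hw t ht]
    exact h1
  have e1 : ∀ t ∈ Ico 0 T, ∀ x,
      dt w t x = eul Z h h₁ (fun p => Hy p - (1 + V p) * Hξ p / J p) t x := fun t ht x =>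
    (d1 t ht x).derivWithin ((uniqueDiffOn_Ici 0) t ht.1)
  have e2 : ∀ t ∈ Ico 0 T, ∀ x,
      dx1 w t x = eul Z h h₁ (fun p => Hy p + (1 - V p) * Hξ p / J p) t x := fun t ht x =>
    (d2 t ht x).lineDeriv
  refine ⟨⟨?_, fun t ht x => (d1 t ht x).differentiableWithinAt,
    fun t ht x => (d2 t ht x).lineDifferentiableAt, ?_, ?_⟩, e1, e2⟩
  · refine (E.eul_continuousOn S (H := H) fun p _ => cH.continuousAt).congr ?_
    rintro ⟨t, x⟩ ⟨ht, -⟩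
    exact hw t ht x
  · refine (E.eul_continuousOn S (H := fun p => Hy p - (1 + V p) * Hξ p / J p)
      fun p hp => ?_).congr ?_
    · exact cy.continuousAt.sub (ContinuousAt.div (by fun_prop) hJ.continuousAt hp)
    · rintro ⟨t, x⟩ ⟨ht, -⟩
      exact e1 t ht x
  · refine (E.eul_continuousOn S (H := fun p => Hy p + (1 - V p) * Hξ p / J p)
      fun p hp => ?_).congr ?_
    · exact cy.continuousAt.add (ContinuousAt.div (by fun_prop) hJ.continuousAt hp)
    · rintro ⟨t, x⟩ ⟨ht, -⟩
      exact e2 t ht x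

/-- The point of the plane with coordinates `a`, `b`. -/
noncomputable def planeMk (a b : ℝ) : Plane := !₂[a, b]

theorem planeMk_coord (x : Plane) : planeMk (x 0) (x 1) = x := by
  ext i
  fin_cases i <;> rfl

/-- The source term in the coordinates `(q, y, z, u, v)`. -/
noncomputable def charSource (f : ℝ × Plane × ℝ × ℝ → ℝ) (p : ℝ × ℝ × ℝ × ℝ × ℝ) : ℝ :=
  1 / 2 * f ((p.2.1 - p.2.2.1) / 2, planeMk ((p.2.1 + p.2.2.1) / 2) p.1, p.2.2.2.1, p.2.2.2.2)

/-- The Eulerian form of a Lagrangian solution is a classical solution. -/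
theorem isClassicalSolution_eul {f : ℝ × Plane × ℝ × ℝ → ℝ} (hF : SourceBound (charSource f) C)
    (hD : DataBound u₀ v₀ v₀' M) (E : EulerDomain Z V J h h₁ c T)
    (S : LagrangeSol (charSource f) u₀ v₀ v₀' Z V J P U) {u₀' u₀'' : ℝ × ℝ → ℝ}
    (hu : ∀ p, HasDerivAt (fun x => u₀ (p.1, x)) (u₀' p) p.2)
    (hu' : ∀ p, HasDerivAt (fun x => u₀' (p.1, x)) (u₀'' p) p.2)
    (hcu' : Continuous u₀') (hcu'' : Continuous u₀'') {a b : Plane → ℝ}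
    (ha : ∀ x : Plane, a x = u₀ (x 1, x 0))
    (hb : ∀ x : Plane, b x = u₀' (x 1, x 0) - v₀ (x 1, x 0)) :
    IsClassicalSolution f a b T (eul Z h h₁ U) ∧
      ∀ t ∈ Ico 0 T, ∀ x, dx1 (eul Z h h₁ U) t x =
        eul Z h h₁ (fun p => LagrangeSol.lagN (charSource f) u₀' v₀ Z V J U p + 1 / 2 * V p) t x := by
  obtain ⟨Ny, cNy, hNy⟩ := S.exists_lagN_y hF hD hu hu' hcu' hcu''
  have hs := S.continuous_source hF
  have h0 := hF.diff.continuous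
  have hZ := S.cont_Z
  have hV := S.cont_V
  have hJ := S.cont_J
  have hP := S.cont_P
  have hU := S.cont_U
  have cN := S.continuous_lagN hF hcu' hD.cont_v
  set N := LagrangeSol.lagN (charSource f) u₀' v₀ Z V J U with hN
  set G : ℝ × ℝ × ℝ → ℝ := fun p => charSource f (p.1, p.2.1, Z p, U p, V p) with hG
  have ht0 : ∀ t ∈ Ico 0 T, -(c * h₁) < t := by
    intro t ht
    have := mul_pos E.c_pos E.h₁_pos
    linarith [ht.1]
  have hJ0 : ∀ t ∈ Ico 0 T, ∀ x : Plane, J (x 1, x 0 + t, label Z h h₁ (x 1, x 0 + t, t)) ≠ 0 :=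
    fun t ht x => (E.J_pos_label S _ _ (ht0 t ht) ht.2).ne'
  obtain ⟨uC, ut, ux⟩ := E.isC1_of_eq_eul S (H := U) (Hy := fun p => N p + 1 / 2 * V p ^ 2)
    (Hξ := fun p => 1 / 2 * (V p * J p)) (w := eul Z h h₁ U) (S.U_y hF hu) S.U_ξ hU (by fun_prop)
    (by fun_prop) (fun t _ x => rfl)
  -- As U_ξ = VJ/2, the factor 1/J cancels: the first derivatives of u are the continuous Lagrangian
  -- functions N ∓ V/2 and have limits even where J → 0.
  have ut' : ∀ t ∈ Ico 0 T, ∀ x, dt (eul Z h h₁ U) t x =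
      eul Z h h₁ (fun p => N p - 1 / 2 * V p) t x := by
    intro t ht x
    rw [ut t ht x]
    have := hJ0 t ht x
    simp only [eul]
    field_simp
    ring
  have ux' : ∀ t ∈ Ico 0 T, ∀ x, dx1 (eul Z h h₁ U) t x =
      eul Z h h₁ (fun p => N p + 1 / 2 * V p) t x := by
    intro t ht x
    rw [ux t ht x]
    have := hJ0 t ht x
    simp only [eul]
    field_simp
    ring
  have hNξ := S.lagN_ξ hF u₀'
  obtain ⟨utC, utt, -⟩ := E.isC1_of_eq_eul S (H := fun p => N p - 1 / 2 * V p)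
    (Hy := fun p => Ny p - 1 / 2 * -G p)
    (Hξ := fun p => (-(1 / 2 * (V p * P p)) - 1 / 2 * (G p * J p)) - 1 / 2 * P p)
    (w := dt (eul Z h h₁ U)) (fun q y ξ => (hNy q y ξ).sub ((S.V_y q y ξ).const_mul (1 / 2)))
    (fun q y ξ => (hNξ q y ξ).sub ((S.V_ξ q y ξ).const_mul (1 / 2))) (by fun_prop) (by fun_prop)
    (by fun_prop) ut'
  obtain ⟨uxC, -, uxx⟩ := E.isC1_of_eq_eul S (H := fun p => N p + 1 / 2 * V p)
    (Hy := fun p => Ny p + 1 / 2 * -G p)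
    (Hξ := fun p => (-(1 / 2 * (V p * P p)) - 1 / 2 * (G p * J p)) + 1 / 2 * P p)
    (w := dx1 (eul Z h h₁ U)) (fun q y ξ => (hNy q y ξ).add ((S.V_y q y ξ).const_mul (1 / 2)))
    (fun q y ξ => (hNξ q y ξ).add ((S.V_ξ q y ξ).const_mul (1 / 2))) (by fun_prop) (by fun_prop)
    (by fun_prop) ux'
  have hDu : ∀ t ∈ Ico 0 T, ∀ x, opD (eul Z h h₁ U) t x = eul Z h h₁ V t x := by
    intro t ht x
    rw [opD, ut' t ht x, ux' t ht x]
    simp only [eul]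
    ring
  obtain ⟨-, vt, vx⟩ := E.isC1_of_eq_eul S (H := V) (Hy := fun p => -G p) (Hξ := P)
    (w := opD (eul Z h h₁ U)) S.V_y S.V_ξ hV (by fun_prop) hP hDu
  have h0T : (0 : ℝ) ∈ Ico 0 T := ⟨le_rfl, E.T_pos⟩
  have hlab0 : ∀ x : Plane, label Z h h₁ (x 1, x 0 + 0, 0) = x 0 := by
    intro x
    rw [add_zero]
    refine E.label_eq S (ht0 0 h0T) E.T_pos ?_ ?_ ?_
    · rw [sub_self]; exact E.h_pos.le
    · rw [sub_self]; linarith [E.h₁_pos]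
    · rw [S.Z_diag, sub_self, zero_div]
  refine ⟨⟨uC, utC, uxC, ?_, ?_, ?_, ?_⟩, ux'⟩
  · intro t ht x
    rw [hDu t ht x]
    obtain ⟨b1, b2, b3⟩ := E.label_spec S (x 1) (x 0 + t) (ht0 t ht) ht.2
    have h1 := E.V_le (x 1, x 0 + t, label Z h h₁ (x 1, x 0 + t, t)) b2.le b1.le
    have h2 := E.c_pos
    have h3 : eul Z h h₁ V t x ≤ 1 - 2 * c := h1
    exact ne_of_lt (by linarith)
  · intro t ht x
    have hD2 : opD (opD (eul Z h h₁ U)) t x =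
        dx1 (opD (eul Z h h₁ U)) t x - dt (opD (eul Z h h₁ U)) t x := rfl
    -- The second derivatives do carry 1/J: here D²u = 2P/J. In □u the terms N_y cancel and the
    -- source contributes 2G.
    rw [box, hD2, utt t ht x, uxx t ht x, vt t ht x, vx t ht x, hDu t ht x]
    have hGf : 2 * eul Z h h₁ G t x = f (t, x, eul Z h h₁ U t x, eul Z h h₁ V t x) := by
      obtain ⟨b1, b2, b3⟩ := E.label_spec S (x 1) (x 0 + t) (ht0 t ht) ht.2
      simp only [eul, hG, charSource]
      rw [b3]
      have h5 : (x 0 + t + Z (x 1, x 0 + t, label Z h h₁ (x 1, x 0 + t, t))) / 2 = x 0 := by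
        linarith
      rw [h5, planeMk_coord]
      ring
    rw [← hGf]
    have := hJ0 t ht x
    simp only [eul]
    field_simp
    ring
  · intro x
    rw [ha]
    simp only [eul]
    rw [hlab0, add_zero, S.U_eq]
    simp
  · intro x
    rw [ut' 0 h0T, hb]
    simp only [eul]
    rw [hlab0, add_zero, hN, LagrangeSol.lagN]
    simp only [S.V_diag, intervalIntegral.integral_same]
    ring

end EulerDomain

/-! ### Uniqueness of classical solutions -/

/-- The restriction of `g` to the line through `x` in direction `e₁`. -/
noncomputable def slice (g : ℝ → Plane → ℝ) (x : Plane) (p : ℝ × ℝ) : ℝ := g p.1 (x + p.2 • e₁)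

/-- The linear form `(a, b) ↦ α a + β b`. -/
noncomputable def linForm (α β : ℝ) : ℝ × ℝ →L[ℝ] ℝ :=
  (ContinuousLinearMap.toSpanSingleton ℝ α).coprod (ContinuousLinearMap.toSpanSingleton ℝ β)

theorem linForm_apply (α β : ℝ) (p : ℝ × ℝ) : linForm α β p = α * p.1 + β * p.2 := by
  simp [linForm, mul_comm]

theorem continuousOn_slice {g : ℝ → Plane → ℝ} {T : ℝ}
    (hg : ContinuousOn (Function.uncurry g) (Ico 0 T ×ˢ univ)) (x : Plane) :
    ContinuousOn (slice g x) (Ico 0 T ×ˢ univ) :=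
  hg.comp (f := fun p : ℝ × ℝ => (p.1, x + p.2 • e₁)) (by fun_prop) fun p hp => ⟨hp.1, mem_univ _⟩

theorem continuousAt_slice {g : ℝ → Plane → ℝ} {T : ℝ}
    (hg : ContinuousOn (Function.uncurry g) (Ico 0 T ×ˢ univ)) (x : Plane) {p : ℝ × ℝ}
    (hp : p.1 ∈ Ioo 0 T) : ContinuousAt (slice g x) p := by
  refine (continuousOn_slice hg x).continuousAt (prod_mem_nhds ?_ univ_mem)
  exact mem_of_superset (Ioo_mem_nhds hp.1 hp.2) Ioo_subset_Ico_self

theorem IsC1.hasFDerivAt_slice {g : ℝ → Plane → ℝ} {T : ℝ} (hg : IsC1 T g) (x : Plane) {p : ℝ × ℝ}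
    (hp : p.1 ∈ Ioo 0 T) :
    HasFDerivAt (slice g x) (linForm (slice (dt g) x p) (slice (dx1 g) x p)) p := by
  have hnear : ∀ᶠ v : ℝ × ℝ in 𝓝 p, v.1 ∈ Ioo 0 T :=
    continuousAt_fst.eventually (Ioo_mem_nhds hp.1 hp.2)
  have h1 := hasStrictFDerivAt_uncurry_coprod (𝕜 := ℝ) (u := p)
    (f := fun a b => slice g x (a, b))
    (f₁ := fun a b => ContinuousLinearMap.toSpanSingleton ℝ (slice (dt g) x (a, b)))
    (f₂ := fun a b => ContinuousLinearMap.toSpanSingleton ℝ (slice (dx1 g) x (a, b)))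
    (hnear.mono fun v hv => ?_) (hnear.mono fun v hv => ?_)
    ((ContinuousLinearMap.toSpanSingletonCLE (𝕜 := ℝ) (E := ℝ)).continuous.continuousAt.comp
      (continuousAt_slice hg.cont_t x hp))
    ((ContinuousLinearMap.toSpanSingletonCLE (𝕜 := ℝ) (E := ℝ)).continuous.continuousAt.comp
      (continuousAt_slice hg.cont_x x hp))
  · exact h1.hasFDerivAt
  · have h2 := (hg.diff_t v.1 ⟨hv.1.le, hv.2⟩ (x + v.2 • e₁)).hasDerivWithinAt.hasDerivAt
      (Ici_mem_nhds hv.1)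
    exact h2.hasFDerivAt
  · have h2 : HasDerivAt (fun r : ℝ => g v.1 ((x + v.2 • e₁) + r • e₁)) (dx1 g v.1 (x + v.2 • e₁))
      (v.2 - v.2) := by
      rw [sub_self]
      exact (hg.diff_x v.1 ⟨hv.1.le, hv.2⟩ (x + v.2 • e₁)).hasLineDerivAt
    have h3 := HasDerivAt.comp (h₂ := fun r => g v.1 ((x + v.2 • e₁) + r • e₁))
      (h := fun r => r - v.2) v.2 h2 ((hasDerivAt_id v.2).sub_const v.2)
    rw [mul_one] at h3
    refine HasDerivAt.hasFDerivAt (h3.congr_of_eventuallyEq (Eventually.of_forall fun r => ?_))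
    simp only [Function.comp, slice, add_assoc, ← add_smul]
    congr 3
    ring

/-- Together with `slice_dx1_eq`, this identifies the partial derivatives of functions such as `opD
u`, for which only a derivative of the slice is at hand. -/
theorem slice_dt_eq {g : ℝ → Plane → ℝ} {x : Plane} {p : ℝ × ℝ} (hp : 0 < p.1) {α β : ℝ}
    (h : HasFDerivAt (slice g x) (linForm α β) p) : slice (dt g) x p = α := by
  have h1 : HasDerivAt (fun s => (s, p.2)) ((1 : ℝ), (0 : ℝ)) p.1 :=
    (hasDerivAt_id p.1).prodMk (hasDerivAt_const p.1 p.2)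
  have h2 : HasDerivAt (fun s => g s (x + p.2 • e₁)) _ p.1 :=
    HasFDerivAt.comp_hasDerivAt (f := fun s => (s, p.2)) p.1 h h1
  rw [linForm_apply] at h2
  have h3 := (h2.hasDerivWithinAt (s := Ici 0)).derivWithin (uniqueDiffOn_Ici 0 p.1 hp.le)
  simpa [slice, dt] using h3

theorem slice_dx1_eq {g : ℝ → Plane → ℝ} {x : Plane} {p : ℝ × ℝ} {α β : ℝ}
    (h : HasFDerivAt (slice g x) (linForm α β) p) : slice (dx1 g) x p = β := by
  have h1 : HasDerivAt (fun r : ℝ => (p.1, p.2 + r)) ((0 : ℝ), (1 : ℝ)) 0 :=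
    (hasDerivAt_const 0 p.1).prodMk ((hasDerivAt_id (0 : ℝ)).const_add p.2)
  have h0 : HasFDerivAt (slice g x) (linForm α β) ((fun r : ℝ => (p.1, p.2 + r)) 0) := by
    simpa using h
  have h2 : HasDerivAt (fun r : ℝ => slice g x (p.1, p.2 + r)) _ 0 :=
    h0.comp_hasDerivAt (f := fun r : ℝ => (p.1, p.2 + r)) (0 : ℝ) h1
  rw [linForm_apply] at h2
  have h3 : HasLineDerivAt ℝ (g p.1) β (x + p.2 • e₁) e₁ := by
    unfold HasLineDerivAt
    refine (h2.congr_of_eventuallyEq (Eventually.of_forall fun r => ?_)).congr_deriv (by simp)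
    simp only [slice, add_smul, add_assoc]
  exact h3.lineDeriv

theorem HasDerivAt.nonpos_of_left_min {g : ℝ → ℝ} {g' : ℝ} (hg : HasDerivAt g g' 0)
    (h : ∀ᶠ σ in 𝓝[<] (0 : ℝ), g 0 ≤ g σ) : g' ≤ 0 := by
  by_contra hcon
  push Not at hcon
  have h1 : HasDerivAt (fun σ => g (-σ)) (-g') 0 := by
    have := HasDerivAt.comp (0 : ℝ) (h₂ := g) (h := fun σ : ℝ => -σ) (by simpa using hg)
      (hasDerivAt_neg (0 : ℝ))
    simpa [Function.comp_def] using this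
  have h2 := h1.eventually_lt_right (by linarith)
  have h3 : Tendsto (fun σ : ℝ => -σ) (𝓝[>] 0) (𝓝[<] 0) := by
    have := tendsto_neg_nhdsGT (a := (0 : ℝ))
    simpa using this
  obtain ⟨σ, hσ1, hσ2⟩ := (h2.and (h3.eventually h)).exists
  simp only [neg_zero] at hσ1
  linarith

theorem HasDerivAt.nonneg_of_left_max {g : ℝ → ℝ} {g' : ℝ} (hg : HasDerivAt g g' 0)
    (h : ∀ᶠ σ in 𝓝[<] (0 : ℝ), g σ ≤ g 0) : 0 ≤ g' := by
  have := HasDerivAt.nonpos_of_left_min hg.neg (h.mono fun σ hσ => by simpa using hσ)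
  linarith

/-- A backward domain of determinacy for speeds between `-1` and `m`. -/
def trapezoid (A B m τ : ℝ) : Set (ℝ × ℝ) :=
  {p | 0 ≤ p.1 ∧ p.1 ≤ τ ∧ A + m * p.1 ≤ p.2 ∧ p.2 ≤ B - p.1}

theorem isCompact_trapezoid (A B m τ : ℝ) : IsCompact (trapezoid A B m τ) := by
  have hcl : IsClosed (trapezoid A B m τ) := by
    have h1 : Continuous fun p : ℝ × ℝ => A + m * p.1 := by fun_prop
    have h2 : Continuous fun p : ℝ × ℝ => B - p.1 := by fun_prop
    exact (isClosed_le continuous_const continuous_fst).inter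
      ((isClosed_le continuous_fst continuous_const).inter
        ((isClosed_le h1 continuous_snd).inter (isClosed_le continuous_snd h2)))
  refine ((isCompact_Icc (a := (0 : ℝ)) (b := τ)).prod
    (isCompact_Icc (a := A - |m| * |τ|) (b := B))).of_isClosed_subset hcl ?_
  rintro ⟨t, s⟩ ⟨h1, h2, h3, h4⟩
  simp only at h1 h2 h3 h4
  have e1 : -(|m| * |τ|) ≤ m * t := by
    have : |m * t| ≤ |m| * |τ| := by
      rw [abs_mul]
      gcongr
    linarith [neg_abs_le (m * t)]
  exact ⟨⟨h1, h2⟩, by linarith, by linarith⟩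

/-- The lateral sides move with speeds m and −1, so following a speed between these backwards in
time does not leave the trapezoid. -/
theorem trapezoid_back {A B m τ c : ℝ} {p : ℝ × ℝ} (hp : p ∈ trapezoid A B m τ) (hp0 : 0 < p.1)
    (hc1 : -1 ≤ c) (hc2 : c ≤ m) :
    ∀ᶠ σ in 𝓝[<] (0 : ℝ), (p.1 + σ, p.2 + c * σ) ∈ trapezoid A B m τ := by
  filter_upwards [Ioo_mem_nhdsLT (show -p.1 < 0 by linarith)] with σ hσ
  obtain ⟨h1, h2, h3, h4⟩ := hp
  refine ⟨by simp only; linarith [hσ.1], by simp only; linarith [hσ.2], ?_, ?_⟩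
  · simp only; nlinarith [hσ.2]
  · simp only; nlinarith [hσ.2]

theorem hasDerivAt_along {k : ℝ × ℝ → ℝ} {α β c : ℝ} {p : ℝ × ℝ}
    (hk : HasFDerivAt k (linForm α β) p) :
    HasDerivAt (fun σ : ℝ => k (p.1 + σ, p.2 + c * σ)) (α + c * β) 0 := by
  have h1 : HasDerivAt (fun σ : ℝ => (p.1 + σ, p.2 + c * σ)) ((1 : ℝ), c * 1) 0 :=
    ((hasDerivAt_id (0 : ℝ)).const_add p.1).prodMk
      (((hasDerivAt_id (0 : ℝ)).const_mul c).const_add p.2)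
  have h2 := HasFDerivAt.comp_hasDerivAt (f := fun σ : ℝ => (p.1 + σ, p.2 + c * σ)) (0 : ℝ)
    (by simpa using hk) h1
  refine HasDerivAt.congr_deriv h2 ?_
  rw [linForm_apply]
  ring

/-! ### The transport equation and the maximum principle -/

namespace IsClassicalSolution

variable {f : ℝ × Plane × ℝ × ℝ → ℝ} {a b : Plane → ℝ} {T : ℝ} {u w : ℝ → Plane → ℝ}

/-- The derivatives of `v = Du` and the transport equation that it satisfies. -/
theorem transport (hu : IsClassicalSolution f a b T u) (x : Plane) {p : ℝ × ℝ}
    (hp : p.1 ∈ Ioo 0 T) :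
    ∃ α β, HasFDerivAt (slice (opD u) x) (linForm α β) p ∧
      (1 - slice (opD u) x p) * α + (1 + slice (opD u) x p) * β =
        -f (p.1, x + p.2 • e₁, slice u x p, slice (opD u) x p) := by
  have hnear : ∀ᶠ v : ℝ × ℝ in 𝓝 p, v.1 ∈ Ioo 0 T :=
    continuousAt_fst.eventually (Ioo_mem_nhds hp.1 hp.2)
  have h1 := hu.c1_t.hasFDerivAt_slice x hp
  have h2 := hu.c1_x.hasFDerivAt_slice x hp
  -- The factorization □ = −(∂_t + ∂_{x₁})D needs the mixed derivatives to commute, which holds at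
  -- positive times by the C² regularity of the slice.
  have hsym : slice (dx1 (dt u)) x p = slice (dt (dx1 u)) x p := by
    have h3 : HasFDerivAt (fun v : ℝ × ℝ => linForm (slice (dt u) x v) (slice (dx1 u) x v)) _ p :=
      (h1.smul_const (ContinuousLinearMap.fst ℝ ℝ ℝ)).add
        (h2.smul_const (ContinuousLinearMap.snd ℝ ℝ ℝ)) |>.congr_of_eventuallyEq
          (Eventually.of_forall fun v => by
            ext <;> simp [linForm])
    have h4 := second_derivative_symmetric_of_eventually
      (hnear.mono fun v hv => hu.c1.hasFDerivAt_slice x hv) h3 (1, 0) (0, 1)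
    simpa [linForm_apply] using h4.symm
  have h5 : HasFDerivAt (slice (opD u) x) (linForm (slice (dt (dx1 u)) x p - slice (dt (dt u)) x p)
      (slice (dx1 (dx1 u)) x p - slice (dx1 (dt u)) x p)) p := by
    refine (h2.sub h1).congr_fderiv ?_
    ext <;> simp [linForm]
  refine ⟨_, _, h5, ?_⟩
  have e1 := slice_dt_eq hp.1 h5
  have e2 := slice_dx1_eq h5
  have h6 := hu.eqn p.1 ⟨hp.1.le, hp.2⟩ (x + p.2 • e₁)
  have h7 : opD (opD u) p.1 (x + p.2 • e₁) = slice (dx1 (opD u)) x p - slice (dt (opD u)) x p := rfl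
  have h8 : box u p.1 (x + p.2 • e₁) = slice (dt (dt u)) x p - slice (dx1 (dx1 u)) x p := rfl
  have h9 : opD u p.1 (x + p.2 • e₁) = slice (opD u) x p := rfl
  have h10 : u p.1 (x + p.2 • e₁) = slice u x p := rfl
  rw [h7, h8, e1, e2, h9, h10, hsym] at h6
  rw [hsym]
  linarith

theorem continuousOn_opD (hu : IsClassicalSolution f a b T u) :
    ContinuousOn (Function.uncurry (opD u)) (Ico 0 T ×ˢ univ) :=
  hu.c1.cont_x.sub hu.c1.cont_t

theorem opD_zero (hu : IsClassicalSolution f a b T u) (x : Plane) :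
    opD u 0 x = lineDeriv ℝ a x (EuclideanSpace.single 0 1) - b x := by
  have h1 : u 0 = a := funext hu.init
  rw [opD, dx1, h1, hu.init_t]

/-- At fixed x the function Du starts at or below κ < 1, is continuous in time and never equals 1,
so it cannot pass 1. -/
theorem opD_lt_one (hu : IsClassicalSolution f a b T u) {κ : ℝ} (hκ : κ < 1)
    (h0 : ∀ x, lineDeriv ℝ a x (EuclideanSpace.single 0 1) - b x ≤ κ) {t : ℝ} (ht : t ∈ Ico 0 T)
    (x : Plane) : opD u t x < 1 := by
  by_contra hcon
  push Not at hcon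
  have hc : ContinuousOn (fun s => opD u s x) (Icc 0 t) :=
    hu.continuousOn_opD.comp (f := fun s : ℝ => (s, x)) (by fun_prop)
      fun s hs => ⟨⟨hs.1, hs.2.trans_lt ht.2⟩, mem_univ _⟩
  obtain ⟨s, hs, hs1⟩ := intermediate_value_Icc ht.1 hc
    (⟨by rw [hu.opD_zero]; linarith [h0 x], hcon⟩ : (1 : ℝ) ∈ Icc (opD u 0 x) (opD u t x))
  exact hu.ne_one s ⟨hs.1, hs.2.trans_lt ht.2⟩ x hs1

/-- `1 - Du` stays away from zero on domains of determinacy. -/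
theorem le_one_sub_opD (hu : IsClassicalSolution f a b T u) {κ C : ℝ} (hκ : κ < 1)
    (h0 : ∀ x, lineDeriv ℝ a x (EuclideanSpace.single 0 1) - b x ≤ κ) (hf : ∀ p, |f p| ≤ C)
    (hT : 2 * (C + 1) * T ≤ 3 / 4 * (1 - κ) ^ 2) (x : Plane) {A B τ : ℝ} (hτ : τ < T)
    {p : ℝ × ℝ} (hp : p ∈ trapezoid A B (4 / (1 - κ)) τ) :
    (1 - κ) / 2 ≤ 1 - slice (opD u) x p := by
  have hC : 0 ≤ C := (abs_nonneg _).trans (hf (0, 0, 0, 0))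
  have hκ' : 0 < 1 - κ := by linarith
  set K := trapezoid A B (4 / (1 - κ)) τ with hK
  have hKT : K ⊆ Ico 0 T ×ˢ univ := fun p hp => ⟨⟨hp.1, hp.2.1.trans_lt hτ⟩, mem_univ _⟩
  have hvc : ContinuousOn (slice (opD u) x) K :=
    (continuousOn_slice hu.continuousOn_opD x).mono hKT
  have hv1 : ∀ p ∈ K, slice (opD u) x p < 1 := fun p hp => hu.opD_lt_one hκ h0 (hKT hp).1 _
  by_contra hcon
  push Not at hcon
  have hKc : IsCompact K := isCompact_trapezoid _ _ _ _
  -- A bad point p₁ of least time will be taken: at every earlier time the bound holds throughout K.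
  have hbad : IsCompact (K ∩ {p | 1 - slice (opD u) x p ≤ (1 - κ) / 2}) := by
    have h1 : ContinuousOn (fun p => 1 - slice (opD u) x p) K := continuousOn_const.sub hvc
    exact hKc.of_isClosed_subset (h1.preimage_isClosed_of_isClosed hKc.isClosed isClosed_Iic)
      inter_subset_left
  obtain ⟨p₁, ⟨hp₁K, hp₁⟩, hmin₁⟩ := hbad.exists_isMinOn ⟨p, hp, hcon.le⟩
    (continuous_fst.continuousOn)
  simp only [mem_ofPred_eq] at hp₁
  -- Along a characteristic ((1 − v)²)' = 2f ≥ −2C, so φ increases there at rate at least 2. Its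
  -- minimum over times up to that of p₁ can therefore only be at t = 0, where φ ≥ (1 − κ)²; but p₁
  -- itself gives a smaller value.
  set φ : ℝ × ℝ → ℝ := fun p => (1 - slice (opD u) x p) ^ 2 + 2 * (C + 1) * p.1 with hφ
  have hK₁ : IsCompact (K ∩ {p | p.1 ≤ p₁.1}) :=
    hKc.inter_right (isClosed_le continuous_fst continuous_const)
  obtain ⟨p₂, ⟨hp₂K, hp₂⟩, hmin₂⟩ := hK₁.exists_isMinOn (f := φ) ⟨p₁, hp₁K, le_refl p₁.1⟩
    ((((continuousOn_const.sub hvc).pow 2).add (by fun_prop)).mono inter_subset_left)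
  simp only [mem_ofPred_eq] at hp₂
  -- The bad point contributes at most (1 − κ)²/4, and the smallness of T keeps the remaining term
  -- below ¾(1 − κ)².
  have hlt : φ p₂ < (1 - κ) ^ 2 := by
    have h1 : φ p₂ ≤ φ p₁ := hmin₂ ⟨hp₁K, le_refl p₁.1⟩
    have h2 : (1 - slice (opD u) x p₁) ^ 2 ≤ ((1 - κ) / 2) ^ 2 := by
      have := hv1 p₁ hp₁K
      exact pow_le_pow_left₀ (by linarith) hp₁ 2
    have h3 : 2 * (C + 1) * p₁.1 < 2 * (C + 1) * T := by
      have := (hKT hp₁K).1.2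
      gcongr
    have h4 : φ p₁ = (1 - slice (opD u) x p₁) ^ 2 + 2 * (C + 1) * p₁.1 := rfl
    nlinarith
  have hpos : 0 < p₂.1 := by
    rcases hp₂K.1.lt_or_eq with h | h
    · exact h
    · exfalso
      have h1 : slice (opD u) x p₂ ≤ κ := by
        have : slice (opD u) x p₂ = opD u 0 (x + p₂.2 • e₁) := by rw [slice, ← h]
        rw [this, hu.opD_zero]
        exact h0 _
      have h2 : φ p₂ = (1 - slice (opD u) x p₂) ^ 2 + 2 * (C + 1) * p₂.1 := rfl
      have h3 : (1 - κ) ^ 2 ≤ (1 - slice (opD u) x p₂) ^ 2 :=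
        pow_le_pow_left₀ hκ'.le (by linarith) 2
      rw [← h, mul_zero, add_zero] at h2
      linarith
  -- At p₂ the bound is a limit from earlier times along a line of fixed x₁. It makes the
  -- characteristic speed (1 + v)/(1 − v) at most 4/(1 − κ), so that the backward characteristic
  -- stays in K.
  have hr : (1 - κ) / 2 ≤ 1 - slice (opD u) x p₂ := by
    have h1 : ∀ᶠ σ in 𝓝[<] (0 : ℝ), (1 - κ) / 2 ≤ 1 - slice (opD u) x (p₂.1 + σ, p₂.2 + 0 * σ) := by
      filter_upwards [trapezoid_back hp₂K hpos (c := 0) (by norm_num) (by positivity),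
        self_mem_nhdsWithin] with σ hσ hσ0
      by_contra hc
      push Not at hc
      have h2 : p₁.1 ≤ p₂.1 + σ := hmin₁ ⟨hσ, hc.le⟩
      have : σ < 0 := hσ0
      linarith
    have h2 : ContinuousAt (fun σ : ℝ => 1 - slice (opD u) x (p₂.1 + σ, p₂.2 + 0 * σ)) 0 := by
      refine continuousAt_const.sub (ContinuousAt.comp (x := (0 : ℝ)) (g := slice (opD u) x)
        (f := fun σ : ℝ => (p₂.1 + σ, p₂.2 + 0 * σ)) ?_ (by fun_prop))
      simp only [add_zero, mul_zero]
      exact continuousAt_slice hu.continuousOn_opD x ⟨hpos, (hKT hp₂K).1.2⟩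
    have h3 := ge_of_tendsto (h2.tendsto.mono_left nhdsWithin_le_nhds) h1
    simpa using h3
  obtain ⟨α, β, hd, heq⟩ := hu.transport x (p := p₂) ⟨hpos, (hKT hp₂K).1.2⟩
  set v := slice (opD u) x p₂ with hv
  have hv1' : 0 < 1 - v := by linarith
  have hc1 : -1 ≤ (1 + v) / (1 - v) := by
    rw [le_div_iff₀ hv1']
    linarith
  have hc2 : (1 + v) / (1 - v) ≤ 4 / (1 - κ) := by
    rw [div_le_div_iff₀ hv1' hκ']
    nlinarith
  have h1 := hasDerivAt_along (c := (1 + v) / (1 - v)) hd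
  have h2 := (((h1.const_sub 1).pow 2).add
    (((hasDerivAt_id (0 : ℝ)).const_add p₂.1).const_mul (2 * (C + 1))))
  have h3 := HasDerivAt.nonpos_of_left_min h2 (by
    filter_upwards [trapezoid_back hp₂K hpos hc1 hc2, self_mem_nhdsWithin] with σ hσ hσ0
    have hσ0' : σ < 0 := hσ0
    have := hmin₂ (⟨hσ, by simp only [mem_ofPred_eq]; linarith⟩ :
      (p₂.1 + σ, p₂.2 + (1 + v) / (1 - v) * σ) ∈ K ∩ {p | p.1 ≤ p₁.1})
    simpa [hφ] using this)
  have h4 : (1 - v) * (α + (1 + v) / (1 - v) * β) = -f (p₂.1, x + p₂.2 • e₁, slice u x p₂, v) := by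
    rw [← heq]
    field_simp
  have h5 := hf (p₂.1, x + p₂.2 • e₁, slice u x p₂, v)
  rw [abs_le] at h5
  simp only [add_zero, mul_zero] at h3
  rw [← hv] at h3
  norm_num at h3
  nlinarith

/-- Uniqueness of classical solutions. -/
theorem unique (hu : IsClassicalSolution f a b T u) (hw : IsClassicalSolution f a b T w)
    {κ C : ℝ} (hκ : κ < 1) (h0 : ∀ x, lineDeriv ℝ a x (EuclideanSpace.single 0 1) - b x ≤ κ)
    (hf : ∀ p, |f p| ≤ C)
    (hfl : ∀ t x r s r' s', |f (t, x, r, s) - f (t, x, r', s')| ≤ C * max |r - r'| |s - s'|)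
    (hT : 2 * (C + 1) * T ≤ 3 / 4 * (1 - κ) ^ 2) {t : ℝ} (ht : t ∈ Ico 0 T) : w t = u t := by
  ext x
  have hC : 0 ≤ C := (abs_nonneg _).trans (hf (0, 0, 0, 0))
  have hκ' : 0 < 1 - κ := by linarith
  set m := 4 / (1 - κ) with hm
  have hm0 : 0 < m := by positivity
  -- The two sides meet at (t, 0), so the trapezoid is a triangle with its apex at the point of
  -- comparison.
  set K := trapezoid (-(m * t)) t m t with hK
  have hKT : K ⊆ Ico 0 T ×ˢ univ := fun p hp => ⟨⟨hp.1, hp.2.1.trans_lt ht.2⟩, mem_univ _⟩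
  have hKc : IsCompact K := isCompact_trapezoid _ _ _ _
  have htK : ((t, 0) : ℝ × ℝ) ∈ K := ⟨ht.1, le_rfl, by simp, by simp⟩
  set d : ℝ × ℝ → ℝ := fun p => slice (opD w) x p - slice (opD u) x p with hd
  set e : ℝ × ℝ → ℝ := fun p => slice w x p - slice u x p with he
  have hdc : ContinuousOn d K := ((continuousOn_slice hw.continuousOn_opD x).sub
    (continuousOn_slice hu.continuousOn_opD x)).mono hKT
  have hec : ContinuousOn e K := ((continuousOn_slice hw.c1.cont x).sub
    (continuousOn_slice hu.c1.cont x)).mono hKT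
  have hru := fun p hp => hu.le_one_sub_opD hκ h0 hf hT x ht.2 (A := -(m * t)) (B := t) (p := p) hp
  have hrw := fun p hp => hw.le_one_sub_opD hκ h0 hf hT x ht.2 (A := -(m * t)) (B := t) (p := p) hp
  -- A bound on ∂_{x₁}Du is needed for one of the solutions only: in the difference of the transport
  -- equations it multiplies the difference of the speeds.
  obtain ⟨Q, hQ⟩ : ∃ Q, ∀ p ∈ K, |slice (dx1 (dx1 u)) x p - slice (dx1 (dt u)) x p| ≤ Q :=
    hKc.exists_bound_of_continuousOn (((continuousOn_slice hu.c1_x.cont_x x).sub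
      (continuousOn_slice hu.c1_t.cont_x x)).mono hKT)
  have hQ0 : 0 ≤ Q := (abs_nonneg _).trans (hQ _ htK)
  set ρ := (1 - κ) / 2 with hρ
  have hρ0 : 0 < ρ := by positivity
  -- The first three terms bound the coefficients in the equation for d. The constant 2 leaves room
  -- for the equation e_t − e_{x₁} = −d and for strictness in `key`.
  set Λ := C / ρ ^ 2 + C / ρ + 2 * Q / ρ ^ 2 + 2 with hΛ
  have hΛ2 : 2 ≤ Λ := by
    have : 0 ≤ C / ρ ^ 2 + C / ρ + 2 * Q / ρ ^ 2 := by positivity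
    linarith
  set g : ℝ × ℝ → ℝ := fun p => max |d p| |e p| * Real.exp (-Λ * p.1) with hg
  have hgc : ContinuousOn g K := ((hdc.abs).sup hec.abs).mul (by fun_prop)
  obtain ⟨p, hpK, hmax⟩ := hKc.exists_isMaxOn ⟨_, htK⟩ hgc
  set μ := max |d p| |e p| with hμ
  have hfinal : μ ≤ 0 := by
    by_contra hcon
    push Not at hcon
    have hp0 : 0 < p.1 := by
      rcases hpK.1.lt_or_eq with h | h
      · exact h
      · exfalso
        have h1 : d p = 0 := by
          simp only [hd, slice, ← h, hw.opD_zero, hu.opD_zero, sub_self]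
        have h2 : e p = 0 := by
          simp only [he, slice, ← h, hw.init, hu.init, sub_self]
        rw [hμ, h1, h2] at hcon
        simp at hcon
    have hpT : p.1 ∈ Ioo 0 T := ⟨hp0, (hKT hpK).1.2⟩
    -- At a positive maximum of k e^{−Λt} the derivative along an admissible speed, taken from the
    -- past, is nonnegative, so k grows at rate at least Λμ; a rate of at most (Λ − 1)μ is a
    -- contradiction. It is applied with k = ±d along characteristics of w and k = ±e along speed
    -- −1.
    have key : ∀ (k : ℝ × ℝ → ℝ) (α β c : ℝ), HasFDerivAt k (linForm α β) p → -1 ≤ c → c ≤ m →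
        (∀ q, k q ≤ max |d q| |e q|) → k p = μ → α + c * β ≤ (Λ - 1) * μ → False := by
      intro k α β c hk hc1 hc2 hkle hkp hαβ
      have h1 := (hasDerivAt_along (c := c) hk).mul
        ((((hasDerivAt_id (0 : ℝ)).const_add p.1).const_mul (-Λ)).exp)
      have h2 := HasDerivAt.nonneg_of_left_max h1 (by
        filter_upwards [trapezoid_back hpK hp0 hc1 hc2] with σ hσ
        have h3 : g (p.1 + σ, p.2 + c * σ) ≤ g p := hmax hσ
        have h4 : k (p.1 + σ, p.2 + c * σ) * Real.exp (-Λ * (p.1 + σ)) ≤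
            g (p.1 + σ, p.2 + c * σ) := by
          simp only [hg]
          gcongr
          exact hkle _
        have h5 : g p = k p * Real.exp (-Λ * p.1) := by rw [hkp]
        simp only [add_zero, mul_zero, Pi.mul_apply, id]
        exact h4.trans (h3.trans h5.le))
      simp only [add_zero, mul_zero, id, mul_one, hkp] at h2
      have hE := Real.exp_pos (-Λ * p.1)
      have h6 : (α + c * β) * Real.exp (-Λ * p.1) + μ * (Real.exp (-Λ * p.1) * -Λ) =
          (α + c * β - Λ * μ) * Real.exp (-Λ * p.1) := by ring
      rw [h6] at h2
      have h7 : 0 ≤ α + c * β - Λ * μ := nonneg_of_mul_nonneg_left h2 hE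
      linarith
    have hdμ : |d p| ≤ μ := le_max_left _ _
    have heμ : |e p| ≤ μ := le_max_right _ _
    have hneg : ∀ {k : ℝ × ℝ → ℝ} {α β : ℝ}, HasFDerivAt k (linForm α β) p →
        HasFDerivAt (fun q => -k q) (linForm (-α) (-β)) p := by
      intro k α β hk
      refine hk.neg.congr_fderiv ?_
      ext <;> simp [linForm]
    rcases le_total |e p| |d p| with hcase | hcase
    · have hdμ' : |d p| = μ := (max_eq_left hcase).symm
      obtain ⟨αw, βw, hdw, heqw⟩ := hw.transport x hpT
      obtain ⟨αu, βu, hdu, hequ⟩ := hu.transport x hpT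
      have hdd : HasFDerivAt d (linForm (αw - αu) (βw - βu)) p := by
        refine (hdw.sub hdu).congr_fderiv ?_
        ext <;> simp [linForm]
      have hβu : |βu| ≤ Q := by
        have h1 := slice_dx1_eq hdu
        have h2 : HasFDerivAt (slice (opD u) x) (linForm (slice (dt (dx1 u)) x p -
            slice (dt (dt u)) x p) (slice (dx1 (dx1 u)) x p - slice (dx1 (dt u)) x p)) p := by
          refine ((hu.c1_x.hasFDerivAt_slice x hpT).sub
            (hu.c1_t.hasFDerivAt_slice x hpT)).congr_fderiv ?_
          ext <;> simp [linForm]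
        rw [← h1, slice_dx1_eq h2]
        exact hQ p hpK
      have hrw' := hrw p hpK
      have hru' := hru p hpK
      have hddef : slice (opD w) x p = slice (opD u) x p + d p := by simp [hd]
      set vw := slice (opD w) x p with hvw
      set vu := slice (opD u) x p with hvu
      set fw := f (p.1, x + p.2 • e₁, slice w x p, vw)
      set fu := f (p.1, x + p.2 • e₁, slice u x p, vu)
      have hrw0 : 0 < 1 - vw := by linarith
      have hru0 : 0 < 1 - vu := by linarith
      have hc1 : -1 ≤ (1 + vw) / (1 - vw) := by
        rw [le_div_iff₀ hrw0]
        linarith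
      have hc2 : (1 + vw) / (1 - vw) ≤ m := by
        rw [hm, div_le_div_iff₀ hrw0 hκ']
        nlinarith
      -- Difference of the two transport equations along the characteristic of w: the first two
      -- terms come from −f/(1 − v), the last from the change of speed 2d/((1 − v_u)(1 − v_w)) times
      -- ∂_{x₁}Du of u.
      have hexp : (αw - αu) + (1 + vw) / (1 - vw) * (βw - βu) =
          fu * d p / ((1 - vu) * (1 - vw)) * (-1) + (fu - fw) / (1 - vw) -
            2 * d p / ((1 - vu) * (1 - vw)) * βu := by
        have hαw : αw = (-fw - (1 + vw) * βw) / (1 - vw) := by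
          field_simp
          linarith
        have hαu : αu = (-fu - (1 + vu) * βu) / (1 - vu) := by
          field_simp
          linarith
        have hvw' : vw = vu + d p := hddef
        have hd' : d p = vw - vu := by linarith
        rw [hαw, hαu, hd']
        field_simp
        ring
      have hfd : |fu - fw| ≤ C * μ := by
        refine (hfl _ _ _ _ _ _).trans ?_
        gcongr
        refine max_le ?_ ?_
        · rw [abs_sub_comm]; exact heμ
        · rw [abs_sub_comm]; exact hdμ
      have hprod : ρ ^ 2 ≤ (1 - vu) * (1 - vw) := by
        rw [sq]
        gcongr
      have hbound : |(αw - αu) + (1 + vw) / (1 - vw) * (βw - βu)| ≤ (Λ - 1) * μ := by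
        rw [hexp]
        have b1 : |fu * d p / ((1 - vu) * (1 - vw)) * (-1)| ≤ C * μ / ρ ^ 2 := by
          rw [abs_mul, abs_neg, abs_one, mul_one, abs_div, abs_mul,
            abs_of_pos (mul_pos hru0 hrw0)]
          gcongr
          exact hf _
        have b2 : |(fu - fw) / (1 - vw)| ≤ C * μ / ρ := by
          rw [abs_div, abs_of_pos hrw0]
          gcongr
        have b3 : |2 * d p / ((1 - vu) * (1 - vw)) * βu| ≤ 2 * μ / ρ ^ 2 * Q := by
          rw [abs_mul, abs_div, abs_mul, abs_of_pos (mul_pos hru0 hrw0), abs_two]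
          gcongr
        have b4 := (abs_sub (fu * d p / ((1 - vu) * (1 - vw)) * (-1) + (fu - fw) / (1 - vw))
          (2 * d p / ((1 - vu) * (1 - vw)) * βu))
        have b5 := abs_add_le (fu * d p / ((1 - vu) * (1 - vw)) * (-1)) ((fu - fw) / (1 - vw))
        have b6 : C * μ / ρ ^ 2 + C * μ / ρ + 2 * μ / ρ ^ 2 * Q + μ = (Λ - 1) * μ := by
          rw [hΛ]
          ring
        linarith
      rcases abs_choice (d p) with hs | hs
      · exact key d _ _ _ hdd hc1 hc2 (fun q => (le_abs_self _).trans (le_max_left _ _))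
          (by rw [← hs, hdμ']) ((le_abs_self _).trans hbound)
      · refine key (fun q => -d q) _ _ _ (hneg hdd) hc1 hc2
          (fun q => (neg_le_abs _).trans (le_max_left _ _)) (by rw [← hs, hdμ']) ?_
        refine le_trans (le_of_eq ?_) ((neg_le_abs _).trans hbound)
        ring
    · have heμ' : |e p| = μ := (max_eq_right hcase).symm
      have hde : HasFDerivAt e (linForm (slice (dt w) x p - slice (dt u) x p)
          (slice (dx1 w) x p - slice (dx1 u) x p)) p := by
        refine ((hw.c1.hasFDerivAt_slice x hpT).sub (hu.c1.hasFDerivAt_slice x hpT)).congr_fderiv ?_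
        ext <;> simp [linForm]
      have hval : (slice (dt w) x p - slice (dt u) x p) +
          (-1) * (slice (dx1 w) x p - slice (dx1 u) x p) = -d p := by
        simp only [hd, slice, opD]
        ring
      have hΛμ : μ ≤ (Λ - 1) * μ := by nlinarith
      rcases abs_choice (e p) with hs | hs
      · refine key e _ _ (-1) hde le_rfl (by linarith)
          (fun q => (le_abs_self _).trans (le_max_right _ _)) (by rw [← hs, heμ']) ?_
        rw [hval]
        exact (neg_le_abs _).trans (hdμ.trans hΛμ)
      · refine key (fun q => -e q) _ _ (-1) (hneg hde) le_rfl (by linarith)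
          (fun q => (neg_le_abs _).trans (le_max_right _ _)) (by rw [← hs, heμ']) ?_
        have : -(slice (dt w) x p - slice (dt u) x p) +
          (-1) * -(slice (dx1 w) x p - slice (dx1 u) x p) = d p := by linarith
        rw [this]
        exact (le_abs_self _).trans (hdμ.trans hΛμ)
  have h1 : g (t, 0) ≤ g p := hmax htK
  have h2 : g p ≤ 0 := mul_nonpos_of_nonpos_of_nonneg hfinal (Real.exp_pos _).le
  have h3 : |e (t, 0)| * Real.exp (-Λ * t) ≤ g (t, 0) := by
    simp only [hg]
    gcongr
    exact le_max_right _ _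
  have h4 : |e (t, 0)| ≤ 0 := by
    by_contra hc
    push Not at hc
    have := mul_pos hc (Real.exp_pos (-Λ * t))
    linarith
  have h5 : e (t, 0) = 0 := abs_nonpos_iff.1 h4
  simp only [he, slice, zero_smul, add_zero] at h5
  linarith

end IsClassicalSolution

/-! ### Estimates along characteristics -/

namespace LagrangeSol

variable {F : ℝ × ℝ × ℝ × ℝ × ℝ → ℝ} {u₀ v₀ v₀' : ℝ × ℝ → ℝ} {C M : ℝ}
  {Z V J P U : ℝ × ℝ × ℝ → ℝ}

theorem abs_V_sub_le (hF : SourceBound F C) (S : LagrangeSol F u₀ v₀ v₀' Z V J P U) (q y ξ : ℝ) :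
    |V (q, y, ξ) - v₀ (q, ξ)| ≤ C * |y - ξ| := by
  have := convex_univ.norm_image_sub_le_of_norm_hasDerivWithin_le (C := C)
    (f := fun y => V (q, y, ξ)) (fun x _ => (S.V_y q x ξ).hasDerivWithinAt)
    (fun x _ => by rw [norm_neg]; exact hF.bound _) (mem_univ ξ) (mem_univ y)
  simpa [S.V_diag] using this

/-- The pair `(J, P)` along a characteristic. -/
def jacPair (J P : ℝ × ℝ × ℝ → ℝ) (q ξ y : ℝ) : ℝ × ℝ := (J (q, y, ξ), P (q, y, ξ))

/-- The equations for (J, P) are linear and homogeneous along a characteristic, with a rate that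
involves only C and a bound on V, not the possibly huge v₀'. -/
theorem exists_hasDerivAt_jacPair (hF : SourceBound F C)
    (S : LagrangeSol F u₀ v₀ v₀' Z V J P U) {M₁ : ℝ} {q y ξ : ℝ} (hV : |V (q, y, ξ)| ≤ M₁) :
    ∃ D, HasDerivAt (jacPair J P q ξ) D y ∧
      ‖D‖ ≤ (1 + C * (1 + M₁)) * ‖jacPair J P q ξ y‖ := by
  refine ⟨_, (S.J_y q y ξ).prodMk (S.P_y q y ξ), ?_⟩
  have hC := hF.nonneg
  have hM : 0 ≤ M₁ := (abs_nonneg _).trans hV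
  set R := ‖jacPair J P q ξ y‖ with hR
  have hR0 : 0 ≤ R := norm_nonneg _
  have hJ : |J (q, y, ξ)| ≤ R := norm_fst_le (jacPair J P q ξ y)
  have hP : |P (q, y, ξ)| ≤ R := norm_snd_le (jacPair J P q ξ y)
  have hCM : 0 ≤ C * (1 + M₁) * R := by positivity
  have hMR : 0 ≤ M₁ * R := by positivity
  rw [Prod.norm_def, max_le_iff]
  refine ⟨?_, ?_⟩
  · simp only [Real.norm_eq_abs]
    linarith
  · simp only [norm_neg]
    refine ((fderiv ℝ F _).le_of_opNorm_le (hF.fderiv_bound _) _).trans ?_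
    have : ‖((0 : ℝ), (0 : ℝ), J (q, y, ξ), 1 / 2 * (V (q, y, ξ) * J (q, y, ξ)), P (q, y, ξ))‖ ≤
        (1 + M₁) * R := by
      rw [norm5_le_iff]
      have h1 : |V (q, y, ξ)| * |J (q, y, ξ)| ≤ M₁ * R := by gcongr
      refine ⟨by simp; positivity, by simp; positivity, by simp only; linarith, ?_,
        by simp only; linarith⟩
      simp only [abs_mul, abs_of_pos (by norm_num : (0 : ℝ) < 1 / 2)]
      linarith
    calc C * _ ≤ C * ((1 + M₁) * R) := by gcongr
      _ ≤ _ := by linarith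

/-- Gronwall in either direction of y. The forward direction limits growth; the backward one shows
that the pair cannot vanish at a focusing point. -/
theorem norm_jacPair_le (hF : SourceBound F C) (S : LagrangeSol F u₀ v₀ v₀' Z V J P U)
    {M₁ q ξ y₀ y : ℝ} (hV : ∀ r ∈ uIcc y₀ y, |V (q, r, ξ)| ≤ M₁) :
    ‖jacPair J P q ξ y‖ ≤ ‖jacPair J P q ξ y₀‖ * Real.exp ((1 + C * (1 + M₁)) * |y - y₀|) := by
  obtain ⟨σ, hσ, hy⟩ : ∃ σ : ℝ, |σ| = 1 ∧ y = y₀ + σ * |y - y₀| := by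
    rcases le_total y₀ y with h | h
    · exact ⟨1, by simp, by rw [abs_of_nonneg (by linarith)]; ring⟩
    · exact ⟨-1, by simp, by rw [abs_of_nonpos (by linarith)]; ring⟩
  set ℓ := |y - y₀| with hℓ
  have hmem : ∀ s ∈ Icc 0 ℓ, y₀ + σ * s ∈ uIcc y₀ y := by
    intro s hs
    rcases eq_or_eq_neg_of_abs_eq hσ with h | h
    · rw [hy, h, mem_uIcc]; left; constructor <;> linarith [hs.1, hs.2]
    · rw [hy, h, mem_uIcc]; right; constructor <;> linarith [hs.1, hs.2]
  have hd : ∀ s ∈ Icc 0 ℓ, ∃ D, HasDerivAt (fun s => jacPair J P q ξ (y₀ + σ * s)) D s ∧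
      ‖D‖ ≤ (1 + C * (1 + M₁)) * ‖jacPair J P q ξ (y₀ + σ * s)‖ := by
    intro s hs
    obtain ⟨D, hD, hDn⟩ := exists_hasDerivAt_jacPair hF S (hV _ (hmem s hs))
    refine ⟨σ • D, ?_, by rwa [norm_smul, Real.norm_eq_abs, hσ, one_mul]⟩
    have := HasDerivAt.scomp s hD (((hasDerivAt_id s).const_mul σ).const_add y₀)
    simpa [Function.comp_def] using this
  choose! D hD hDn using hd
  have := norm_le_gronwallBound_of_norm_deriv_right_le (a := 0) (b := ℓ) (ε := 0)
    (δ := ‖jacPair J P q ξ y₀‖) (K := 1 + C * (1 + M₁))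
    (f := fun s => jacPair J P q ξ (y₀ + σ * s)) (f' := D)
    (fun s hs => (hD s hs).continuousAt.continuousWithinAt)
    (fun s hs => (hD s ⟨hs.1, hs.2.le⟩).hasDerivWithinAt) (by simp)
    (fun s hs => by rw [add_zero]; exact hDn s ⟨hs.1, hs.2.le⟩) ℓ ⟨abs_nonneg _, le_rfl⟩
  simp only [← hy, gronwallBound_ε0, sub_zero] at this
  exact this

theorem norm_jacPair_sub_le (hF : SourceBound F C) (S : LagrangeSol F u₀ v₀ v₀' Z V J P U)
    {M₁ q ξ y₀ y : ℝ} (hV : ∀ r ∈ uIcc y₀ y, |V (q, r, ξ)| ≤ M₁) :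
    ‖jacPair J P q ξ y - jacPair J P q ξ y₀‖ ≤ (1 + C * (1 + M₁)) * (‖jacPair J P q ξ y₀‖ *
      Real.exp ((1 + C * (1 + M₁)) * |y - y₀|)) * |y - y₀| := by
  have hC := hF.nonneg
  have hM : 0 ≤ M₁ := (abs_nonneg _).trans (hV y₀ left_mem_uIcc)
  have hd : ∀ r ∈ uIcc y₀ y, ∃ D, HasDerivAt (jacPair J P q ξ) D r ∧
      ‖D‖ ≤ (1 + C * (1 + M₁)) * ‖jacPair J P q ξ r‖ :=
    fun r hr => exists_hasDerivAt_jacPair hF S (hV r hr)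
  choose! D hD hDn using hd
  refine (convex_uIcc y₀ y).norm_image_sub_le_of_norm_hasDerivWithin_le
    (fun r hr => (hD r hr).hasDerivWithinAt) (fun r hr => (hDn r hr).trans ?_)
    left_mem_uIcc right_mem_uIcc
  gcongr
  refine (norm_jacPair_le hF S (y₀ := y₀) fun r' hr' => hV r' ?_).trans ?_
  · exact uIcc_subset_uIcc left_mem_uIcc hr hr'
  · have := abs_sub_le_of_mem_uIcc hr
    gcongr

/-- `J` stays positive for a time depending only on bounds of the data at the label. -/
theorem J_pos_of_small (hF : SourceBound F C) (S : LagrangeSol F u₀ v₀ v₀' Z V J P U)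
    {κ M₀ h : ℝ} (h1 : h ≤ 1) (hsmall : (1 + C * (2 + M₀ + C)) * ((1 + M₀ + C) *
      Real.exp (1 + C * (2 + M₀ + C))) * h < 1 - κ) {q ξ y : ℝ} (hy : |y - ξ| ≤ h)
    (hv : v₀ (q, ξ) ≤ κ) (hv0 : |v₀ (q, ξ)| ≤ M₀) (hv' : |v₀' (q, ξ)| ≤ M₀) :
    0 < J (q, y, ξ) := by
  have hC := hF.nonneg
  have hM : 0 ≤ M₀ := (abs_nonneg _).trans hv0
  have hle : |y - ξ| ≤ 1 := hy.trans h1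
  have hV : ∀ r ∈ uIcc ξ y, |V (q, r, ξ)| ≤ M₀ + C := by
    intro r hr
    have e1 := S.abs_V_sub_le hF q r ξ
    have e2 : C * |r - ξ| ≤ C * 1 := by
      gcongr
      exact (abs_sub_le_of_mem_uIcc hr).trans hle
    have e3 := abs_sub_abs_le_abs_sub (V (q, r, ξ)) (v₀ (q, ξ))
    linarith
  have h2 := norm_jacPair_sub_le hF S hV
  have h3 : ‖jacPair J P q ξ ξ‖ ≤ 1 + M₀ + C := by
    rw [jacPair, Prod.norm_def, S.J_diag, S.P_diag, max_le_iff]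
    constructor
    · refine (norm_sub_le _ _).trans ?_
      rw [norm_one, Real.norm_eq_abs]
      linarith
    · refine (norm_add_le _ _).trans ?_
      have := hF.bound (q, ξ, ξ, u₀ (q, ξ), v₀ (q, ξ))
      simp only [Real.norm_eq_abs]
      linarith
  have h4 : |J (q, y, ξ) - J (q, ξ, ξ)| ≤ ‖jacPair J P q ξ y - jacPair J P q ξ ξ‖ :=
    norm_fst_le (jacPair J P q ξ y - jacPair J P q ξ ξ)
  have e : 1 + C * (1 + (M₀ + C)) = 1 + C * (2 + M₀ + C) - C := by ring
  have h5 : (1 + C * (1 + (M₀ + C))) * (‖jacPair J P q ξ ξ‖ *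
      Real.exp ((1 + C * (1 + (M₀ + C))) * |y - ξ|)) * |y - ξ| ≤
      (1 + C * (2 + M₀ + C)) * ((1 + M₀ + C) * Real.exp (1 + C * (2 + M₀ + C))) * h := by
    have e1 : 1 + C * (1 + (M₀ + C)) ≤ 1 + C * (2 + M₀ + C) := by linarith
    have e2 : (1 + C * (1 + (M₀ + C))) * |y - ξ| ≤ 1 + C * (2 + M₀ + C) := by
      have : (1 + C * (1 + (M₀ + C))) * |y - ξ| ≤ (1 + C * (1 + (M₀ + C))) * 1 := by gcongr
      linarith
    gcongr
  rw [S.J_diag] at h4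
  have := (abs_le.1 (h4.trans (h2.trans h5))).1
  linarith

/-- If `P` is very negative at a label, then `J` vanishes quickly along its characteristic. -/
theorem exists_J_nonpos (hF : SourceBound F C) (S : LagrangeSol F u₀ v₀ v₀' Z V J P U)
    {M₀ A q ξ : ℝ} (hv0 : |v₀ (q, ξ)| ≤ M₀) (hA : 1 + M₀ ≤ A) (hP : P (q, ξ, ξ) = -A)
    (hsmall : 2 * ((1 + C * (2 + M₀ + C)) * Real.exp (1 + C * (2 + M₀ + C))) *
      (2 * (1 + M₀) / A) ≤ 1) :
    J (q, ξ + 2 * (1 + M₀) / A, ξ) ≤ 0 ∧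
      (ξ + 2 * (1 + M₀) / A - Z (q, ξ + 2 * (1 + M₀) / A, ξ)) / 2 ≤
        (1 + M₀ + C) * (2 * (1 + M₀) / A) := by
  have hC := hF.nonneg
  have hM : 0 ≤ M₀ := (abs_nonneg _).trans hv0
  have hA0 : 0 < A := by linarith
  -- J starts at most 1 + M₀ and falls at rate at least A/2 as long as P ≤ −A/2; s is the length
  -- with (A/2)s = 1 + M₀.
  set s := 2 * (1 + M₀) / A with hs
  have hs0 : 0 < s := by positivity
  set K := 1 + C * (2 + M₀ + C) with hK
  have hK1 : 1 ≤ K := by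
    have : 0 ≤ C * (2 + M₀ + C) := by positivity
    linarith
  have hs1 : s ≤ 1 := by
    have h1 : 1 ≤ Real.exp K := Real.one_le_exp (by linarith)
    have h2 : 1 ≤ K * Real.exp K := by nlinarith
    nlinarith
  have hV : ∀ r ∈ Icc ξ (ξ + s), |V (q, r, ξ)| ≤ M₀ + C := by
    intro r hr
    have e1 := S.abs_V_sub_le hF q r ξ
    have e2 : C * |r - ξ| ≤ C * 1 := by
      gcongr
      rw [abs_le]
      constructor <;> linarith [hr.1, hr.2]
    have e3 := abs_sub_abs_le_abs_sub (V (q, r, ξ)) (v₀ (q, ξ))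
    linarith
  have hJ0 : |J (q, ξ, ξ)| ≤ 1 + M₀ := by
    rw [S.J_diag]
    refine (abs_sub _ _).trans ?_
    rw [abs_one]
    linarith
  have hR : ‖jacPair J P q ξ ξ‖ ≤ A := by
    rw [jacPair, Prod.norm_def, hP, max_le_iff]
    exact ⟨hJ0.trans hA, by rw [norm_neg, Real.norm_eq_abs, abs_of_pos hA0]⟩
  -- As 1 + M₀ ≤ A, the initial pair has norm at most A, so by linearity P varies over the length s
  -- by at most K e^K A s ≤ A/2.
  have hPle : ∀ r ∈ Icc ξ (ξ + s), P (q, r, ξ) ≤ -(A / 2) := by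
    intro r hr
    have hsub : uIcc ξ r ⊆ Icc ξ (ξ + s) := by
      rw [uIcc_of_le hr.1]
      exact Icc_subset_Icc_right hr.2
    have h2 := norm_jacPair_sub_le hF S fun r' hr' => hV r' (hsub hr')
    have h4 : |P (q, r, ξ) - P (q, ξ, ξ)| ≤ ‖jacPair J P q ξ r - jacPair J P q ξ ξ‖ :=
      norm_snd_le (jacPair J P q ξ r - jacPair J P q ξ ξ)
    have hrs : |r - ξ| ≤ s := by
      rw [abs_le]
      constructor <;> linarith [hr.1, hr.2]
    have e1 : 1 + C * (1 + (M₀ + C)) ≤ K := by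
      rw [hK]
      linarith
    have e2 : (1 + C * (1 + (M₀ + C))) * |r - ξ| ≤ K := by
      have e3 : (1 + C * (1 + (M₀ + C))) * |r - ξ| ≤ K * 1 := by
        gcongr
        exact hrs.trans hs1
      linarith
    have h5 : (1 + C * (1 + (M₀ + C))) * (‖jacPair J P q ξ ξ‖ *
        Real.exp ((1 + C * (1 + (M₀ + C))) * |r - ξ|)) * |r - ξ| ≤ K * (A * Real.exp K) * s := by
      gcongr
    have h6 : K * (A * Real.exp K) * s ≤ A / 2 := by
      have : K * (A * Real.exp K) * s = A / 2 * (2 * (K * Real.exp K) * s) := by ring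
      rw [this]
      exact mul_le_of_le_one_right (by positivity) hsmall
    have := (abs_le.1 (h4.trans (h2.trans (h5.trans h6)))).2
    rw [hP] at this
    linarith
  constructor
  · have h1 := (convex_Icc ξ (ξ + s)).image_sub_le_mul_sub_of_deriv_le
      (f := fun y => J (q, y, ξ)) (C := -(A / 2))
      (fun x _ => (S.J_y q x ξ).continuousAt.continuousWithinAt)
      (fun x _ => (S.J_y q x ξ).differentiableAt.differentiableWithinAt)
      (fun x hx => by
        rw [(S.J_y q x ξ).deriv]
        exact hPle x (interior_subset hx))
      ξ (left_mem_Icc.2 (by linarith)) (ξ + s) (right_mem_Icc.2 (by linarith)) (by linarith)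
    have h2 : A / 2 * s = 1 + M₀ := by
      rw [hs]
      field_simp
    have h3 := (abs_le.1 hJ0).2
    nlinarith
  · have h1 := (convex_Icc ξ (ξ + s)).image_sub_le_mul_sub_of_deriv_le
      (f := fun y => (y - Z (q, y, ξ)) / 2) (C := 1 + M₀ + C)
      (fun x _ => (EulerDomain.hasDerivAt_time S q x ξ).continuousAt.continuousWithinAt)
      (fun x _ => (EulerDomain.hasDerivAt_time S q x ξ).differentiableAt.differentiableWithinAt)
      (fun x hx => by
        rw [(EulerDomain.hasDerivAt_time S q x ξ).deriv]
        have := (abs_le.1 (hV x (interior_subset hx))).1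
        linarith)
      ξ (left_mem_Icc.2 (by linarith)) (ξ + s) (right_mem_Icc.2 (by linarith)) (by linarith)
    rw [S.Z_diag] at h1
    have e : ξ + s - ξ = s := by ring
    rw [e] at h1
    linarith

end LagrangeSol

/-! ### The blow-up time -/

/-- The first time `T` at which characteristics focus, and a point `(q, y, ξ)` where they do. -/
structure FocusPoint (Z V J : ℝ × ℝ × ℝ → ℝ) (h h₁ c T q y ξ : ℝ) : Prop
    extends EulerDomain Z V J h h₁ c T where
  lt_y : ξ < y
  y_lt : y - ξ < h
  time_eq : (y - Z (q, y, ξ)) / 2 = T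
  J_eq : J (q, y, ξ) = 0

namespace LagrangeSol

variable {F : ℝ × ℝ × ℝ × ℝ × ℝ → ℝ} {u₀ v₀ v₀' : ℝ × ℝ → ℝ} {C M : ℝ}
  {Z V J P U : ℝ × ℝ × ℝ → ℝ}

/-- `V` stays below `1` for short times. -/
theorem V_le (hF : SourceBound F C) (S : LagrangeSol F u₀ v₀ v₀' Z V J P U) {κ h h₁ : ℝ}
    (hv : ∀ p, v₀ p ≤ κ) (h₁_le : h₁ ≤ h) (hsmall : C * h ≤ (1 - κ) / 2) (p : ℝ × ℝ × ℝ)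
    (h1 : -h₁ ≤ p.2.1 - p.2.2) (h2 : p.2.1 - p.2.2 ≤ h) : V p ≤ 1 - 2 * ((1 - κ) / 4) := by
  obtain ⟨q, y, ξ⟩ := p
  simp only at h1 h2
  have e1 := (abs_le.1 (S.abs_V_sub_le hF q y ξ)).2
  have e2 : C * |y - ξ| ≤ C * h := by
    have := hF.nonneg
    gcongr
    rw [abs_le]
    constructor <;> linarith
  have := hv (q, ξ)
  linarith

/-- The points of the strip with J ≤ 0 have labels in K and form a compact set, so the time attains
a minimum there; it is positive because J > 0 near the diagonal. The width h is tied to the data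
outside K, whereas h₁ is tied to the global bound M and may be much smaller. -/
theorem exists_focusPoint (hF : SourceBound F C) (hD : DataBound u₀ v₀ v₀' M)
    (S : LagrangeSol F u₀ v₀ v₀' Z V J P U) {κ h : ℝ} (hκ : κ < 1) (hv : ∀ p, v₀ p ≤ κ)
    (hh : 0 < h) (hsmall : C * h ≤ (1 - κ) / 2) {K : Set (ℝ × ℝ)} (hK : IsCompact K)
    (hout : ∀ q ξ y, (q, ξ) ∉ K → |y - ξ| ≤ h → 0 < J (q, y, ξ)) {q₁ y₁ ξ₁ : ℝ}
    (hy₁ : ξ₁ ≤ y₁) (hy₁' : y₁ - ξ₁ ≤ h) (hJ₁ : J (q₁, y₁, ξ₁) ≤ 0)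
    (ht₁ : (y₁ - Z (q₁, y₁, ξ₁)) / 2 < (1 - κ) / 4 * h) :
    ∃ h₁ T q y ξ, FocusPoint Z V J h h₁ ((1 - κ) / 4) T q y ξ ∧
      T ≤ (y₁ - Z (q₁, y₁, ξ₁)) / 2 := by
  have hC := hF.nonneg
  have hM : 0 ≤ M := (abs_nonneg _).trans (hD.bound_v 0)
  have hκ' : 0 < 1 - κ := by linarith
  set Q := (1 + C * (2 + M + C)) * ((1 + M + C) * Real.exp (1 + C * (2 + M + C))) with hQ
  have hQ0 : 0 ≤ Q := by positivity
  obtain ⟨h₁, h₁_pos, h₁_le, h₁_le', h₁_small⟩ : ∃ h₁ > 0, h₁ ≤ h ∧ h₁ ≤ 1 ∧ Q * h₁ < 1 - κ := by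
    refine ⟨min h (min 1 ((1 - κ) / (2 * (Q + 1)))), by positivity, min_le_left _ _,
      (min_le_right _ _).trans (min_le_left _ _), ?_⟩
    have h1 : Q * min h (min 1 ((1 - κ) / (2 * (Q + 1)))) ≤ Q * ((1 - κ) / (2 * (Q + 1))) := by
      gcongr
      exact (min_le_right _ _).trans (min_le_right _ _)
    refine h1.trans_lt ?_
    rw [← mul_div_assoc, div_lt_iff₀ (by positivity)]
    nlinarith
  have hneg : ∀ q ξ y, |y - ξ| ≤ h₁ → 0 < J (q, y, ξ) := fun q ξ y hy =>
    S.J_pos_of_small hF h₁_le' h₁_small hy (hv _) (hD.bound_v _) (hD.bound_v' _)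
  have hVle := S.V_le hF hv h₁_le hsmall
  have hJc := S.cont_J
  have hZc := S.cont_Z
  set time : ℝ × ℝ × ℝ → ℝ := fun p => (p.2.1 - Z p) / 2 with htime
  have htc : Continuous time := by fun_prop
  set B : Set (ℝ × ℝ × ℝ) :=
    ((fun p : (ℝ × ℝ) × ℝ => (p.1.1, p.1.2 + p.2, p.1.2)) '' (K ×ˢ Icc 0 h)) ∩ {p | J p ≤ 0} with hB
  have hBc : IsCompact B := ((hK.prod isCompact_Icc).image (by fun_prop)).inter_right
    (isClosed_le hJc continuous_const)
  have hmemB : ∀ q y ξ, -h₁ ≤ y - ξ → y - ξ ≤ h → J (q, y, ξ) ≤ 0 → (q, y, ξ) ∈ B := by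
    intro q y ξ a1 a2 a3
    have b1 : ξ ≤ y := by
      by_contra hc
      push Not at hc
      have := hneg q ξ y (by rw [abs_le]; constructor <;> linarith)
      linarith
    refine ⟨⟨((q, ξ), y - ξ), ⟨?_, by simp only; linarith, a2⟩, by simp⟩, a3⟩
    by_contra hc
    have := hout q ξ y hc (by rw [abs_le]; constructor <;> linarith)
    linarith
  have hB₁ : (q₁, y₁, ξ₁) ∈ B := hmemB _ _ _ (by linarith) hy₁' hJ₁
  obtain ⟨⟨q, y, ξ⟩, hpB, hmin⟩ := hBc.exists_isMinOn ⟨_, hB₁⟩ htc.continuousOn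
  have hp1 : ξ ≤ y ∧ y - ξ ≤ h := by
    obtain ⟨⟨p, hp, hpe⟩, -⟩ := hpB
    simp only [Prod.mk.injEq] at hpe
    obtain ⟨-, e2, e3⟩ := hpe
    have := hp.2
    constructor <;> linarith [this.1, this.2]
  have hJle : J (q, y, ξ) ≤ 0 := hpB.2
  have hlt : ξ < y := by
    refine lt_of_le_of_ne hp1.1 fun he => ?_
    have := hneg q ξ y (by rw [he]; simpa using h₁_pos.le)
    linarith
  have htimeT := EulerDomain.time_sub_le S hVle (q := q) (ξ := ξ) (y := ξ) (y' := y)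
    (by linarith) hlt.le hp1.2
  rw [S.Z_diag] at htimeT
  have hle₁ : time (q, y, ξ) ≤ time (q₁, y₁, ξ₁) := hmin hB₁
  have hTdef : time (q, y, ξ) = (y - Z (q, y, ξ)) / 2 := rfl
  have hTdef₁ : time (q₁, y₁, ξ₁) = (y₁ - Z (q₁, y₁, ξ₁)) / 2 := rfl
  have hpos : 0 < (1 - κ) / 4 * (y - ξ) := by
    have : 0 < y - ξ := by linarith
    positivity
  refine ⟨h₁, time (q, y, ξ), q, y, ξ, ⟨⟨hh, h₁_pos, by linarith, ?_, ?_, hVle, ?_⟩, hlt, ?_,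
    rfl, ?_⟩, hle₁⟩
  · linarith
  · linarith
  · rintro ⟨q', y', ξ'⟩ a1 a2 a3
    by_contra hc
    push Not at hc
    have : time (q, y, ξ) ≤ time (q', y', ξ') := hmin (hmemB _ _ _ a1 a2 hc)
    exact absurd a3 (not_lt.2 this)
  · have : (1 - κ) / 4 * (y - ξ) < (1 - κ) / 4 * h := by linarith
    exact lt_of_mul_lt_mul_left this (by linarith)
  -- If J were negative at the minimizer, it would still be so slightly earlier on the same
  -- characteristic, where the time is smaller.
  · by_contra hne
    have hJlt : J (q, y, ξ) < 0 := lt_of_le_of_ne hJle hne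
    have hev : ∀ᶠ r in 𝓝[<] y, J (q, r, ξ) < 0 := by
      have : ContinuousAt (fun r => J (q, r, ξ)) y := by fun_prop
      exact (this.eventually (gt_mem_nhds hJlt)).filter_mono nhdsWithin_le_nhds
    obtain ⟨r, hr1, hr2⟩ := (hev.and (Ioo_mem_nhdsLT hlt)).exists
    have e1 : time (q, y, ξ) ≤ time (q, r, ξ) :=
      hmin (hmemB q r ξ (by linarith [hr2.1]) (by linarith [hr2.2]) hr1.le)
    have e2 := EulerDomain.time_sub_le S hVle (q := q) (ξ := ξ) (y := r) (y' := y)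
      (by linarith [hr2.1]) hr2.2.le hp1.2
    have e3 : time (q, r, ξ) = (r - Z (q, r, ξ)) / 2 := rfl
    have e4 : 0 < (1 - κ) / 4 * (y - r) := by
      have : 0 < y - r := by linarith [hr2.2]
      positivity
    linarith

end LagrangeSol

/-! ### Behaviour near a focusing point -/

namespace LagrangeSol

variable {F : ℝ × ℝ × ℝ × ℝ × ℝ → ℝ} {u₀ u₀' v₀ v₀' : ℝ × ℝ → ℝ} {C M : ℝ}
  {Z V J P U : ℝ × ℝ × ℝ → ℝ}

theorem norm_lagInit_sub_le (hF : SourceBound F C) (hD : DataBound u₀ v₀ v₀' M) {q ξ A Q δ : ℝ}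
    (hδ0 : 0 ≤ δ) (hδ1 : δ ≤ 1) (hQ : 0 ≤ Q) (hA : |v₀' (q, ξ + δ) - v₀' (q, ξ)| ≤ A * δ ^ (3 / 4 : ℝ))
    (hu : |u₀ (q, ξ + δ) - u₀ (q, ξ)| ≤ Q * δ) :
    ‖lagInit F u₀ v₀ v₀' q (ξ + δ) - lagInit F u₀ v₀ v₀' q ξ‖ ≤
      (1 + M + A + C * (1 + Q + M)) * δ ^ (3 / 4 : ℝ) := by
  have hC := hF.nonneg
  have hM : 0 ≤ M := (abs_nonneg _).trans (hD.bound_v 0)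
  set d := δ ^ (3 / 4 : ℝ) with hd
  have hd0 : 0 ≤ d := Real.rpow_nonneg hδ0 _
  have hδd : δ ≤ d := by
    have := Real.rpow_le_rpow_of_exponent_ge' hδ0 hδ1 (by norm_num) (by norm_num : (3 / 4 : ℝ) ≤ 1)
    rwa [Real.rpow_one] at this
  have hv : |v₀ (q, ξ + δ) - v₀ (q, ξ)| ≤ M * d := by
    have := convex_univ.norm_image_sub_le_of_norm_hasDerivWithin_le (C := M)
      (f := fun x => v₀ (q, x)) (fun x _ => (hD.deriv_v (q, x)).hasDerivWithinAt)
      (fun x _ => hD.bound_v' (q, x)) (mem_univ ξ) (mem_univ (ξ + δ))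
    simp only [Real.norm_eq_abs, add_sub_cancel_left, abs_of_nonneg hδ0] at this
    exact this.trans (by gcongr)
  have hu' : |u₀ (q, ξ + δ) - u₀ (q, ξ)| ≤ Q * d := hu.trans (by gcongr)
  have hA0 : 0 ≤ A * d := (abs_nonneg _).trans hA
  have hFd : |F (q, ξ + δ, ξ + δ, u₀ (q, ξ + δ), v₀ (q, ξ + δ)) - F (q, ξ, ξ, u₀ (q, ξ), v₀ (q, ξ))| ≤
      C * ((1 + Q + M) * d) := by
    refine (hF.lip _ _).trans ?_
    gcongr
    have h1 : 0 ≤ Q * d := by positivity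
    have h2 : 0 ≤ M * d := by positivity
    rw [norm5_le_iff]
    simp only [Prod.mk_sub_mk, sub_self, add_sub_cancel_left, abs_of_nonneg hδ0, abs_zero]
    refine ⟨by positivity, ?_, ?_, ?_, ?_⟩ <;> linarith
  have h2 : 0 ≤ M * d := by positivity
  have h3 : 0 ≤ C * ((1 + Q + M) * d) := by positivity
  rw [norm4_le_iff]
  simp only [lagInit, Prod.mk_sub_mk, add_sub_cancel_left, abs_of_nonneg hδ0, sub_sub_sub_cancel_left]
  refine ⟨by linarith, by linarith, by rw [abs_sub_comm]; linarith, ?_⟩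
  rw [add_sub_add_comm]
  refine (abs_add_le _ _).trans ?_
  linarith

/-- At fixed `y` the function `J` is Hölder continuous in the label. -/
theorem exists_holder_J (hF : SourceBound F C) (hD : DataBound u₀ v₀ v₀' M)
    (S : LagrangeSol F u₀ v₀ v₀' Z V J P U)
    (hu : ∀ p : ℝ × ℝ, HasDerivAt (fun x => u₀ (p.1, x)) (u₀' p) p.2) (hu' : Continuous u₀')
    {q y ξ A : ℝ} (hlt : ξ < y) (hA0 : 0 ≤ A)
    (hA : ∀ δ ∈ Icc (0 : ℝ) 1, |v₀' (q, ξ + δ) - v₀' (q, ξ)| ≤ A * δ ^ (3 / 4 : ℝ)) :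
    ∃ A' ≥ 0, ∀ δ, 0 ≤ δ → δ ≤ 1 → δ ≤ y - ξ →
      |J (q, y, ξ + δ) - J (q, y, ξ)| ≤ A' * δ ^ (3 / 4 : ℝ) := by
  have hC := hF.nonneg
  have hM : 0 ≤ M := (abs_nonneg _).trans (hD.bound_v 0)
  have hZc := S.cont_Z
  have hVc := S.cont_V
  have hJc := S.cont_J
  have hPc := S.cont_P
  have hUc := S.cont_U
  set Φ : ℝ × ℝ × ℝ → ℝ × ℝ × ℝ × ℝ := fun p => (Z p, V p, J p, P p) with hΦ
  have hΦc : Continuous Φ := by fun_prop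
  set R : ℝ × ℝ × ℝ → ℝ × ℝ × ℝ × ℝ := fun p => lagRhs F p.1 p.2.1 (Φ p) (U p) with hR
  have hRc : Continuous R := by
    have h0 := hF.diff.continuous
    have h1 := hF.continuous_fderiv
    simp only [hR, hΦ, lagRhs]
    fun_prop
  have hΦd : ∀ r x, HasDerivAt (fun r => Φ (q, r, x)) (R (q, r, x)) r := fun r x =>
    (S.Z_y q r x).prodMk ((S.V_y q r x).prodMk ((S.J_y q r x).prodMk (S.P_y q r x)))
  obtain ⟨B, hB1, hBΦ, hBR, hBu⟩ : ∃ B ≥ 1, (∀ r ∈ Icc ξ y, ∀ x ∈ Icc ξ (ξ + 1), ‖Φ (q, r, x)‖ ≤ B) ∧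
      (∀ r ∈ Icc ξ y, ∀ x ∈ Icc ξ (ξ + 1), ‖R (q, r, x)‖ ≤ B) ∧
      ∀ x ∈ Icc ξ (ξ + 1), |u₀' (q, x)| ≤ B := by
    have hK : IsCompact (Icc ξ y ×ˢ Icc ξ (ξ + 1)) := isCompact_Icc.prod isCompact_Icc
    obtain ⟨B1, h1⟩ := hK.exists_bound_of_continuousOn
      (f := fun p : ℝ × ℝ => Φ (q, p.1, p.2)) (by fun_prop)
    obtain ⟨B2, h2⟩ := hK.exists_bound_of_continuousOn
      (f := fun p : ℝ × ℝ => R (q, p.1, p.2)) (by fun_prop)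
    obtain ⟨B3, h3⟩ := (isCompact_Icc (a := ξ) (b := ξ + 1)).exists_bound_of_continuousOn
      (f := fun x => u₀' (q, x)) (by fun_prop)
    refine ⟨max 1 (max B1 (max B2 B3)), le_max_left _ _, fun r hr x hx => ?_, fun r hr x hx => ?_,
      fun x hx => ?_⟩
    · exact (h1 (r, x) ⟨hr, hx⟩).trans ((le_max_left _ _).trans (le_max_right _ _))
    · exact (h2 (r, x) ⟨hr, hx⟩).trans
        ((le_max_left _ _).trans ((le_max_right _ _).trans (le_max_right _ _)))
    · exact (h3 x hx).trans ((le_max_right _ _).trans ((le_max_right _ _).trans (le_max_right _ _)))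
  set L := 1 + C * (2 * B ^ 2) with hL
  have hL0 : 0 < L := by positivity
  set A₁ := (1 + M + A + C * (1 + B + M)) + B with hA₁
  have hA₁0 : 0 ≤ A₁ := by positivity
  refine ⟨(A₁ + B ^ 2) * Real.exp (L * (y - ξ)), by positivity, fun δ hδ0 hδ1 hδy => ?_⟩
  set d := δ ^ (3 / 4 : ℝ) with hd
  have hd0 : 0 ≤ d := Real.rpow_nonneg hδ0 _
  have hδd : δ ≤ d := by
    have := Real.rpow_le_rpow_of_exponent_ge' hδ0 hδ1 (by norm_num) (by norm_num : (3 / 4 : ℝ) ≤ 1)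
    rwa [Real.rpow_one] at this
  have hξ' : ξ + δ ∈ Icc ξ (ξ + 1) := ⟨by linarith, by linarith⟩
  have hξξ : ξ ∈ Icc ξ (ξ + 1) := ⟨by linarith, by linarith⟩
  -- The two characteristics are compared from y = ξ + δ, where the second one starts; by then the
  -- first has moved by O(δ) from its own initial values.
  have hstart : ‖Φ (q, ξ + δ, ξ + δ) - Φ (q, ξ + δ, ξ)‖ ≤ A₁ * d := by
    have hdiag : ∀ x, Φ (q, x, x) = lagInit F u₀ v₀ v₀' q x := fun x => by
      simp only [hΦ, S.Z_diag, S.V_diag, S.J_diag, S.P_diag]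
      rfl
    have hul : |u₀ (q, ξ + δ) - u₀ (q, ξ)| ≤ B * δ := by
      have := (convex_Icc ξ (ξ + 1)).norm_image_sub_le_of_norm_hasDerivWithin_le (C := B)
        (f := fun x => u₀ (q, x)) (fun x _ => (hu (q, x)).hasDerivWithinAt) hBu hξξ hξ'
      simpa [abs_of_nonneg hδ0] using this
    have h1 := norm_lagInit_sub_le hF hD hδ0 hδ1 (by linarith) (hA δ ⟨hδ0, hδ1⟩) hul
    have h2 : ‖Φ (q, ξ + δ, ξ) - Φ (q, ξ, ξ)‖ ≤ B * δ := by
      have := (convex_Icc ξ y).norm_image_sub_le_of_norm_hasDerivWithin_le (C := B)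
        (f := fun r => Φ (q, r, ξ)) (fun r _ => (hΦd r ξ).hasDerivWithinAt)
        (fun r hr => hBR r hr ξ hξξ) (left_mem_Icc.2 hlt.le)
        (⟨by linarith, by linarith⟩ : ξ + δ ∈ Icc ξ y)
      simpa [abs_of_nonneg hδ0] using this
    have h3 : B * δ ≤ B * d := by gcongr
    have h4 : Φ (q, ξ + δ, ξ + δ) - Φ (q, ξ + δ, ξ) = (Φ (q, ξ + δ, ξ + δ) - Φ (q, ξ, ξ)) -
        (Φ (q, ξ + δ, ξ) - Φ (q, ξ, ξ)) := by abel
    rw [h4]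
    refine (norm_sub_le _ _).trans ?_
    rw [hdiag (ξ + δ), hdiag ξ] at *
    linarith
  have hstep : ∀ r ∈ Ico (ξ + δ) y, ‖R (q, r, ξ + δ) - R (q, r, ξ)‖ ≤
      L * ‖Φ (q, r, ξ + δ) - Φ (q, r, ξ)‖ + L * (B ^ 2 * d) := by
    intro r hr
    have hr' : r ∈ Icc ξ y := ⟨by linarith [hr.1], hr.2.le⟩
    -- U_ξ = VJ/2 is bounded, so the nonlocal unknown enters only as an inhomogeneity of size O(δ)
    -- and the ordinary Gronwall inequality suffices.
    have hΔU : |U (q, r, ξ + δ) - U (q, r, ξ)| ≤ B ^ 2 * d := by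
      have h1 := (convex_Icc ξ (ξ + 1)).norm_image_sub_le_of_norm_hasDerivWithin_le (C := B ^ 2)
        (f := fun x => U (q, r, x)) (fun x _ => (S.U_ξ q r x).hasDerivWithinAt)
        (fun x hx => by
          obtain ⟨-, e2, e3, -⟩ := norm4_le_iff.1 (hBΦ r hr' x hx)
          simp only [hΦ] at e2 e3
          rw [Real.norm_eq_abs, abs_mul, abs_mul, abs_of_pos (by norm_num : (0 : ℝ) < 1 / 2)]
          have : |V (q, r, x)| * |J (q, r, x)| ≤ B * B := by gcongr
          nlinarith [abs_nonneg (V (q, r, x)), abs_nonneg (J (q, r, x))]) hξξ hξ'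
      simp only [Real.norm_eq_abs, add_sub_cancel_left, abs_of_nonneg hδ0] at h1
      exact h1.trans (by gcongr)
    obtain ⟨-, e2, e3, e4⟩ := norm4_le_iff.1 (hBΦ r hr' _ hξ')
    obtain ⟨-, -, e3', -⟩ := norm4_le_iff.1 (hBΦ r hr' _ hξξ)
    have hn := norm_nonneg (Φ (q, r, ξ + δ) - Φ (q, r, ξ))
    have hBd : 0 ≤ B ^ 2 * d := by positivity
    have := norm_lagRhs_sub_le hF (q := q) (y := r) (u := U (q, r, ξ + δ)) (u' := U (q, r, ξ))
      (φ := Φ (q, r, ξ + δ)) (φ' := Φ (q, r, ξ)) (B := B)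
      (d := ‖Φ (q, r, ξ + δ) - Φ (q, r, ξ)‖ + B ^ 2 * d) hB1 e2 e3 e4 e3' (by linarith) (by linarith)
    rw [mul_add] at this
    exact this
  have hgr := norm_le_gronwallBound_of_norm_deriv_right_le (a := ξ + δ) (b := y)
    (f := fun r => Φ (q, r, ξ + δ) - Φ (q, r, ξ)) (f' := fun r => R (q, r, ξ + δ) - R (q, r, ξ))
    (by fun_prop) (fun r _ => ((hΦd r (ξ + δ)).sub (hΦd r ξ)).hasDerivWithinAt) hstart hstep y
    ⟨by linarith, le_rfl⟩
  have hJle : |J (q, y, ξ + δ) - J (q, y, ξ)| ≤ ‖Φ (q, y, ξ + δ) - Φ (q, y, ξ)‖ :=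
    (norm4_le_iff.1 (le_refl ‖Φ (q, y, ξ + δ) - Φ (q, y, ξ)‖)).2.2.1
  refine hJle.trans (hgr.trans ?_)
  rw [gronwallBound_of_K_ne_0 hL0.ne']
  have e1 : L * (B ^ 2 * d) / L = B ^ 2 * d := by field_simp
  rw [e1]
  have e2 : Real.exp (L * (y - (ξ + δ))) ≤ Real.exp (L * (y - ξ)) := by
    gcongr
    linarith
  have e3 : A₁ * d * Real.exp (L * (y - (ξ + δ))) ≤ A₁ * d * Real.exp (L * (y - ξ)) := by gcongr
  have e4 : B ^ 2 * d * (Real.exp (L * (y - (ξ + δ))) - 1) ≤ B ^ 2 * d * Real.exp (L * (y - ξ)) := by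
    gcongr
    linarith
  calc _ ≤ A₁ * d * Real.exp (L * (y - ξ)) + B ^ 2 * d * Real.exp (L * (y - ξ)) := by linarith
    _ = _ := by ring

end LagrangeSol

namespace FocusPoint

variable {F : ℝ × ℝ × ℝ × ℝ × ℝ → ℝ} {u₀ u₀' v₀ v₀' : ℝ × ℝ → ℝ} {C M : ℝ}
  {Z V J P U : ℝ × ℝ × ℝ → ℝ} {h h₁ c T q y ξ : ℝ}

/-- (J, P) solves a homogeneous linear system, so J = P = 0 at one point would give J = 0 on the
diagonal, where J = 1 − v₀ > 0. -/
theorem P_ne_zero (E : FocusPoint Z V J h h₁ c T q y ξ) (hF : SourceBound F C)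
    (S : LagrangeSol F u₀ v₀ v₀' Z V J P U) : P (q, y, ξ) ≠ 0 := by
  intro hP
  have hV := S.cont_V
  obtain ⟨B, hB⟩ := (isCompact_uIcc (a := y) (b := ξ)).exists_bound_of_continuousOn
    (f := fun r => V (q, r, ξ)) (by fun_prop)
  have h1 := LagrangeSol.norm_jacPair_le hF S hB
  have h2 : LagrangeSol.jacPair J P q ξ y = 0 := by simp [LagrangeSol.jacPair, E.J_eq, hP]
  rw [h2, norm_zero, zero_mul] at h1
  have h3 : J (q, ξ, ξ) = 0 := congrArg Prod.fst (norm_le_zero_iff.1 h1)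
  rw [S.J_diag] at h3
  have h4 := E.V_le (q, ξ, ξ) (by simp only [sub_self]; linarith [E.h₁_pos])
    (by simp only [sub_self]; linarith [E.h_pos])
  rw [S.V_diag] at h4
  linarith [E.c_pos]

/-- Points at the time `T` on the characteristics near the focusing one. -/
theorem exists_near (E : FocusPoint Z V J h h₁ c T q y ξ) (hF : SourceBound F C)
    (hD : DataBound u₀ v₀ v₀' M) (S : LagrangeSol F u₀ v₀ v₀' Z V J P U)
    (hu : ∀ p : ℝ × ℝ, HasDerivAt (fun x => u₀ (p.1, x)) (u₀' p) p.2) (hu' : Continuous u₀')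
    {A : ℝ} (hA0 : 0 ≤ A)
    (hA : ∀ δ ∈ Icc (0 : ℝ) 1, |v₀' (q, ξ + δ) - v₀' (q, ξ)| ≤ A * δ ^ (3 / 4 : ℝ)) :
    ∃ A' ≥ 0, ∃ η > 0, ∀ δ ∈ Ioo 0 η, ∃ y', |y' - y| ≤ A' * δ ^ (7 / 4 : ℝ) ∧ ξ + δ ≤ y' ∧
      y' - (ξ + δ) ≤ h ∧ (y' - Z (q, y', ξ + δ)) / 2 = T := by
  obtain ⟨B, hB0, hB⟩ := LagrangeSol.exists_holder_J hF hD S hu hu' E.lt_y hA0 hA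
  have hc := E.c_pos
  have hZ := S.cont_Z
  have hgap1 : 0 < y - ξ := sub_pos.2 E.lt_y
  have hgap2 : 0 < h - (y - ξ) := sub_pos.2 E.y_lt
  refine ⟨B / c, by positivity, min 1 (min ((y - ξ) / (1 + B / c)) ((h - (y - ξ)) / (1 + B / c))),
    by positivity, fun δ hδ => ?_⟩
  have hδ0 : 0 < δ := hδ.1
  have hδ1 : δ < 1 := hδ.2.trans_le (min_le_left _ _)
  have hδ2 : δ * (1 + B / c) < y - ξ := by
    rw [← lt_div_iff₀ (by positivity)]
    exact hδ.2.trans_le ((min_le_right _ _).trans (min_le_left _ _))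
  have hδ3 : δ * (1 + B / c) < h - (y - ξ) := by
    rw [← lt_div_iff₀ (by positivity)]
    exact hδ.2.trans_le ((min_le_right _ _).trans (min_le_right _ _))
  have hBc : 0 ≤ B / c := by positivity
  have e74 : δ ^ (7 / 4 : ℝ) = δ ^ (3 / 4 : ℝ) * δ := by
    rw [← Real.rpow_add_one hδ0.ne']
    norm_num
  have hle : δ ^ (7 / 4 : ℝ) ≤ δ := by
    have := Real.rpow_le_rpow_of_exponent_ge hδ0 hδ1.le (by norm_num : (1 : ℝ) ≤ 7 / 4)
    rwa [Real.rpow_one] at this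
  set ε := B / c * δ ^ (7 / 4 : ℝ) with hε
  have hε0 : 0 ≤ ε := by positivity
  have hεδ : ε ≤ B / c * δ := by
    rw [hε]
    gcongr
  have hcε : c * ε = B * (δ ^ (3 / 4 : ℝ) * δ) := by
    rw [hε, e74]
    field_simp
  -- J vanishes at ξ, so |J| ≤ Bδ^(3/4) on [ξ, ξ + δ], and integrating −J/2 moves the time at fixed
  -- y away from T by at most Bδ^(7/4) = cε. The time grows at rate at least c in y, so its values
  -- at y − ε and y + ε bracket T.
  have hT : |(y - Z (q, y, ξ + δ)) / 2 - T| ≤ c * ε := by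
    have h1 := (convex_Icc ξ (ξ + δ)).norm_image_sub_le_of_norm_hasDerivWithin_le
      (C := B * δ ^ (3 / 4 : ℝ)) (f := fun x => (y - Z (q, y, x)) / 2)
      (fun x _ => (EulerDomain.hasDerivAt_time_ξ S q y x).hasDerivWithinAt)
      (fun x hx => by
        have h2 := hB (x - ξ) (by linarith [hx.1]) (by linarith [hx.2]) (by
          have : 0 ≤ δ * (B / c) := by positivity
          linarith [hx.2])
        rw [E.J_eq, sub_zero, add_sub_cancel] at h2
        rw [Real.norm_eq_abs, abs_div, abs_neg, abs_two]
        have h3 : (x - ξ) ^ (3 / 4 : ℝ) ≤ δ ^ (3 / 4 : ℝ) :=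
          Real.rpow_le_rpow (by linarith [hx.1]) (by linarith [hx.2]) (by norm_num)
        have h4 : B * (x - ξ) ^ (3 / 4 : ℝ) ≤ B * δ ^ (3 / 4 : ℝ) := by gcongr
        linarith [abs_nonneg (J (q, y, x))])
      (left_mem_Icc.2 (by linarith)) (right_mem_Icc.2 (by linarith))
    simp only [E.time_eq, Real.norm_eq_abs, add_sub_cancel_left, abs_of_pos hδ0] at h1
    rw [hcε, ← mul_assoc]
    exact h1
  have h1 := EulerDomain.time_sub_le S E.V_le (q := q) (ξ := ξ + δ) (y := y) (y' := y + ε)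
    (by linarith [E.h₁_pos]) (by linarith) (by linarith)
  have h2 := EulerDomain.time_sub_le S E.V_le (q := q) (ξ := ξ + δ) (y := y - ε) (y' := y)
    (by linarith [E.h₁_pos]) (by linarith) (by linarith)
  have hgc : Continuous fun r => (r - Z (q, r, ξ + δ)) / 2 := by fun_prop
  rw [abs_le] at hT
  have e1 : y + ε - y = ε := by ring
  have e2 : y - (y - ε) = ε := by ring
  rw [e1] at h1
  rw [e2] at h2
  obtain ⟨y', hy', hy'T⟩ := intermediate_value_Icc (by linarith : y - ε ≤ y + ε) hgc.continuousOn
    (⟨by linarith, by linarith⟩ : T ∈ Icc _ _)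
  refine ⟨y', ?_, by linarith [hy'.1], by linarith [hy'.2], hy'T⟩
  rw [abs_le]
  constructor <;> linarith [hy'.1, hy'.2]

end FocusPoint

namespace EulerDomain

variable {F : ℝ × ℝ × ℝ × ℝ × ℝ → ℝ} {u₀ v₀ v₀' : ℝ × ℝ → ℝ}
  {Z V J P U : ℝ × ℝ × ℝ → ℝ} {h h₁ c T : ℝ}

/-- The characteristic through a point at the time `T`, parametrized by time. -/
theorem exists_curve (E : EulerDomain Z V J h h₁ c T) (S : LagrangeSol F u₀ v₀ v₀' Z V J P U)
    {q y ξ : ℝ} (h1 : ξ ≤ y) (h2 : y - ξ ≤ h) (hT : (y - Z (q, y, ξ)) / 2 = T) :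
    ∃ Y : ℝ → ℝ, (∀ t ∈ Ico 0 T, ξ ≤ Y t ∧ Y t ≤ y ∧ (Y t - Z (q, Y t, ξ)) / 2 = t) ∧
      Tendsto Y (𝓝[<] T) (𝓝 y) := by
  have hZ := S.cont_Z
  have hc := E.c_pos
  have hex : ∀ t ∈ Ico 0 T, ∃ r, ξ ≤ r ∧ r ≤ y ∧ (r - Z (q, r, ξ)) / 2 = t := by
    intro t ht
    have hgc : Continuous fun r => (r - Z (q, r, ξ)) / 2 := by fun_prop
    obtain ⟨r, hr, hrt⟩ := intermediate_value_Icc h1 hgc.continuousOn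
      (⟨by rw [S.Z_diag]; linarith [ht.1], by rw [hT]; exact ht.2.le⟩ : t ∈ Icc _ _)
    exact ⟨r, hr.1, hr.2, hrt⟩
  choose! Y hY using hex
  refine ⟨Y, hY, ?_⟩
  have hnear : ∀ᶠ t in 𝓝[<] T, t ∈ Ico 0 T :=
    mem_of_superset (Ioo_mem_nhdsLT E.T_pos) Ioo_subset_Ico_self
  have hlim : Tendsto (fun t => y - (T - t) / c) (𝓝[<] T) (𝓝 y) := by
    have : ContinuousAt (fun t => y - (T - t) / c) T := by fun_prop
    have h3 := this.tendsto.mono_left (nhdsWithin_le_nhds (s := Iio T))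
    simpa using h3
  refine tendsto_of_tendsto_of_tendsto_of_le_of_le' hlim tendsto_const_nhds
    (hnear.mono fun t ht => ?_) (hnear.mono fun t ht => (hY t ht).2.1)
  obtain ⟨a1, a2, a3⟩ := hY t ht
  have := time_sub_le S E.V_le (q := q) (ξ := ξ) (by linarith [E.h₁_pos]) a2 h2
  rw [a3, hT] at this
  have h3 : y - Y t ≤ (T - t) / c := by
    rw [le_div_iff₀ hc]
    linarith
  linarith

end EulerDomain

/-! ### Blow-up of the Sobolev norm -/

namespace EulerDomain

theorem planeMk_eq_add (a a' q : ℝ) : planeMk a q = planeMk a' q + (a - a') • e₁ := by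
  ext i
  fin_cases i <;> simp [planeMk, e₁]

theorem norm_planeMk_sub (a a' q : ℝ) : ‖planeMk a q - planeMk a' q‖ = |a - a'| := by
  rw [planeMk_eq_add a a' q, add_sub_cancel_left, norm_smul]
  simp [e₁]

variable {F : ℝ × ℝ × ℝ × ℝ × ℝ → ℝ} {u₀ v₀ v₀' : ℝ × ℝ → ℝ}
  {Z V J P U : ℝ × ℝ × ℝ → ℝ} {h h₁ c T : ℝ}

theorem eul_apply (E : EulerDomain Z V J h h₁ c T) (S : LagrangeSol F u₀ v₀ v₀' Z V J P U)
    (H : ℝ × ℝ × ℝ → ℝ) {q y ξ t : ℝ} (ht : t ∈ Ico 0 T) (h1 : ξ ≤ y) (h2 : y - ξ ≤ h)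
    (h3 : (y - Z (q, y, ξ)) / 2 = t) : eul Z h h₁ H t (planeMk (y - t) q) = H (q, y, ξ) := by
  have h4 := mul_pos E.c_pos E.h₁_pos
  have := E.label_eq S (by linarith [ht.1]) ht.2 h2 (by linarith [E.h₁_pos]) h3
  simp [eul, planeMk, this]

end EulerDomain

namespace FocusPoint

open EulerDomain

variable {F : ℝ × ℝ × ℝ × ℝ × ℝ → ℝ} {u₀ u₀' u₀'' v₀ v₀' : ℝ × ℝ → ℝ} {C M : ℝ}
  {Z V J P U : ℝ × ℝ × ℝ → ℝ} {h h₁ c T q y ξ : ℝ}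

/-- If the Sobolev norms do not tend to infinity, then the derivative in Lagrangian coordinates
is Hölder continuous with respect to the position at the time `T`. -/
theorem exists_holder_of_frequently (E : FocusPoint Z V J h h₁ c T q y ξ)
    (S : LagrangeSol F u₀ v₀ v₀' Z V J P U) {H : ℝ × ℝ × ℝ → ℝ} (hH : Continuous H)
    {u : ℝ → Plane → ℝ} (hu : IsC1 T u) (hux : ∀ t ∈ Ico 0 T, ∀ x, dx1 u t x = eul Z h h₁ H t x)
    {θ : Plane → ℝ} (hθc : Continuous θ) {ρ : ℝ}
    (hθ : ∀ x ∈ Metric.ball (planeMk (y - T) q) ρ, θ x = 1) {m : ℝ≥0∞} (hm : m < ⊤)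
    (hfreq : ∃ᶠ t in 𝓝[<] T, sobolevNorm (11 / 4) (fun x => θ x * u t x) ≤ m) :
    ∃ A ≥ 0, ∀ y' ξ', |y' - y| < ρ → ξ' ≤ y' → y' - ξ' ≤ h → (y' - Z (q, y', ξ')) / 2 = T →
      |H (q, y', ξ') - H (q, y, ξ)| ≤ A * |y' - y| ^ (2 / 3 : ℝ) := by
  -- The embedding requires 1 + γ < 11/4 − 1, that is γ < 3/4, and the contradiction requires (7/4)γ
  -- > 1; γ = 2/3 satisfies both.
  obtain ⟨C, hC0, hC⟩ := exists_holder_of_sobolevNorm (s := 11 / 4) (γ := 2 / 3) 1 (by norm_num)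
    (by norm_num) (by norm_num)
  refine ⟨C * m.toReal, by positivity, fun y' ξ' hρ h1 h2 hT => ?_⟩
  have hED := E.toEulerDomain
  obtain ⟨Y, hY, hYlim⟩ := hED.exists_curve S E.lt_y.le E.y_lt.le E.time_eq
  obtain ⟨Y', hY', hYlim'⟩ := hED.exists_curve S h1 h2 hT
  have hnear : ∀ᶠ t in 𝓝[<] T, t ∈ Ico 0 T :=
    mem_of_superset (Ioo_mem_nhdsLT E.T_pos) Ioo_subset_Ico_self
  have hid : Tendsto (fun t : ℝ => t) (𝓝[<] T) (𝓝 T) := tendsto_id.mono_left nhdsWithin_le_nhds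
  have hlim1 : Tendsto (fun t => |Y t - t - (y - T)|) (𝓝[<] T) (𝓝 0) := by
    have := ((hYlim.sub hid).sub_const (y - T)).abs
    simpa using this
  have hlim2 : Tendsto (fun t => |Y' t - t - (y - T)|) (𝓝[<] T) (𝓝 |y' - y|) := by
    have := ((hYlim'.sub hid).sub_const (y - T)).abs
    have e : y' - T - (y - T) = y' - y := by ring
    rwa [e] at this
  have hρ0 : 0 < ρ := (abs_nonneg _).trans_lt hρ
  have hev : ∀ᶠ t in 𝓝[<] T, t ∈ Ico 0 T ∧ |Y t - t - (y - T)| < ρ ∧ |Y' t - t - (y - T)| < ρ :=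
    hnear.and ((hlim1.eventually (gt_mem_nhds hρ0)).and (hlim2.eventually (gt_mem_nhds hρ)))
  have hLHS : Tendsto (fun t => |H (q, Y' t, ξ') - H (q, Y t, ξ)|) (𝓝[<] T)
      (𝓝 |H (q, y', ξ') - H (q, y, ξ)|) := by
    have g1 : Tendsto (fun t => H (q, Y' t, ξ')) (𝓝[<] T) (𝓝 (H (q, y', ξ'))) := by
      have : Continuous fun r => H (q, r, ξ') := by fun_prop
      exact (this.tendsto y').comp hYlim'
    have g2 : Tendsto (fun t => H (q, Y t, ξ)) (𝓝[<] T) (𝓝 (H (q, y, ξ))) := by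
      have : Continuous fun r => H (q, r, ξ) := by fun_prop
      exact (this.tendsto y).comp hYlim
    exact (g1.sub g2).abs
  have hRHS : Tendsto (fun t => C * m.toReal * |Y' t - Y t| ^ (2 / 3 : ℝ)) (𝓝[<] T)
      (𝓝 (C * m.toReal * |y' - y| ^ (2 / 3 : ℝ))) :=
    ((hYlim'.sub hYlim).abs.rpow_const (Or.inr (by norm_num))).const_mul _
  -- Both sides converge as t ↑ T along the two characteristics, so it is enough to have the Hölder
  -- inequality at times accumulating at T.
  refine le_of_tendsto_of_tendsto_of_frequently hLHS hRHS ((hfreq.and_eventually hev).mono ?_)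
  rintro t ⟨hnorm, ht, hb, hb'⟩
  have hgc : Continuous fun x => θ x * u t x := by
    refine hθc.mul ?_
    have := hu.cont.comp (f := fun x : Plane => (t, x)) (s := univ) (by fun_prop)
      fun x _ => ⟨ht, mem_univ _⟩
    exact continuousOn_univ.1 this
  obtain ⟨G, hG0, hGd, -, -, hGh⟩ := hC _ hgc (hnorm.trans_lt hm)
  have key : ∀ r, |r - (y - T)| < ρ → G 1 (planeMk r q) = dx1 u t (planeMk r q) := by
    intro r hr
    have hmem : planeMk r q ∈ Metric.ball (planeMk (y - T) q) ρ := by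
      rwa [mem_ball_iff_norm, norm_planeMk_sub]
    have d1 := hGd 0 one_pos (planeMk r q)
    rw [hG0] at d1
    have d2 : HasDerivAt (fun s : ℝ => u t (planeMk r q + s • e₁)) (dx1 u t (planeMk r q)) 0 :=
      (hu.diff_x t ht (planeMk r q)).hasLineDerivAt
    refine d1.unique (d2.congr_of_eventuallyEq ?_)
    have hc : ContinuousAt (fun s : ℝ => planeMk r q + s • e₁) 0 := by fun_prop
    have := hc.eventually (Metric.isOpen_ball.mem_nhds (by simpa using hmem))
    filter_upwards [this] with s hs
    rw [hθ _ hs, one_mul]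
  obtain ⟨a1, a2, a3⟩ := hY t ht
  obtain ⟨b1, b2, b3⟩ := hY' t ht
  have f1 := key _ hb
  have f2 := key _ hb'
  rw [hux t ht, hED.eul_apply S H ht a1 (by linarith [E.y_lt]) a3] at f1
  rw [hux t ht, hED.eul_apply S H ht b1 (by linarith) b3] at f2
  have f3 := hGh (planeMk (Y' t - t) q) (planeMk (Y t - t) q)
  rw [f1, f2, norm_planeMk_sub] at f3
  have e : Y' t - t - (Y t - t) = Y' t - Y t := by ring
  rw [e] at f3
  refine f3.trans ?_
  gcongr
  exact hm.ne

/-- The Sobolev norm of the solution tends to infinity at the focusing time. -/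
theorem tendsto_sobolevNorm (E : FocusPoint Z V J h h₁ c T q y ξ) (hF : SourceBound F C)
    (hD : DataBound u₀ v₀ v₀' M) (S : LagrangeSol F u₀ v₀ v₀' Z V J P U)
    (hu₀ : ∀ p : ℝ × ℝ, HasDerivAt (fun x => u₀ (p.1, x)) (u₀' p) p.2)
    (hu₀' : ∀ p : ℝ × ℝ, HasDerivAt (fun x => u₀' (p.1, x)) (u₀'' p) p.2)
    (hcu' : Continuous u₀') (hcu'' : Continuous u₀'') {A : ℝ} (hA0 : 0 ≤ A)
    (hA : ∀ δ ∈ Icc (0 : ℝ) 1, |v₀' (q, ξ + δ) - v₀' (q, ξ)| ≤ A * δ ^ (3 / 4 : ℝ))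
    {u : ℝ → Plane → ℝ} (hu : IsC1 T u) (hux : ∀ t ∈ Ico 0 T, ∀ x, dx1 u t x =
      eul Z h h₁ (fun p => LagrangeSol.lagN F u₀' v₀ Z V J U p + 1 / 2 * V p) t x)
    {θ : Plane → ℝ} (hθc : Continuous θ) {ρ : ℝ} (hρ : 0 < ρ)
    (hθ : ∀ x ∈ Metric.ball (planeMk (y - T) q) ρ, θ x = 1) :
    Tendsto (fun t => sobolevNorm (11 / 4) (fun x => θ x * u t x)) (𝓝[<] T) (𝓝 ⊤) := by
  set H : ℝ × ℝ × ℝ → ℝ := fun p => LagrangeSol.lagN F u₀' v₀ Z V J U p + 1 / 2 * V p with hHdef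
  have hNc := S.continuous_lagN hF hcu' hD.cont_v
  have hVc := S.cont_V
  have hH : Continuous H := by fun_prop
  obtain ⟨N', hN'c, hN'⟩ := S.exists_lagN_y hF hD hu₀ hu₀' hcu' hcu''
  have hsrc := S.continuous_source hF
  set H' : ℝ × ℝ × ℝ → ℝ := fun p => N' p + 1 / 2 * -F (p.1, p.2.1, Z p, U p, V p) with hH'def
  have hH'c : Continuous H' := hN'c.add (continuous_const.mul hsrc.neg)
  have hHy : ∀ r x, HasDerivAt (fun r => H (q, r, x)) (H' (q, r, x)) r := fun r x =>
    (hN' q r x).add ((S.V_y q r x).const_mul (1 / 2))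
  -- This is the label derivative of u_{x₁} at the focusing point, where the term with J drops out;
  -- it is nonzero as P ≠ 0 and V < 1.
  set w := 1 / 2 * (P (q, y, ξ) * (1 - V (q, y, ξ))) with hw
  have hHξ : HasDerivAt (fun x => H (q, y, x)) w ξ := by
    refine ((S.lagN_ξ hF u₀' q y ξ).add ((S.V_ξ q y ξ).const_mul (1 / 2))).congr_deriv ?_
    rw [E.J_eq, hw]
    ring
  have hw0 : 0 < |w| := by
    rw [abs_pos, hw]
    have h1 := E.V_le (q, y, ξ) (by simp only; linarith [E.h₁_pos, E.lt_y]) E.y_lt.le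
    have h2 : 1 - V (q, y, ξ) ≠ 0 := by
      have := E.c_pos
      intro h
      linarith
    exact mul_ne_zero (by norm_num) (mul_ne_zero (E.P_ne_zero hF S) h2)
  obtain ⟨B, hB⟩ := (isCompact_Icc.prod isCompact_Icc : IsCompact (Icc (y - 1) (y + 1) ×ˢ
    Icc ξ (ξ + 1))).exists_bound_of_continuousOn (f := fun p : ℝ × ℝ => H' (q, p.1, p.2))
    (hH'c.comp (by fun_prop : Continuous fun p : ℝ × ℝ => (q, p.1, p.2))).continuousOn
  have hB0 : 0 ≤ B := (norm_nonneg _).trans (hB (y, ξ) ⟨by simp, by simp⟩)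
  obtain ⟨A', hA'0, η, hη, hnear⟩ := E.exists_near hF hD S hu₀ hcu' hA0 hA
  rw [ENNReal.tendsto_nhds_top_iff_nnreal]
  intro m
  by_contra hcon
  have hfreq : ∃ᶠ t in 𝓝[<] T, sobolevNorm (11 / 4) (fun x => θ x * u t x) ≤ m :=
    (Filter.not_eventually.1 hcon).mono fun t ht => not_lt.1 ht
  obtain ⟨L, hL0, hL⟩ := E.exists_holder_of_frequently S hH hu hux hθc hθ ENNReal.coe_lt_top hfreq
  have hdiff : ∀ᶠ δ in 𝓝[>] (0 : ℝ), |w| / 2 * δ ≤ |H (q, y, ξ + δ) - H (q, y, ξ)| := by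
    have h1 := hasDerivAt_iff_isLittleO_nhds_zero.1 hHξ
    have h2 := (h1.def (half_pos hw0)).filter_mono (nhdsWithin_le_nhds (s := Ioi 0))
    filter_upwards [h2, self_mem_nhdsWithin] with δ hδ hδ0
    have hδ0' : 0 < δ := hδ0
    rw [Real.norm_eq_abs, Real.norm_eq_abs, abs_of_pos hδ0', smul_eq_mul] at hδ
    have h3 := abs_sub_abs_le_abs_sub (δ * w) (H (q, y, ξ + δ) - H (q, y, ξ))
    rw [abs_sub_comm (δ * w), abs_mul, abs_of_pos hδ0'] at h3
    linarith
  have hsmall : ∀ (e : ℝ), 0 < e → ∀ K : ℝ, ∀ k : ℝ, 0 < k →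
      ∀ᶠ δ in 𝓝[>] (0 : ℝ), K * δ ^ e < k := by
    intro e he K k hk
    have h1 : ContinuousAt (fun δ : ℝ => K * δ ^ e) 0 :=
      continuousAt_const.mul (Real.continuousAt_rpow_const _ _ (Or.inr he.le))
    have h2 := h1.tendsto.mono_left (nhdsWithin_le_nhds (s := Ioi 0))
    simp only [Real.zero_rpow he.ne', mul_zero] at h2
    exact h2.eventually (gt_mem_nhds hk)
  -- The change |w|δ/2 would be at most L(A'δ^(7/4))^(2/3) + BA'δ^(7/4), where the second term
  -- accounts for comparing the labels at y' instead of y. The exponents 7/6 and 7/4 exceed 1, which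
  -- is impossible for small δ.
  have hfin : ∀ᶠ δ in 𝓝[>] (0 : ℝ), False := by
    filter_upwards [hdiff, Ioo_mem_nhdsGT (lt_min hη one_pos),
      hsmall (7 / 4) (by norm_num) A' (min ρ 1) (by positivity),
      hsmall (1 / 6) (by norm_num) (L * A' ^ (2 / 3 : ℝ)) (|w| / 4) (by positivity),
      hsmall (3 / 4) (by norm_num) (B * A') (|w| / 4) (by positivity)] with δ g1 g2 g3 g4 g5
    have hδ0 : 0 < δ := g2.1
    have hδ1 : δ < 1 := g2.2.trans_le (min_le_right _ _)
    obtain ⟨y', hy1, hy2, hy3, hy4⟩ := hnear δ ⟨hδ0, g2.2.trans_le (min_le_left _ _)⟩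
    have i1 := hL y' (ξ + δ) ((hy1.trans_lt g3).trans_le (min_le_left _ _)) hy2 hy3 hy4
    have hy'1 : |y' - y| ≤ 1 := (hy1.trans g3.le).trans (min_le_right _ _)
    have i2 : |H (q, y', ξ + δ) - H (q, y, ξ + δ)| ≤ B * |y' - y| := by
      refine (convex_Icc (y - 1) (y + 1)).norm_image_sub_le_of_norm_hasDerivWithin_le
        (f := fun r => H (q, r, ξ + δ)) (fun r _ => (hHy r (ξ + δ)).hasDerivWithinAt)
        (fun r hr => hB (r, ξ + δ) ⟨hr, by constructor <;> simp only <;> linarith⟩)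
        ⟨by linarith, by linarith⟩ ?_
      rw [abs_le] at hy'1
      constructor <;> linarith [hy'1.1, hy'1.2]
    have i3 : |H (q, y, ξ + δ) - H (q, y, ξ)| ≤
        |H (q, y', ξ + δ) - H (q, y, ξ)| + |H (q, y', ξ + δ) - H (q, y, ξ + δ)| := by
      have := abs_sub (H (q, y', ξ + δ) - H (q, y, ξ)) (H (q, y', ξ + δ) - H (q, y, ξ + δ))
      rwa [sub_sub_sub_cancel_left] at this
    have i4 : |y' - y| ^ (2 / 3 : ℝ) ≤ A' ^ (2 / 3 : ℝ) * (δ ^ (1 / 6 : ℝ) * δ) := by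
      refine (Real.rpow_le_rpow (abs_nonneg _) hy1 (by norm_num)).trans (le_of_eq ?_)
      rw [Real.mul_rpow hA'0 (by positivity), ← Real.rpow_mul hδ0.le, ← Real.rpow_add_one hδ0.ne']
      norm_num
    have i5 : δ ^ (7 / 4 : ℝ) = δ ^ (3 / 4 : ℝ) * δ := by
      rw [← Real.rpow_add_one hδ0.ne']
      norm_num
    have i6 : L * |y' - y| ^ (2 / 3 : ℝ) ≤ L * A' ^ (2 / 3 : ℝ) * δ ^ (1 / 6 : ℝ) * δ := by
      calc _ ≤ L * (A' ^ (2 / 3 : ℝ) * (δ ^ (1 / 6 : ℝ) * δ)) := by gcongr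
        _ = _ := by ring
    have i7 : B * |y' - y| ≤ B * A' * δ ^ (3 / 4 : ℝ) * δ := by
      calc _ ≤ B * (A' * (δ ^ (3 / 4 : ℝ) * δ)) := by rw [← i5]; gcongr
        _ = _ := by ring
    have i8 : L * A' ^ (2 / 3 : ℝ) * δ ^ (1 / 6 : ℝ) * δ < |w| / 4 * δ := by gcongr
    have i9 : B * A' * δ ^ (3 / 4 : ℝ) * δ < |w| / 4 * δ := by gcongr
    linarith
  exact hfin.exists.choose_spec

end FocusPoint

/-! ### Blow-up for given bounds on the data -/

-- The constants are kept apart: M₀ bounds the data off K and restricts h, while M₁ and A describe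
-- the label where focusing is forced. The global bound M, which degenerates with the cutoff, enters
-- no smallness condition, so all conditions can be met uniformly in ε.
open EulerDomain in
theorem exists_blowup {f : ℝ × Plane × ℝ × ℝ → ℝ} {C M κ h M₀ M₁ A q₁ ξ₁ : ℝ}
    {a b : Plane → ℝ} {u₀ u₀' u₀'' v₀ v₀' : ℝ × ℝ → ℝ}
    (hF : SourceBound (charSource f) C) (hf : ∀ p, |f p| ≤ C)
    (hfl : ∀ t x r s r' s', |f (t, x, r, s) - f (t, x, r', s')| ≤ C * max |r - r'| |s - s'|)
    (hD : DataBound u₀ v₀ v₀' M)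
    (hu₀ : ∀ p : ℝ × ℝ, HasDerivAt (fun x => u₀ (p.1, x)) (u₀' p) p.2)
    (hu₀' : ∀ p : ℝ × ℝ, HasDerivAt (fun x => u₀' (p.1, x)) (u₀'' p) p.2)
    (hcu' : Continuous u₀') (hcu'' : Continuous u₀'')
    (hHolder : ∀ q ξ, ∃ B ≥ 0, ∀ δ ∈ Icc (0 : ℝ) 1,
      |v₀' (q, ξ + δ) - v₀' (q, ξ)| ≤ B * δ ^ (3 / 4 : ℝ))
    (ha : ∀ x : Plane, a x = u₀ (x 1, x 0))
    (hb : ∀ x : Plane, b x = u₀' (x 1, x 0) - v₀ (x 1, x 0))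
    (h0 : ∀ x, lineDeriv ℝ a x (EuclideanSpace.single 0 1) - b x ≤ κ)
    (hκ : κ < 1) (hv : ∀ p, v₀ p ≤ κ) (hh : 0 < h) (hh1 : h ≤ 1) (hCh : C * h ≤ (1 - κ) / 2)
    (hsmall : (1 + C * (2 + M₀ + C)) * ((1 + M₀ + C) *
      Real.exp (1 + C * (2 + M₀ + C))) * h < 1 - κ)
    {K : Set (ℝ × ℝ)} (hK : IsCompact K) (hout : ∀ p ∉ K, |v₀ p| ≤ M₀ ∧ |v₀' p| ≤ M₀)
    (hlab : |v₀ (q₁, ξ₁)| ≤ M₁) (hA : 1 + M₁ ≤ A)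
    (hP : v₀' (q₁, ξ₁) + charSource f (q₁, ξ₁, ξ₁, u₀ (q₁, ξ₁), v₀ (q₁, ξ₁)) = -A)
    (hs₁ : 2 * ((1 + C * (2 + M₁ + C)) * Real.exp (1 + C * (2 + M₁ + C))) *
      (2 * (1 + M₁) / A) ≤ 1) (hs₂ : 2 * (1 + M₁) / A ≤ h)
    (hs₃ : (1 + M₁ + C) * (2 * (1 + M₁) / A) < (1 - κ) / 4 * h)
    (hs₄ : 2 * (C + 1) * ((1 + M₁ + C) * (2 * (1 + M₁) / A)) ≤ 3 / 4 * (1 - κ) ^ 2) :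
    ∃ T u, 0 < T ∧ T ≤ (1 + M₁ + C) * (2 * (1 + M₁) / A) ∧ IsClassicalSolution f a b T u ∧
      (∀ w, IsClassicalSolution f a b T w → ∀ t ∈ Ico 0 T, w t = u t) ∧
      Tendsto (fun t => sobolevNorm (11 / 4) (u t)) (𝓝[<] T) (𝓝 ⊤) ∧
      ∃ θ : Plane → ℝ, ContDiff ℝ ∞ θ ∧ HasCompactSupport θ ∧
        Tendsto (fun t => sobolevNorm (11 / 4) (fun x => θ x * u t x)) (𝓝[<] T) (𝓝 ⊤) := by
  have hC := hF.nonneg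
  have hM₁0 : 0 ≤ M₁ := (abs_nonneg _).trans hlab
  have hA0 : 0 < A := by linarith
  obtain ⟨Z, V, J, P, U, S⟩ := exists_lagrangeSol hF hD
  obtain ⟨hJ₁, ht₁⟩ := S.exists_J_nonpos hF hlab hA (by rw [S.P_diag, hP]) hs₁
  have hs0 : 0 ≤ 2 * (1 + M₁) / A := by positivity
  obtain ⟨h₁, T, q, y, ξ, E, hT⟩ := S.exists_focusPoint hF hD hκ hv hh hCh hK
    (fun q ξ y hp hy => S.J_pos_of_small hF hh1 hsmall hy (hv _) (hout _ hp).1 (hout _ hp).2)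
    (by linarith) (by linarith) hJ₁ (ht₁.trans_lt hs₃)
  have hT' := hT.trans ht₁
  have hED := E.toEulerDomain
  obtain ⟨hsol, hux⟩ := hED.isClassicalSolution_eul hF hD S hu₀ hu₀' hcu' hcu'' ha hb
  obtain ⟨B, hB0, hB⟩ := hHolder q ξ
  refine ⟨T, eul Z h h₁ U, hED.T_pos, hT', hsol, fun w hw t ht => ?_, ?_, ?_⟩
  · refine hsol.unique hw hκ h0 hf hfl (le_trans ?_ hs₄) ht
    gcongr
  -- θ = 1 gives the global norm; below, a bump centred at the spatial focusing point (y − T, q)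
  -- gives the local one.
  · have := E.tendsto_sobolevNorm hF hD S hu₀ hu₀' hcu' hcu'' hB0 hB hsol.c1 hux
      (θ := fun _ => 1) continuous_const one_pos (fun _ _ => rfl)
    simpa using this
  · let θ : ContDiffBump (planeMk (y - T) q) := ⟨1, 2, one_pos, one_lt_two⟩
    exact ⟨θ, θ.contDiff, θ.hasCompactSupport, E.tendsto_sobolevNorm hF hD S hu₀ hu₀' hcu' hcu''
      hB0 hB hsol.c1 hux θ.continuous one_pos
      fun x hx => θ.one_of_mem_closedBall (Metric.ball_subset_closedBall hx)⟩

/-! ### The hypotheses on the source and the data -/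

theorem sobolevNorm_mono {s s' : ℝ} (h : s ≤ s') (g : Plane → ℝ) :
    sobolevNorm s g ≤ sobolevNorm s' g := by
  unfold sobolevNorm
  split_ifs with hg
  · refine eLpNorm_mono fun ξ => ?_
    rw [norm_mul, norm_mul]
    gcongr
    rw [Complex.norm_real, Complex.norm_real, Real.norm_of_nonneg (by positivity),
      Real.norm_of_nonneg (by positivity)]
    exact Real.rpow_le_rpow_of_exponent_le (by nlinarith [norm_nonneg ξ]) (by linarith)
  · exact le_rfl

/-- The linear change of variables in `charSource`. -/
noncomputable def charMap : (ℝ × ℝ × ℝ × ℝ × ℝ) →L[ℝ] ℝ × Plane × ℝ × ℝ :=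
  LinearMap.toContinuousLinearMap
    { toFun := fun p => ((p.2.1 - p.2.2.1) / 2, EulerDomain.planeMk ((p.2.1 + p.2.2.1) / 2) p.1,
        p.2.2.2.1, p.2.2.2.2)
      map_add' := fun p p' => by
        refine Prod.ext ?_ (Prod.ext ?_ rfl)
        · simp only [Prod.fst_add, Prod.snd_add]
          ring
        · ext i
          fin_cases i
          · simp [EulerDomain.planeMk]
            ring
          · simp [EulerDomain.planeMk]
      map_smul' := fun r p => by
        refine Prod.ext ?_ (Prod.ext ?_ rfl)
        · simp only [Prod.smul_fst, Prod.smul_snd, smul_eq_mul, RingHom.id_apply]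
          ring
        · ext i
          fin_cases i
          · simp [EulerDomain.planeMk]
            ring
          · simp [EulerDomain.planeMk] }

theorem exists_sourceBound {f : ℝ × Plane × ℝ × ℝ → ℝ} (hf : ContDiff ℝ ∞ f)
    (hf_bdd : ∀ k : ℕ, ∃ C : ℝ, ∀ p, ‖iteratedFDeriv ℝ k f p‖ ≤ C) :
    ∃ C, SourceBound (EulerDomain.charSource f) C ∧ (∀ p, |f p| ≤ C) ∧
      ∀ t x r s r' s', |f (t, x, r, s) - f (t, x, r', s')| ≤ C * max |r - r'| |s - s'| := by
  obtain ⟨C₀, h₀⟩ := hf_bdd 0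
  obtain ⟨C₁, h₁⟩ := hf_bdd 1
  obtain ⟨C₂, h₂⟩ := hf_bdd 2
  simp only [norm_iteratedFDeriv_zero, Real.norm_eq_abs] at h₀
  simp only [norm_iteratedFDeriv_one] at h₁
  have h₂' : ∀ p, ‖fderiv ℝ (fderiv ℝ f) p‖ ≤ C₂ := fun p => by
    have := norm_iteratedFDeriv_fderiv (𝕜 := ℝ) (f := f) (x := p) (n := 1)
    rw [norm_iteratedFDeriv_one] at this
    rw [this]
    exact h₂ p
  have hC₀ : 0 ≤ C₀ := (abs_nonneg _).trans (h₀ 0)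
  have hC₁ : 0 ≤ C₁ := (norm_nonneg _).trans (h₁ 0)
  have hC₂ : 0 ≤ C₂ := (norm_nonneg _).trans (h₂ 0)
  have hd : Differentiable ℝ f := hf.differentiable (by simp)
  have hd' : Differentiable ℝ (fderiv ℝ f) :=
    (hf.fderiv_right (m := 1) (by norm_cast)).differentiable (by simp)
  have hfd : ∀ p, HasFDerivAt (EulerDomain.charSource f)
      ((1 / 2 : ℝ) • (fderiv ℝ f (charMap p)).comp charMap) p := fun p => by
    have h1 : HasFDerivAt (fun p => f (charMap p)) _ p :=
      (hd (charMap p)).hasFDerivAt.comp p charMap.hasFDerivAt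
    exact h1.const_smul (1 / 2 : ℝ)
  set ℓ := ‖charMap‖ with hℓ
  have hℓ0 : 0 ≤ ℓ := norm_nonneg _
  have n3 : 0 ≤ C₁ * ℓ := by positivity
  have n4 : 0 ≤ C₂ * ℓ * ℓ := by positivity
  refine ⟨C₀ + C₁ + C₁ * ℓ + C₂ * ℓ * ℓ, ⟨fun p => (hfd p).differentiableAt, fun p => ?_,
    fun p => ?_, fun p p' => ?_⟩, fun p => ?_, fun t x r s r' s' => ?_⟩
  · have : |EulerDomain.charSource f p| = 1 / 2 * |f (charMap p)| := by
      show |1 / 2 * f (charMap p)| = _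
      rw [abs_mul, abs_of_pos (by norm_num : (0 : ℝ) < 1 / 2)]
    rw [this]
    linarith [h₀ (charMap p), abs_nonneg (f (charMap p))]
  · rw [(hfd p).fderiv, norm_smul]
    have h1 : ‖(fderiv ℝ f (charMap p)).comp charMap‖ ≤ C₁ * ℓ :=
      (ContinuousLinearMap.opNorm_comp_le _ _).trans (by gcongr; exact h₁ _)
    have h2 : ‖(1 / 2 : ℝ)‖ = 1 / 2 := by norm_num
    rw [h2]
    linarith
  · have e : fderiv ℝ (EulerDomain.charSource f) p - fderiv ℝ (EulerDomain.charSource f) p' =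
        (1 / 2 : ℝ) • (fderiv ℝ f (charMap p) - fderiv ℝ f (charMap p')).comp charMap := by
      rw [(hfd p).fderiv, (hfd p').fderiv]
      refine ContinuousLinearMap.ext fun w => ?_
      simp only [sub_apply, smul_apply,
        ContinuousLinearMap.comp_apply, smul_eq_mul]
      ring
    rw [e, norm_smul]
    have h0 : ‖fderiv ℝ f (charMap p) - fderiv ℝ f (charMap p')‖ ≤ C₂ * (ℓ * ‖p - p'‖) := by
      refine (convex_univ.norm_image_sub_le_of_norm_fderiv_le (fun x _ => hd' x)
        (fun x _ => h₂' x) (mem_univ (charMap p')) (mem_univ (charMap p))).trans ?_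
      gcongr
      rw [← map_sub]
      exact charMap.le_opNorm _
    have h1 : ‖(fderiv ℝ f (charMap p) - fderiv ℝ f (charMap p')).comp charMap‖ ≤
        C₂ * (ℓ * ‖p - p'‖) * ℓ :=
      (ContinuousLinearMap.opNorm_comp_le _ _).trans (by gcongr)
    have h2 : ‖(1 / 2 : ℝ)‖ = 1 / 2 := by norm_num
    rw [h2]
    have h3 : 0 ≤ (C₀ + C₁ + C₁ * ℓ) * ‖p - p'‖ := by positivity
    have h4 : 0 ≤ C₂ * (ℓ * ‖p - p'‖) * ℓ := by positivity
    nlinarith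
  · linarith [h₀ p]
  · have h1 : |f (t, x, r, s) - f (t, x, r', s')| ≤
        C₁ * ‖(t, x, r, s) - (t, x, r', s')‖ :=
      convex_univ.norm_image_sub_le_of_norm_fderiv_le (fun x _ => hd x) (fun x _ => h₁ x)
        (mem_univ _) (mem_univ _)
    have h2 : ‖(t, x, r, s) - (t, x, r', s')‖ = max |r - r'| |s - s'| := by
      simp [Prod.norm_def]
    rw [h2] at h1
    refine h1.trans ?_
    gcongr
    linarith

/-! ### The initial data -/

open EulerDomain (planeMk planeMk_eq_add planeMk_coord norm_planeMk_sub charSource)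

theorem continuous_planeMk : Continuous fun p : ℝ × ℝ => planeMk p.2 p.1 := by
  refine (PiLp.continuous_toLp 2 _).comp (continuous_pi fun i => ?_)
  fin_cases i
  · exact continuous_snd
  · exact continuous_fst

theorem hasDerivAt_planeMk {g : Plane → ℝ} {d a q : ℝ}
    (hg : HasDerivAt (fun r : ℝ => g (planeMk a q + r • e₁)) d 0) :
    HasDerivAt (fun x => g (planeMk x q)) d a := by
  have h1 := HasDerivAt.comp (h₂ := fun r : ℝ => g (planeMk a q + r • e₁)) (h := fun x => x - a) a
    (by rwa [sub_self]) ((hasDerivAt_id a).sub_const a)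
  rw [mul_one] at h1
  refine h1.congr_of_eventuallyEq (Eventually.of_forall fun x => ?_)
  simp only [Function.comp, ← planeMk_eq_add]

theorem exists_deriv_of_hasCompactSupport {χ : Plane → ℝ} (h : ContDiff ℝ ∞ χ)
    (hc : HasCompactSupport χ) :
    ∃ (χ' : Plane → ℝ) (B : ℝ), Continuous χ' ∧ 0 ≤ B ∧
      (∀ x, HasDerivAt (fun r : ℝ => χ (x + r • e₁)) (χ' x) 0) ∧ (∀ x, |χ x| ≤ B) ∧
      (∀ x, |χ' x| ≤ B) ∧ (∀ x y, |χ' x - χ' y| ≤ B * ‖x - y‖) ∧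
      ∀ x ∉ tsupport χ, χ x = 0 ∧ χ' x = 0 := by
  have hχ' : ContDiff ℝ 1 fun x => fderiv ℝ χ x e₁ :=
    (h.fderiv_right (m := 1) (by norm_cast)).clm_apply contDiff_const
  have hc' : HasCompactSupport fun x => fderiv ℝ χ x e₁ :=
    (hc.fderiv (𝕜 := ℝ)).comp_left (g := fun L : Plane →L[ℝ] ℝ => L e₁) rfl
  obtain ⟨B₀, h₀⟩ := h.continuous.bounded_above_of_compact_support hc
  obtain ⟨B₁, h₁⟩ := hχ'.continuous.bounded_above_of_compact_support hc'
  obtain ⟨B₂, h₂⟩ := hχ'.lipschitzWith_of_hasCompactSupport hc' (by simp)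
  have hB₀ : 0 ≤ B₀ := (norm_nonneg _).trans (h₀ 0)
  have hB₁ : 0 ≤ B₁ := (norm_nonneg _).trans (h₁ 0)
  have hB₂ : (0 : ℝ) ≤ B₂ := B₂.2
  refine ⟨fun x => fderiv ℝ χ x e₁, B₀ + B₁ + B₂, hχ'.continuous, by positivity, fun x => ?_,
    fun x => (h₀ x).trans (by linarith), fun x => (h₁ x).trans (by linarith), fun x y => ?_,
    fun x hx => ⟨image_eq_zero_of_notMem_tsupport hx, ?_⟩⟩
  · exact ((h.differentiable (by simp)) x).hasFDerivAt.hasLineDerivAt e₁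
  · have := h₂.dist_le_mul x y
    rw [dist_eq_norm, dist_eq_norm] at this
    refine this.trans ?_
    gcongr
    linarith
  · have : fderiv ℝ χ x = 0 := by
      by_contra hne
      exact hx (support_fderiv_subset ℝ hne)
    simp [this]

/-- The behaviour of the data on the axis. -/
theorem IsDataFamily.axis {α δ : ℝ} {ψ : ℝ → ℝ → ℝ} {χ : ℝ → Plane → ℝ}
    (hχ : IsDataFamily α δ ψ χ) (hψ : IsCutoffFamily ψ) (hα : 0 < α) {ε : ℝ}
    (hε : ε ∈ Ioo (0 : ℝ) (1 / 2)) :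
    |χ ε (planeMk ε 0)| ≤ ε * |Real.log (ε / 2)| ^ α ∧
      HasDerivAt (fun r => χ ε (planeMk r 0)) (-|Real.log ε| ^ α) ε := by
  have hε0 : 0 < ε := hε.1
  -- Since ψ_ε = 0 on [0, ε/2], truncating the logarithm at ε/2 does not change the integrand on the
  -- interval considered, and it makes k continuous.
  set k : ℝ → ℝ := fun s => ψ ε s * |Real.log (max s (ε / 2))| ^ α with hk
  have hmax : ∀ s : ℝ, 0 < max s (ε / 2) := fun s => lt_max_of_lt_right (by linarith)
  have hkc : Continuous k := by
    refine (hψ.smooth ε hε0).continuous.mul (Continuous.rpow_const ?_ fun _ => Or.inr hα.le)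
    exact (Continuous.log (by fun_prop) fun s => (hmax s).ne').abs
  have hval : ∀ r ∈ Icc (0 : ℝ) (1 / 2), χ ε (planeMk r 0) = -∫ s in (0 : ℝ)..r, k s := by
    intro r hr
    have e0 : planeMk r 0 0 = r := rfl
    have e1 : planeMk r 0 1 = 0 := rfl
    have hmem : planeMk r 0 ∈ omegaZero δ := by
      refine ⟨⟨by rw [e0]; exact hr.1, ?_⟩, by rw [mem_ofPred_eq, e0, e1]; exact ⟨hr, by norm_num⟩⟩
      rw [e0, e1, abs_zero]
      positivity
    rw [hχ.eq_on ε hε _ hmem, e0]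
    congr 1
    refine intervalIntegral.integral_congr fun s hs => ?_
    rw [uIcc_of_le hr.1] at hs
    simp only [hk]
    rcases le_total s (ε / 2) with h | h
    · rw [hψ.eq_zero ε hε0 s ⟨hs.1, h⟩, zero_mul, zero_mul]
    · rw [max_eq_left h]
  constructor
  · rw [hval ε ⟨hε0.le, hε.2.le⟩, abs_neg]
    have := intervalIntegral.norm_integral_le_of_norm_le_const (a := 0) (b := ε) (f := k)
      (C := |Real.log (ε / 2)| ^ α) (fun s hs => by
        rw [uIoc_of_le hε0.le] at hs
        have h1 := hψ.mem_Icc ε hε0 s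
        have h2 : |Real.log (max s (ε / 2))| ≤ |Real.log (ε / 2)| := by
          have h3 : max s (ε / 2) ≤ 1 := max_le (by linarith [hs.2, hε.2]) (by linarith [hε.2])
          rw [abs_of_nonpos (Real.log_nonpos (hmax s).le h3),
            abs_of_nonpos (Real.log_nonpos (by linarith) (by linarith [hε.2]))]
          exact neg_le_neg (Real.log_le_log (by linarith) (le_max_right _ _))
        rw [Real.norm_eq_abs, hk, abs_mul, abs_of_nonneg h1.1, Real.abs_rpow_of_nonneg (abs_nonneg _),
          abs_abs]
        have h4 := Real.rpow_le_rpow (abs_nonneg _) h2 hα.le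
        have h5 : 0 ≤ |Real.log (max s (ε / 2))| ^ α := by positivity
        nlinarith [h1.1, h1.2])
    rw [sub_zero, abs_of_pos hε0, mul_comm] at this
    exact this
  · have h1 := (intervalIntegral.integral_hasDerivAt_right (hkc.intervalIntegrable 0 ε)
      (hkc.stronglyMeasurableAtFilter _ _) hkc.continuousAt).neg
    have h2 : k ε = |Real.log ε| ^ α := by
      simp only [hk]
      rw [hψ.eq_one ε hε0 ε le_rfl, one_mul, max_eq_left (by linarith)]
    rw [h2] at h1
    refine h1.congr_of_eventuallyEq ?_
    filter_upwards [Ioo_mem_nhds hε0 hε.2] with r hr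
    rw [hval r ⟨hr.1.le, hr.2.le⟩]
    rfl

/-- A power of the logarithm is o(1/s) as s → 0. This keeps χ_ε(ε, 0) bounded, so that v₀ at the
focusing label stays bounded while its derivative does not. -/
theorem eventually_mul_abs_log_rpow_le (α : ℝ) :
    ∀ᶠ ε in 𝓝[>] (0 : ℝ), ε * |Real.log (ε / 2)| ^ α ≤ 2 := by
  have h1 := (isLittleO_abs_log_rpow_rpow_nhdsGT_zero α (by norm_num : (-1 : ℝ) < 0)).def one_pos
  have h2 : Tendsto (fun ε : ℝ => ε / 2) (𝓝[>] 0) (𝓝[>] 0) := by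
    refine tendsto_nhdsWithin_iff.2 ⟨?_, ?_⟩
    · have : ContinuousAt (fun ε : ℝ => ε / 2) 0 := by fun_prop
      simpa using this.tendsto.mono_left (nhdsWithin_le_nhds (s := Ioi 0))
    · filter_upwards [self_mem_nhdsWithin] with ε hε
      exact half_pos (show (0 : ℝ) < ε from hε)
  filter_upwards [h2.eventually h1, self_mem_nhdsWithin] with ε hε hε0
  have hε0' : 0 < ε := hε0
  rw [Real.norm_of_nonneg (by positivity), Real.norm_of_nonneg (by positivity), one_mul,
    Real.rpow_neg_one] at hε
  calc ε * |Real.log (ε / 2)| ^ α ≤ ε * (ε / 2)⁻¹ := by gcongr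
    _ = 2 := by field_simp

theorem tendsto_abs_log_rpow_nhdsGT_zero {α : ℝ} (hα : 0 < α) :
    Tendsto (fun ε => |Real.log ε| ^ α) (𝓝[>] 0) atTop :=
  (tendsto_rpow_atTop hα).comp (tendsto_abs_atBot_atTop.comp Real.tendsto_log_nhdsGT_zero)

/-! ### Bounds uniform in the cutoff and conclusion -/

/-- Bounds of the non-singular part of the data, which do not depend on the cutoff. -/
structure RegularData (u₀ u₁ g₁ g₂ h₁ : Plane → ℝ) (M₀ : ℝ) : Prop where
  cont_u₀ : Continuous u₀
  cont_u₁ : Continuous u₁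
  cont_g₁ : Continuous g₁
  cont_g₂ : Continuous g₂
  cont_h₁ : Continuous h₁
  deriv_u₀ : ∀ x, HasDerivAt (fun r : ℝ => u₀ (x + r • e₁)) (g₁ x) 0
  deriv_g₁ : ∀ x, HasDerivAt (fun r : ℝ => g₁ (x + r • e₁)) (g₂ x) 0
  deriv_u₁ : ∀ x, HasDerivAt (fun r : ℝ => u₁ (x + r • e₁)) (h₁ x) 0
  bound : ∀ x, |g₁ x| + |u₁ x| ≤ M₀
  bound' : ∀ x, |g₂ x| + |h₁ x| ≤ M₀
  holder : ∀ x y, |g₂ x - g₂ y| + |h₁ x - h₁ y| ≤ M₀ * ‖x - y‖ ^ (3 / 4 : ℝ)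

/-- The exponent 3/4 is admissible since 2 + 3/4 < 4 − 1 for ũ₀ and 1 + 3/4 < 3 − 1 for ũ₁; it is
the Hölder exponent of v₀' that governs the focusing geometry. -/
theorem exists_regularData {u₀ u₁ : Plane → ℝ} (hu₀_cont : Continuous u₀)
    (hu₁_cont : Continuous u₁) (hu₀ : sobolevNorm 4 u₀ < ⊤) (hu₁ : sobolevNorm 3 u₁ < ⊤) :
    ∃ g₁ g₂ h₁ M₀, 0 ≤ M₀ ∧ RegularData u₀ u₁ g₁ g₂ h₁ M₀ := by
  obtain ⟨C, hC0, hC⟩ := exists_holder_of_sobolevNorm (s := 4) (γ := 3 / 4) 2 (by norm_num)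
    (by norm_num) (by norm_num)
  obtain ⟨C', hC'0, hC'⟩ := exists_holder_of_sobolevNorm (s := 3) (γ := 3 / 4) 1 (by norm_num)
    (by norm_num) (by norm_num)
  obtain ⟨G, hG0, hGd, hGc, hGb, hGh⟩ := hC u₀ hu₀_cont hu₀
  obtain ⟨H, hH0, hHd, hHc, hHb, hHh⟩ := hC' u₁ hu₁_cont hu₁
  refine ⟨G 1, G 2, H 1, C * (sobolevNorm 4 u₀).toReal + C' * (sobolevNorm 3 u₁).toReal,
    by positivity, hu₀_cont, hu₁_cont, hGc 1 (by norm_num), hGc 2 le_rfl, hHc 1 le_rfl,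
    fun x => ?_, fun x => hGd 1 (by norm_num) x, fun x => ?_, fun x => ?_, fun x => ?_,
    fun x y => ?_⟩
  · have := hGd 0 (by norm_num) x
    rwa [hG0] at this
  · have := hHd 0 (by norm_num) x
    rwa [hH0] at this
  · have h1 := hGb 1 (by norm_num) x
    have h2 := hHb 0 (by norm_num) x
    rw [hH0] at h2
    exact add_le_add h1 h2
  · exact add_le_add (hGb 2 le_rfl x) (hHb 1 le_rfl x)
  · rw [add_mul]
    exact add_le_add (hGh x y) (hHh x y)

/-- Blow-up for a given cutoff, with constants that do not depend on it. -/
theorem RegularData.exists_blowup {f : ℝ × Plane × ℝ × ℝ → ℝ} {C M₀ κ h L : ℝ}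
    {u₀ u₁ g₁ g₂ h₁ χ : Plane → ℝ} (D : RegularData u₀ u₁ g₁ g₂ h₁ M₀)
    (hF : SourceBound (charSource f) C) (hf : ∀ p, |f p| ≤ C)
    (hfl : ∀ t x r s r' s', |f (t, x, r, s) - f (t, x, r', s')| ≤ C * max |r - r'| |s - s'|)
    (hκ : κ < 1) (hh : 0 < h) (hh1 : h ≤ 1) (hCh : C * h ≤ (1 - κ) / 2)
    (hsmall : (1 + C * (2 + M₀ + C)) * ((1 + M₀ + C) *
      Real.exp (1 + C * (2 + M₀ + C))) * h < 1 - κ)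
    (hχ : ContDiff ℝ ∞ χ) (hχc : HasCompactSupport χ)
    (hyp : ∀ x, χ x + (lineDeriv ℝ u₀ x (EuclideanSpace.single 0 1) - u₁ x) ≤ κ)
    {ε : ℝ} (hε : |χ (planeMk ε 0)| ≤ 2) (hε' : HasDerivAt (fun r => χ (planeMk r 0)) (-L) ε)
    {M₁ B σ : ℝ} (hM₁ : M₁ = M₀ + 2) (hB : B = L - M₀ - C) (hσ : σ = 2 * (1 + M₁) / B)
    (hB₁ : 1 + M₁ ≤ B)
    (hs₁ : 2 * ((1 + C * (2 + M₁ + C)) * Real.exp (1 + C * (2 + M₁ + C))) * σ ≤ 1)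
    (hs₂ : σ ≤ h) (hs₃ : (1 + M₁ + C) * σ < (1 - κ) / 4 * h)
    (hs₄ : 2 * (C + 1) * ((1 + M₁ + C) * σ) ≤ 3 / 4 * (1 - κ) ^ 2) :
    ∃ T u, 0 < T ∧ T ≤ (1 + M₁ + C) * σ ∧
      IsClassicalSolution f u₀ (fun x => -χ x + u₁ x) T u ∧
      (∀ w, IsClassicalSolution f u₀ (fun x => -χ x + u₁ x) T w → ∀ t ∈ Ico 0 T, w t = u t) ∧
      Tendsto (fun t => sobolevNorm (11 / 4) (u t)) (𝓝[<] T) (𝓝 ⊤) ∧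
      ∃ θ : Plane → ℝ, ContDiff ℝ ∞ θ ∧ HasCompactSupport θ ∧
        Tendsto (fun t => sobolevNorm (11 / 4) (fun x => θ x * u t x)) (𝓝[<] T) (𝓝 ⊤) := by
  have hC := hF.nonneg
  obtain ⟨χ', Bχ, hχ'c, hBχ, hχ'd, hχb, hχ'b, hχ'l, hχs⟩ := exists_deriv_of_hasCompactSupport hχ hχc
  have hM₀ : 0 ≤ M₀ := (by positivity : 0 ≤ |g₁ 0| + |u₁ 0|).trans (D.bound 0)
  have hpc := continuous_planeMk
  have hlin : ∀ x, lineDeriv ℝ u₀ x (EuclideanSpace.single 0 1) = g₁ x := fun x =>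
    HasLineDerivAt.lineDeriv (D.deriv_u₀ x)
  set v₀ : ℝ × ℝ → ℝ := fun p =>
    g₁ (planeMk p.2 p.1) + χ (planeMk p.2 p.1) - u₁ (planeMk p.2 p.1) with hv₀
  set v₀' : ℝ × ℝ → ℝ := fun p =>
    g₂ (planeMk p.2 p.1) + χ' (planeMk p.2 p.1) - h₁ (planeMk p.2 p.1) with hv₀'
  have three : ∀ a b c : ℝ, |a + b - c| ≤ |a| + |c| + |b| := fun a b c => by
    have e1 := abs_sub (a + b) c
    have e2 := abs_add_le a b
    linarith
  have hD : DataBound (fun p => u₀ (planeMk p.2 p.1)) v₀ v₀' (M₀ + Bχ) := by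
    refine ⟨D.cont_u₀.comp hpc, ?_, ?_, fun p => ?_, fun p => ?_, fun p => ?_⟩
    · exact ((D.cont_g₁.comp hpc).add (hχ.continuous.comp hpc)).sub (D.cont_u₁.comp hpc)
    · exact ((D.cont_g₂.comp hpc).add (hχ'c.comp hpc)).sub (D.cont_h₁.comp hpc)
    · exact ((hasDerivAt_planeMk (D.deriv_g₁ _)).add (hasDerivAt_planeMk (hχ'd _))).sub
        (hasDerivAt_planeMk (D.deriv_u₁ _))
    · exact (three _ _ _).trans (add_le_add (D.bound _) (hχb _))
    · exact (three _ _ _).trans (add_le_add (D.bound' _) (hχ'b _))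
  have hv : ∀ p, v₀ p ≤ κ := fun p => by
    have := hyp (planeMk p.2 p.1)
    rw [hlin] at this
    simp only [hv₀]
    linarith
  have hχε : χ' (planeMk ε 0) = -L := (hasDerivAt_planeMk (hχ'd _)).unique hε'
  have hcoord : ∀ x : Plane, planeMk (x 0) (x 1) = x := planeMk_coord
  -- −A is the diagonal value of P at the label ε on the axis. There χ' contributes −L, and the
  -- other terms are at most M₀ + C in total, whence B ≤ A.
  set A := -(v₀' (0, ε) + charSource f (0, ε, ε, u₀ (planeMk ε 0), v₀ (0, ε))) with hA
  have hBA : B ≤ A := by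
    have e1 := (abs_le.1 (hF.bound (0, ε, ε, u₀ (planeMk ε 0), v₀ (0, ε)))).2
    have e2 := D.bound' (planeMk ε 0)
    have e3 := le_abs_self (g₂ (planeMk ε 0))
    have e4 := neg_abs_le (h₁ (planeMk ε 0))
    rw [hA]
    simp only [hv₀', hχε]
    linarith
  have hM₁0 : 0 ≤ M₁ := by linarith
  have hB0 : 0 < B := by linarith
  have hAσ : 2 * (1 + M₁) / A ≤ σ := by
    rw [hσ]
    gcongr
  have hCσ : (1 + M₁ + C) * (2 * (1 + M₁) / A) ≤ (1 + M₁ + C) * σ := by gcongr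
  have hHol : ∀ q ξ, ∃ B ≥ 0, ∀ δ ∈ Icc (0 : ℝ) 1,
      |v₀' (q, ξ + δ) - v₀' (q, ξ)| ≤ B * δ ^ (3 / 4 : ℝ) := by
    refine fun q ξ => ⟨M₀ + Bχ, by positivity, fun δ hδ => ?_⟩
    have e1 := D.holder (planeMk (ξ + δ) q) (planeMk ξ q)
    have e2 := hχ'l (planeMk (ξ + δ) q) (planeMk ξ q)
    rw [norm_planeMk_sub, add_sub_cancel_left, abs_of_nonneg hδ.1] at e1 e2
    have e3 : δ ≤ δ ^ (3 / 4 : ℝ) := by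
      have := Real.rpow_le_rpow_of_exponent_ge' hδ.1 hδ.2 (by norm_num)
        (by norm_num : (3 / 4 : ℝ) ≤ 1)
      rwa [Real.rpow_one] at this
    have e4 : Bχ * δ ≤ Bχ * δ ^ (3 / 4 : ℝ) := by gcongr
    have e5 := three (g₂ (planeMk (ξ + δ) q) - g₂ (planeMk ξ q))
      (χ' (planeMk (ξ + δ) q) - χ' (planeMk ξ q)) (h₁ (planeMk (ξ + δ) q) - h₁ (planeMk ξ q))
    have e6 : v₀' (q, ξ + δ) - v₀' (q, ξ) = (g₂ (planeMk (ξ + δ) q) - g₂ (planeMk ξ q)) +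
      (χ' (planeMk (ξ + δ) q) - χ' (planeMk ξ q)) -
        (h₁ (planeMk (ξ + δ) q) - h₁ (planeMk ξ q)) := by
      simp only [hv₀']
      ring
    rw [e6, add_mul]
    linarith
  have hout : ∀ p ∉ (fun x : Plane => (x 1, x 0)) '' tsupport χ, |v₀ p| ≤ M₀ ∧ |v₀' p| ≤ M₀ := by
    intro p hp
    have hp' : planeMk p.2 p.1 ∉ tsupport χ := fun hmem => hp ⟨_, hmem, rfl⟩
    obtain ⟨e1, e2⟩ := hχs _ hp'
    constructor
    · have := three (g₁ (planeMk p.2 p.1)) (χ (planeMk p.2 p.1)) (u₁ (planeMk p.2 p.1))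
      simp only [e1, abs_zero, add_zero] at this
      simp only [hv₀, e1, add_zero]
      exact this.trans (D.bound _)
    · have := three (g₂ (planeMk p.2 p.1)) (χ' (planeMk p.2 p.1)) (h₁ (planeMk p.2 p.1))
      simp only [e2, abs_zero, add_zero] at this
      simp only [hv₀', e2, add_zero]
      exact this.trans (D.bound' _)
  have hlab : |v₀ (0, ε)| ≤ M₁ := by
    rw [hM₁]
    exact (three _ _ _).trans (add_le_add (D.bound _) hε)
  obtain ⟨T, u, hT, hTle, hrest⟩ := _root_.exists_blowup (q₁ := 0) (ξ₁ := ε) (M₀ := M₀) (M₁ := M₁)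
    (A := A) (κ := κ) (h := h) (a := u₀) (b := fun x => -χ x + u₁ x)
    (u₀' := fun p => g₁ (planeMk p.2 p.1)) (u₀'' := fun p => g₂ (planeMk p.2 p.1))
    (K := (fun x : Plane => (x 1, x 0)) '' tsupport χ) hF hf hfl hD
    (fun p => hasDerivAt_planeMk (D.deriv_u₀ _)) (fun p => hasDerivAt_planeMk (D.deriv_g₁ _))
    (D.cont_g₁.comp hpc) (D.cont_g₂.comp hpc)
    hHol
    (fun x => by simp only [hcoord]) (fun x => by simp only [hv₀, hcoord]; ring)
    (fun x => by have := hyp x; linarith) hκ hv hh hh1 hCh hsmall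
    (hχc.isCompact.image (by fun_prop)) hout
    hlab (hB₁.trans hBA) (by rw [hA]; ring) (le_trans (by gcongr) hs₁) (hAσ.trans hs₂) (hCσ.trans_lt hs₃)
    (le_trans (by gcongr) hs₄)
  exact ⟨T, u, hT, hTle.trans hCσ, hrest⟩

/-- The order of choices matters: C and M₀ come from f and the fixed data, h from these alone, and
only then ε₀, so small that B(ε) = |ln ε|^α − M₀ − C is large and σ = 2(1 + M₁)/B is small compared
with h. The blow-up times lie between 0 and (1 + M₁ + C)σ, hence tend to 0. -/
theorem mainTheorem3
    (f : ℝ × Plane × ℝ × ℝ → ℝ) (hf : ContDiff ℝ ∞ f)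
    (hf_bdd : ∀ k : ℕ, ∃ C : ℝ, ∀ p, ‖iteratedFDeriv ℝ k f p‖ ≤ C)
    (α δ : ℝ) (hα : 0 < α) (hδ : 0 < δ)
    (ψ : ℝ → ℝ → ℝ) (hψ : IsCutoffFamily ψ)
    (χ : ℝ → Plane → ℝ) (hχ : IsDataFamily α δ ψ χ)
    (u₀ u₁ : Plane → ℝ) (hu₀_cont : Continuous u₀) (hu₁_cont : Continuous u₁)
    (hu₀ : sobolevNorm 4 u₀ < ⊤) (hu₁ : sobolevNorm 3 u₁ < ⊤)
    (κ : ℝ) (hκ : κ < 1)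
    (hyp : ∀ ε ∈ Set.Ioo (0 : ℝ) (1 / 2), ∀ x : Plane,
      χ ε x + (lineDeriv ℝ u₀ x (EuclideanSpace.single 0 1) - u₁ x) ≤ κ) :
    ∃ ε₀ > 0, ∃ tt : ℝ → ℝ, Tendsto tt (𝓝[>] 0) (𝓝 0) ∧
      ∀ ε ∈ Set.Ioo 0 (min ε₀ (1 / 2)), 0 < tt ε ∧
        ∃ u : ℝ → Plane → ℝ,
          IsClassicalSolution f u₀ (fun x => -χ ε x + u₁ x) (tt ε) u ∧
          (∀ w : ℝ → Plane → ℝ,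
            IsClassicalSolution f u₀ (fun x => -χ ε x + u₁ x) (tt ε) w →
              ∀ t ∈ Set.Ico 0 (tt ε), w t = u t) ∧
          sobolevNorm (11 / 4) (u 0) < ⊤ ∧
          Tendsto (fun t => sobolevNorm (11 / 4) (u t)) (𝓝[<] (tt ε)) (𝓝 ⊤) ∧
          ∃ θ : Plane → ℝ, ContDiff ℝ ∞ θ ∧ HasCompactSupport θ ∧
            Tendsto (fun t => sobolevNorm (11 / 4) (fun x => θ x * u t x)) (𝓝[<] (tt ε)) (𝓝 ⊤) := by
  obtain ⟨C, hF, hfb, hfl⟩ := exists_sourceBound hf hf_bdd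
  obtain ⟨g₁, g₂, h₁, M₀, hM₀, D⟩ := exists_regularData hu₀_cont hu₁_cont hu₀ hu₁
  have hC := hF.nonneg
  have hκ' : 0 < 1 - κ := by linarith
  set Q := (1 + C * (2 + M₀ + C)) * ((1 + M₀ + C) * Real.exp (1 + C * (2 + M₀ + C))) with hQ
  have hQ0 : 0 ≤ Q := by positivity
  obtain ⟨h, hh, hh1, hCh, hsmall⟩ : ∃ h > 0, h ≤ 1 ∧ C * h ≤ (1 - κ) / 2 ∧ Q * h < 1 - κ := by
    refine ⟨min 1 ((1 - κ) / (2 * (C + Q + 1))), by positivity, min_le_left _ _, ?_, ?_⟩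
    · have e1 : C * min 1 ((1 - κ) / (2 * (C + Q + 1))) ≤ C * ((1 - κ) / (2 * (C + Q + 1))) := by
        gcongr
        exact min_le_right _ _
      refine e1.trans ?_
      rw [← mul_div_assoc, div_le_div_iff₀ (by positivity) (by positivity)]
      nlinarith
    · have e1 : Q * min 1 ((1 - κ) / (2 * (C + Q + 1))) ≤ Q * ((1 - κ) / (2 * (C + Q + 1))) := by
        gcongr
        exact min_le_right _ _
      refine e1.trans_lt ?_
      rw [← mul_div_assoc, div_lt_iff₀ (by positivity)]
      nlinarith
  set M₁ := M₀ + 2 with hM₁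
  set B : ℝ → ℝ := fun ε => |Real.log ε| ^ α - M₀ - C with hB
  set σ : ℝ → ℝ := fun ε => 2 * (1 + M₁) / B ε with hσ
  have hBlim : Tendsto B (𝓝[>] 0) atTop := by
    have := tendsto_atTop_add_const_right _ (-M₀ - C) (tendsto_abs_log_rpow_nhdsGT_zero hα)
    refine this.congr fun ε => ?_
    simp only [hB]
    ring
  have hσlim : Tendsto σ (𝓝[>] 0) (𝓝 0) := hBlim.const_div_atTop _
  have hsm : ∀ k r : ℝ, 0 < r → ∀ᶠ ε in 𝓝[>] (0 : ℝ), k * σ ε < r := fun k r hr => by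
    have := hσlim.const_mul k
    rw [mul_zero] at this
    exact this.eventually (gt_mem_nhds hr)
  have hev := (eventually_mul_abs_log_rpow_le α).and ((hBlim.eventually_ge_atTop (1 + M₁)).and
    ((hsm (2 * ((1 + C * (2 + M₁ + C)) * Real.exp (1 + C * (2 + M₁ + C)))) 1 one_pos).and
    ((hsm 1 h hh).and ((hsm (1 + M₁ + C) ((1 - κ) / 4 * h) (by positivity)).and
      (hsm (2 * (C + 1) * (1 + M₁ + C)) (3 / 4 * (1 - κ) ^ 2) (by positivity))))))
  obtain ⟨ε₀, hε₀, hsub⟩ := mem_nhdsGT_iff_exists_Ioo_subset.1 hev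
  have hmain : ∀ ε, ∃ T, ε ∈ Ioo 0 (min ε₀ (1 / 2)) → 0 < T ∧ T ≤ (1 + M₁ + C) * σ ε ∧
      ∃ u : ℝ → Plane → ℝ,
        IsClassicalSolution f u₀ (fun x => -χ ε x + u₁ x) T u ∧
        (∀ w : ℝ → Plane → ℝ, IsClassicalSolution f u₀ (fun x => -χ ε x + u₁ x) T w →
          ∀ t ∈ Ico 0 T, w t = u t) ∧
        Tendsto (fun t => sobolevNorm (11 / 4) (u t)) (𝓝[<] T) (𝓝 ⊤) ∧
        ∃ θ : Plane → ℝ, ContDiff ℝ ∞ θ ∧ HasCompactSupport θ ∧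
          Tendsto (fun t => sobolevNorm (11 / 4) (fun x => θ x * u t x)) (𝓝[<] T) (𝓝 ⊤) := by
    intro ε
    by_cases hε : ε ∈ Ioo 0 (min ε₀ (1 / 2))
    · obtain ⟨c1, c2, c3, c4, c5, c6⟩ := hsub ⟨hε.1, hε.2.trans_le (min_le_left _ _)⟩
      have hε2 : ε ∈ Ioo (0 : ℝ) (1 / 2) := ⟨hε.1, hε.2.trans_le (min_le_right _ _)⟩
      obtain ⟨d1, d2⟩ := hχ.axis hψ hα hε2
      obtain ⟨T, u, hT, hTle, hrest⟩ := D.exists_blowup hF hfb hfl hκ hh hh1 hCh hsmall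
        (hχ.smooth ε hε2) (hχ.compact ε hε2) (hyp ε hε2) (d1.trans c1) d2 hM₁ (B := B ε) rfl
        (σ := σ ε) rfl c2 c3.le (by linarith) c5 (by rw [← mul_assoc]; exact c6.le)
      exact ⟨T, fun _ => ⟨hT, hTle, u, hrest⟩⟩
    -- Outside the admissible range the value of the time is immaterial; 0 is a default.
    · exact ⟨0, fun h => absurd h hε⟩
  choose tt htt using hmain
  have hnear : ∀ᶠ ε in 𝓝[>] (0 : ℝ), ε ∈ Ioo 0 (min ε₀ (1 / 2)) :=
    Ioo_mem_nhdsGT (lt_min hε₀ (by norm_num))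
  refine ⟨ε₀, hε₀, tt, ?_, fun ε hε => ?_⟩
  · have hlim := hσlim.const_mul (1 + M₁ + C)
    rw [mul_zero] at hlim
    exact tendsto_of_tendsto_of_tendsto_of_le_of_le' tendsto_const_nhds hlim
      (hnear.mono fun ε hε => (htt ε hε).1.le) (hnear.mono fun ε hε => (htt ε hε).2.1)
  · obtain ⟨hT, -, u, hsol, huniq, hnorm, hloc⟩ := htt ε hε
    refine ⟨hT, u, hsol, huniq, ?_, hnorm, hloc⟩
    rw [show u 0 = u₀ from funext hsol.init]
    exact (sobolevNorm_mono (by norm_num) u₀).trans_lt hu₀
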